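/- All graphs are finite and simple. For a digraph $D$, a sub-digraph is \emph{Eulerian} if each vertex has equal in-degree and out-degree in it (it need not be connected, and it may have no arcs). Let $\mathcal{E}_e(D)$ and $\mathcal{E}_o(D)$ be the sets of spanning Eulerian sub-digraphs of $D$ with an even, respectively odd, number of arcs. An orientation $D$ of a graph is \emph{Alon--Tarsi} if $|\mathcal{E}_e(D)| \neq |\mathcal{E}_o(D)|$. \textbf{Theorem.} Let $l \in \{5,6,7\}$, let $G$ be a plane graph (a planar graph with a fixed embedding in the plane) that contains no cycle of length $4$ and no cycle of length $l$, and let $v_0$ be a vertex on the boundary of the outer face of $G$. Then there are a matching $M$ of $G$ that does not cover $v_0$ and an Alon--Tarsi orientation $D$ of $G-M$ (the graph obtained from $G$ by deleting the edges of $M$) such that $d_D^+(v) < 3$ for every vertex $v$ and $d_D^+(v_0) = 0$. -/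

import Mathlib

namespace AlonTarsi

variable {V : Type*}

/-! ### Plane graphs

A plane graph is given, up to homeomorphism, by the combinatorial data of its drawing: the cyclic
order of the edges around each vertex (a rotation system, or combinatorial map), from which the
boundary walks of the faces are read off; for a graph that may be disconnected, the grouping of
these boundary walks into faces; and the choice of the outer face. -/

/-- The places at which a vertex meets a face: a dart `d` stands for the corner at `d.fst` beside
`d`, and an isolated vertex has a single corner, all around it. -/
abbrev Corner (G : SimpleGraph V) : Type _ := G.Dart ⊕ {v : V // ∀ w, ¬ G.Adj v w}

/-- The vertex at which a corner is located. -/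
def Corner.vertex {G : SimpleGraph V} : Corner G → V
  | .inl d => d.fst
  | .inr v => v.1

/-- A plane embedding of a finite graph `G`, as a combinatorial map on the sphere with one face
singled out as the outer (unbounded) one. -/
structure PlaneEmbedding (G : SimpleGraph V) where
  /-- The next dart in the cyclic order around the same starting vertex. -/
  rot : Equiv.Perm G.Dart
  rot_fst : ∀ d, (rot d).fst = d.fst
  /-- The darts at each vertex form a single cycle of the rotation. -/
  rot_sameCycle : ∀ d e : G.Dart, d.fst = e.fst → rot.SameCycle d e
  /-- Two corners are related if they lie in the same face. -/
  sameFace : Setoid (Corner G)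
  /-- A face is closed under walking along its boundary: traverse the dart `d`, then
  continue with the dart that follows the reversed dart `d.symm` in the rotation. -/
  sameFace_next : ∀ d : G.Dart, sameFace (.inl d) (.inl (rot d.symm))
  /-- The components of `G` and the faces together form one connected surface: any two vertices
  are joined by a sequence of steps, each along an edge or across a face. -/
  connected : ∀ u v : V, Relation.EqvGen
    (fun a b => G.Adj a b ∨
      ∃ s t : Corner G, s.vertex = a ∧ t.vertex = b ∧ sameFace s t) u v
  /-- The surface is the sphere, i.e. the genus is zero: `|V| - |E| + |F| = 1 + c`, where `c` is
  the number of connected components of `G`. -/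
  genus_zero : Nat.card V + Nat.card (Quotient sameFace) =
    Nat.card G.edgeSet + 1 + Nat.card G.ConnectedComponent
  /-- The outer face. -/
  outer : Quotient sameFace

/-- The vertex `v` lies on the boundary of the outer face. -/
def PlaneEmbedding.OnOuterBoundary {G : SimpleGraph V} (E : PlaneEmbedding G) (v : V) : Prop :=
  ∃ s : Corner G, s.vertex = v ∧ Quotient.mk E.sameFace s = E.outer

/-- A graph is planar if it has a plane embedding. -/
def IsPlanar (G : SimpleGraph V) : Prop := Nonempty (PlaneEmbedding G)

/-- `G` contains no cycle of length `k` (as a subgraph, not necessarily induced). -/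
def NoCycleOfLength (G : SimpleGraph V) (k : ℕ) : Prop :=
  ∀ (v : V) (c : G.Walk v v), c.IsCycle → c.length ≠ k

/-- The family of planar graphs that contain no cycle of length `k` or `l`. -/
def PlanarFamily (k l : ℕ) (G : SimpleGraph V) : Prop :=
  IsPlanar G ∧ NoCycleOfLength G k ∧ NoCycleOfLength G l

/-! ### Alon–Tarsi orientations -/

/-- `D` is an orientation of `G`: every edge is replaced by exactly one of its two arcs, and there
are no other arcs. -/
def IsOrientation (G : SimpleGraph V) (D : Digraph V) : Prop :=
  (∀ u v, D.Adj u v → G.Adj u v) ∧ ∀ u v, G.Adj u v → Xor (D.Adj u v) (D.Adj v u)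

/-- The out-degree of a vertex in a digraph. -/
noncomputable def outDegree (D : Digraph V) (v : V) : ℕ := {w | D.Adj v w}.ncard

/-- The in-degree of a vertex in a digraph. -/
noncomputable def inDegree (D : Digraph V) (v : V) : ℕ := {w | D.Adj w v}.ncard

/-- The number of arcs of a digraph. -/
noncomputable def arcCount (D : Digraph V) : ℕ := {p : V × V | D.Adj p.1 p.2}.ncard

/-- A digraph is Eulerian if every vertex has equal out-degree and in-degree
(connectedness is not required). -/
def IsEulerian (D : Digraph V) : Prop := ∀ v, outDegree D v = inDegree D v

/-- The number of spanning Eulerian sub-digraphs with an even number of arcs, minus the number of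
those with an odd number of arcs. -/
noncomputable def diff (D : Digraph V) : ℤ :=
  ({H : Digraph V | H ≤ D ∧ IsEulerian H ∧ Even (arcCount H)}.ncard : ℤ) -
    ({H : Digraph V | H ≤ D ∧ IsEulerian H ∧ Odd (arcCount H)}.ncard : ℤ)

/-- `D` is an Alon–Tarsi orientation of `G`. -/
def IsATOrientation (G : SimpleGraph V) (D : Digraph V) : Prop :=
  IsOrientation G D ∧ diff D ≠ 0

/-- `D` is a good orientation of `G` with respect to `v₀`: it is Alon–Tarsi, all out-degrees are
less than `3`, and `v₀` has out-degree `0`. -/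
def IsGoodOrientation (G : SimpleGraph V) (v₀ : V) (D : Digraph V) : Prop :=
  IsATOrientation G D ∧ (∀ v, outDegree D v < 3) ∧ outDegree D v₀ = 0

/-- A valid matching of `(G, v₀)` is a matching that does not cover `v₀`. -/
def IsValidMatching {G : SimpleGraph V} (v₀ : V) (M : G.Subgraph) : Prop :=
  M.IsMatching ∧ v₀ ∉ M.verts

end AlonTarsi

/-! The orientation can be chosen acyclic. Then the arcless digraph is its only Eulerian
sub-digraph, so the two counts differ by 1. It therefore suffices to split the graph into a matching
that misses `v₀` and a graph with a ranking in which every vertex has at most two lower neighbours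
and `v₀` has none; arcs point downwards. This is `Decomposable`, and it is proved for all subgraphs
and all roots at once.

A vertex can be put on top of the ranking if at most two of the remaining neighbours are not its
partner in the matching. `Peels` records sequences of such removals together with the partners that
are still pending. In a minimal counterexample no sequence that removes a non-isolated vertex ends
without pending partners (`Irreducible`). Hence all non-isolated vertices other than the root have
degree at least 3, and vertices of degree 3 are not adjacent. Moreover, the removal of a vertex of
degree 3 propagates through light triangles, whose vertices have degrees 3 and 4. So a component of
light triangles has at most one vertex of degree 3, and if it has one, it has at least two slots
(`two_mul_card_le`). Seen from outside its light triangles, a slot acts like a vertex of degree 3;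
both kinds are called stars. Adjacent stars lie in a common light triangle (`star_adj_light`), and
several configurations at a vertex of degree 5 are impossible.

The contradiction comes from discharging. Forbidding cycles of lengths 4 and `l` implies that every
5-cycle has at most one edge in a triangle (`FewTriangles`). Euler's inequality for the subgraph
then says that the sum of `2 deg - 6` over the non-isolated vertices, plus 12, is at most 3 for each
triangular face plus 1 for each pentagonal face. The vertices pay these amounts: every triangle
receives 3 (`three_le_sum_pay3`) and every 5-cycle receives 1 (`one_le_total5`). No vertex spends
more than `2 deg - 6`, except that the root has 8 extra and a vertex of degree 3 in a light triangle
has 1 extra; the latter is financed by 1/2 saved at each of two slots. So the payments exceed the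
sum of `2 deg - 6` by at most 8, which is less than 12. -/

namespace AlonTarsi

open scoped Classical
open Finset

/-! ### Removal sequences and decompositions -/

section Peeling

variable {V : Type*} [Fintype V]

/-- The number of neighbours of `v`. -/
noncomputable def deg (H : SimpleGraph V) (v : V) : ℕ := #{w | H.Adj v w}

/-- The number of neighbours of `v` outside `B`. -/
noncomputable def rdeg (H : SimpleGraph V) (B : Finset V) (v : V) : ℕ := #{w | H.Adj v w ∧ w ∉ B}

/-- The additive form lets `omega` turn known removed neighbours into the bounds 2 and 3 that
`Peels` requires. -/
theorem rdeg_add_card_le {H : SimpleGraph V} {B S : Finset V} {v : V}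
    (hS : ∀ w ∈ S, H.Adj v w ∧ w ∈ B) : rdeg H B v + #S ≤ deg H v := by
  have hd : Disjoint (univ.filter fun w => H.Adj v w ∧ w ∉ B) S := by
    rw [Finset.disjoint_left]
    intro w hw hwS
    simp only [mem_filter, mem_univ, true_and] at hw
    exact hw.2 (hS w hwS).2
  unfold rdeg deg
  rw [← card_union_of_disjoint hd]
  apply card_le_card
  intro w hw
  simp only [mem_union, mem_filter, mem_univ, true_and] at hw ⊢
  rcases hw with hw | hw
  · exact hw.1
  · exact (hS w hw).1

theorem rdeg_le_deg (H : SimpleGraph V) (B : Finset V) (v : V) : rdeg H B v ≤ deg H v := by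
  simpa using rdeg_add_card_le (H := H) (B := B) (S := ∅) (v := v) (by simp)

theorem rdeg_add_one_le {H : SimpleGraph V} {B : Finset V} {v a : V} (ha : H.Adj v a)
    (haB : a ∈ B) : rdeg H B v + 1 ≤ deg H v := by
  simpa using rdeg_add_card_le (H := H) (B := B) (S := {a}) (v := v) (by simp [ha, haB])

theorem rdeg_add_two_le {H : SimpleGraph V} {B : Finset V} {v a b : V} (ha : H.Adj v a)
    (hb : H.Adj v b) (hab : a ≠ b) (haB : a ∈ B) (hbB : b ∈ B) :
    rdeg H B v + 2 ≤ deg H v := by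
  simpa [card_pair hab] using
    rdeg_add_card_le (H := H) (B := B) (S := {a, b}) (v := v) (by simp [ha, haB, hb, hbB])

theorem rdeg_add_three_le {H : SimpleGraph V} {B : Finset V} {v a b c : V} (ha : H.Adj v a)
    (hb : H.Adj v b) (hc : H.Adj v c) (hab : a ≠ b) (hac : a ≠ c) (hbc : b ≠ c)
    (haB : a ∈ B) (hbB : b ∈ B) (hcB : c ∈ B) : rdeg H B v + 3 ≤ deg H v := by
  have h3 : #({a, b, c} : Finset V) = 3 := by
    rw [card_eq_three]; exact ⟨a, b, c, hab, hac, hbc, rfl⟩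
  have := rdeg_add_card_le (H := H) (B := B) (S := {a, b, c}) (v := v)
    (by simp [ha, haB, hb, hbB, hc, hcB])
  omega

theorem rdeg_anti {H : SimpleGraph V} {B B' : Finset V} (h : B ⊆ B') (v : V) :
    rdeg H B' v ≤ rdeg H B v := by
  apply card_le_card
  intro w hw
  simp only [mem_filter, mem_univ, true_and] at hw ⊢
  exact ⟨hw.1, fun hB => hw.2 (h hB)⟩

/-- `H` decomposes into a matching that does not cover `v₀` and a graph in which every vertex has at
most two neighbours of lower rank, the vertex `v₀` none. -/
def Decomposable (H : SimpleGraph V) (v₀ : V) : Prop :=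
  ∃ (M : V → V → Prop) (r : V → ℕ), (∀ u v, M u v → H.Adj u v) ∧ (∀ u v, M u v → M v u) ∧
    (∀ u v w, M u v → M u w → v = w) ∧ (∀ v, ¬ M v₀ v) ∧ Function.Injective r ∧
    (∀ v, #{w | H.Adj v w ∧ ¬ M v w ∧ r w < r v} ≤ 2) ∧ ∀ v, H.Adj v₀ v → r v₀ < r v

/-- The graph obtained by isolating all vertices of `B`. -/
def isolate (H : SimpleGraph V) (B : Finset V) : SimpleGraph V where
  Adj u v := H.Adj u v ∧ u ∉ B ∧ v ∉ B
  symm := ⟨fun _ _ h => ⟨h.1.symm, h.2.2, h.2.1⟩⟩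
  loopless := ⟨fun v h => H.loopless.irrefl v h.1⟩

/-- `Peels H v₀ B Φ`: the vertices of `B` can be removed one after the other, each having at most two
remaining neighbours apart from its partner in a matching; the vertices of `Φ` are the remaining
partners of removed vertices. -/
inductive Peels (H : SimpleGraph V) (v₀ : V) : Finset V → Finset V → Prop
  | nil : Peels H v₀ ∅ ∅
  | peel {B Φ : Finset V} {v : V} : Peels H v₀ B Φ → v ≠ v₀ → v ∉ B → rdeg H B v ≤ 2 →
      Peels H v₀ (insert v B) (Φ.erase v)
  | pair {B Φ : Finset V} {v y : V} : Peels H v₀ B Φ → v ≠ v₀ → y ≠ v₀ → v ∉ B → y ∉ B →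
      v ∉ Φ → y ∉ Φ → H.Adj v y → rdeg H B v ≤ 3 → Peels H v₀ (insert v B) (insert y Φ)

/-- The rank function `r` with `v` moved to the top. -/
noncomputable def raise (r : V → ℕ) (v w : V) : ℕ := if w = v then univ.sup r + 1 else r w

theorem raise_self (r : V → ℕ) (v : V) : raise r v v = univ.sup r + 1 := if_pos rfl

theorem raise_of_ne (r : V → ℕ) {v w : V} (h : w ≠ v) : raise r v w = r w := if_neg h

theorem raise_lt_raise_self (r : V → ℕ) {v w : V} (h : w ≠ v) : raise r v w < raise r v v := by
  rw [raise_self, raise_of_ne r h]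
  exact Nat.lt_succ_of_le (le_sup (mem_univ w))

theorem raise_injective {r : V → ℕ} (hr : Function.Injective r) (v : V) :
    Function.Injective (raise r v) := by
  intro a b hab
  by_cases ha : a = v <;> by_cases hb : b = v
  · rw [ha, hb]
  · subst ha; exact absurd hab (raise_lt_raise_self r hb).ne'
  · subst hb; exact absurd hab (raise_lt_raise_self r ha).ne
  · rw [raise_of_ne r ha, raise_of_ne r hb] at hab; exact hr hab

/-- With `v` on top, no other vertex gains a lower neighbour, and `v` itself has at most its
unmatched remaining neighbours below it. Enlarging the matching only shrinks the counted sets, so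
both kinds of removal are covered. -/
theorem card_lower_raise_le {H : SimpleGraph V} {B : Finset V} {M M' : V → V → Prop} {r : V → ℕ}
    {v : V} (hM : ∀ a b, M a b → M' a b)
    (hv : #{w | (isolate H B).Adj v w ∧ ¬ M' v w} ≤ 2)
    (h : ∀ u, #{w | (isolate H (insert v B)).Adj u w ∧ ¬ M u w ∧ r w < r u} ≤ 2) (u : V) :
    #{w | (isolate H B).Adj u w ∧ ¬ M' u w ∧ raise r v w < raise r v u} ≤ 2 := by
  by_cases huv : u = v
  · subst huv
    refine le_trans (card_le_card ?_) hv
    intro w hw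
    simp only [mem_filter, mem_univ, true_and] at hw ⊢
    exact ⟨hw.1, hw.2.1⟩
  · refine le_trans (card_le_card ?_) (h u)
    intro w hw
    simp only [mem_filter, mem_univ, true_and] at hw ⊢
    obtain ⟨⟨h1, h2, h3⟩, h4, h5⟩ := hw
    have hwv : w ≠ v := by
      rintro rfl
      exact absurd h5 (raise_lt_raise_self r huv).le.not_gt
    rw [raise_of_ne r huv, raise_of_ne r hwv] at h5
    exact ⟨⟨h1, by simp [huv, h2], by simp [hwv, h3]⟩, fun h => h4 (hM _ _ h), h5⟩

theorem raise_root_lt {H : SimpleGraph V} {B : Finset V} {r : V → ℕ} {v v₀ : V} (hv : v ≠ v₀)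
    (h : ∀ w, (isolate H (insert v B)).Adj v₀ w → r v₀ < r w) (w : V)
    (hw : (isolate H B).Adj v₀ w) : raise r v v₀ < raise r v w := by
  by_cases hwv : w = v
  · rw [hwv]; exact raise_lt_raise_self r hv.symm
  · rw [raise_of_ne r hv.symm, raise_of_ne r hwv]
    exact h w ⟨hw.1, by simp [hv.symm, hw.2.1], by simp [hwv, hw.2.2]⟩

namespace Peels

variable {H : SimpleGraph V} {v₀ : V} {B Φ : Finset V}

theorem disjoint (h : Peels H v₀ B Φ) : Disjoint B Φ := by
  induction h with
  | nil => simp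
  | @peel B Φ v h hv hvB hd ih =>
    rw [Finset.disjoint_left] at ih ⊢
    intro w hw
    rw [mem_insert] at hw
    rw [mem_erase]
    rintro ⟨h1, h2⟩
    exact ih (hw.resolve_left h1) h2
  | @pair B Φ v y h hv hy hvB hyB hvΦ hyΦ hvy hd ih =>
    rw [Finset.disjoint_left] at ih ⊢
    intro w hw
    rw [mem_insert] at hw ⊢
    rcases hw with rfl | hw
    · rintro (h1 | h1)
      · exact hvy.ne h1
      · exact hvΦ h1
    · rintro (rfl | h1)
      · exact hyB hw
      · exact ih hw h1

/-- A repeated removal changes nothing, so it need not be checked that `v` is still present. -/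
theorem peel' (h : Peels H v₀ B Φ) {v : V} (hv : v ≠ v₀) (hd : rdeg H B v ≤ 2) :
    Peels H v₀ (insert v B) (Φ.erase v) := by
  by_cases hvB : v ∈ B
  · rw [insert_eq_of_mem hvB, erase_eq_of_notMem (Finset.disjoint_left.mp h.disjoint hvB)]
    exact h
  · exact h.peel hv hvB hd

/-- Earlier removals only lower remaining degrees, so the second sequence can be replayed after the
first one, provided that it touches no vertex removed or pending there. -/
theorem frame {B₁ Φ₁ : Finset V} (h₁ : Peels H v₀ B₁ Φ₁) (h : Peels H v₀ B Φ)
    (hd : ∀ v, v ∈ B ∨ v ∈ Φ → v ∉ B₁ ∧ v ∉ Φ₁) : Peels H v₀ (B₁ ∪ B) (Φ₁ ∪ Φ) := by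
  induction h with
  | nil => simpa using h₁
  | @peel B Φ v h hv hvB hr ih =>
    have hv' := hd v (Or.inl (mem_insert_self v B))
    have h' := ih (fun w hw => by
      by_cases hwv : w = v
      · rw [hwv]; exact hv'
      · exact hd w (hw.imp (mem_insert_of_mem) (fun h => mem_erase.mpr ⟨hwv, h⟩)))
    have h'' := h'.peel (v := v) hv (by simp [hvB, hv'.1])
      ((rdeg_anti subset_union_right v).trans hr)
    rwa [erase_union_distrib, erase_eq_of_notMem hv'.2, ← union_insert] at h''
  | @pair B Φ v y h hv hy hvB hyB hvΦ hyΦ hvy hr ih =>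
    have hv' := hd v (Or.inl (mem_insert_self v B))
    have hy' := hd y (Or.inr (mem_insert_self y Φ))
    have h' := ih (fun w hw => hd w (hw.imp mem_insert_of_mem mem_insert_of_mem))
    have h'' := h'.pair (v := v) (y := y) hv hy (by simp [hvB, hv'.1]) (by simp [hyB, hy'.1])
      (by simp [hvΦ, hv'.2]) (by simp [hyΦ, hy'.2]) hvy
      ((rdeg_anti subset_union_right v).trans hr)
    rwa [← union_insert, ← union_insert] at h''

/-- The removals are undone from the last to the first, each vertex returning on top of the ranking.
A pending partner has to be unmatched in what remains, because its matching edge is added when the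
removed neighbour returns. -/
theorem decomposable_aux (h : Peels H v₀ B Φ) : ∀ (M : V → V → Prop) (r : V → ℕ),
    (∀ u v, M u v → (isolate H B).Adj u v) → (∀ u v, M u v → M v u) →
    (∀ u v w, M u v → M u w → v = w) → (∀ v, ¬ M v₀ v) → (∀ u ∈ Φ, ∀ v, ¬ M u v) →
    Function.Injective r →
    (∀ v, #{w | (isolate H B).Adj v w ∧ ¬ M v w ∧ r w < r v} ≤ 2) →
    (∀ v, (isolate H B).Adj v₀ v → r v₀ < r v) → Decomposable H v₀ := by
  induction h with
  | nil =>
    intro M r h1 h2 h3 h4 _ h6 h7 h8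
    simp only [isolate, notMem_empty, not_false_eq_true, and_true] at h1 h7 h8
    exact ⟨M, r, h1, h2, h3, h4, h6, h7, h8⟩
  | @peel B Φ v h hv hvB hr ih =>
    intro M r h1 h2 h3 h4 h5 h6 h7 h8
    have hMv : ∀ w, ¬ M v w := fun w hw => (h1 _ _ hw).2.1 (mem_insert_self v B)
    refine ih M (raise r v) ?_ h2 h3 h4 ?_ (raise_injective h6 v)
      (card_lower_raise_le (fun _ _ h => h) ?_ h7) (raise_root_lt hv h8)
    · exact fun u w hw => ⟨(h1 _ _ hw).1, fun h => (h1 _ _ hw).2.1 (mem_insert_of_mem h),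
        fun h => (h1 _ _ hw).2.2 (mem_insert_of_mem h)⟩
    · intro u hu w
      by_cases huv : u = v
      · rw [huv]; exact hMv w
      · exact h5 u (mem_erase.mpr ⟨huv, hu⟩) w
    · refine le_trans (card_le_card ?_) hr
      intro w hw
      simp only [mem_filter, mem_univ, true_and] at hw ⊢
      exact ⟨hw.1.1, hw.1.2.2⟩
  | @pair B Φ v y h hv hy hvB hyB hvΦ hyΦ hvy hr ih =>
    intro M r h1 h2 h3 h4 h5 h6 h7 h8
    have hMv : ∀ w, ¬ M v w := fun w hw => (h1 _ _ hw).2.1 (mem_insert_self v B)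
    have hMv' : ∀ w, ¬ M w v := fun w hw => hMv w (h2 _ _ hw)
    have hMy : ∀ w, ¬ M y w := h5 y (mem_insert_self y Φ)
    have hMy' : ∀ w, ¬ M w y := fun w hw => hMy w (h2 _ _ hw)
    refine ih (fun a b => M a b ∨ (a = v ∧ b = y) ∨ (a = y ∧ b = v)) (raise r v) ?_ ?_ ?_ ?_ ?_
      (raise_injective h6 v) (card_lower_raise_le (fun _ _ h => Or.inl h) ?_ h7)
      (raise_root_lt hv h8)
    · rintro u w (hw | ⟨rfl, rfl⟩ | ⟨rfl, rfl⟩)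
      · exact ⟨(h1 _ _ hw).1, fun h => (h1 _ _ hw).2.1 (mem_insert_of_mem h),
          fun h => (h1 _ _ hw).2.2 (mem_insert_of_mem h)⟩
      · exact ⟨hvy, hvB, hyB⟩
      · exact ⟨hvy.symm, hyB, hvB⟩
    · rintro u w (hw | hw | hw)
      · exact Or.inl (h2 _ _ hw)
      · exact Or.inr (Or.inr hw.symm)
      · exact Or.inr (Or.inl hw.symm)
    · have hne := hvy.ne
      rintro a b c (hb | ⟨hb, hb'⟩ | ⟨hb, hb'⟩) (hc | ⟨hc, hc'⟩ | ⟨hc, hc'⟩)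
      · exact h3 a b c hb hc
      · exact absurd (hc ▸ hb) (hMv b)
      · exact absurd (hc ▸ hb) (hMy b)
      · exact absurd (hb ▸ hc) (hMv c)
      · rw [hb', hc']
      · exact absurd (hb.symm.trans hc) hne
      · exact absurd (hb ▸ hc) (hMy c)
      · exact absurd (hc.symm.trans hb) hne
      · rw [hb', hc']
    · rintro w (hw | hw | hw)
      · exact h4 w hw
      · exact hv hw.1.symm
      · exact hy hw.1.symm
    · rintro u hu w (hw | hw | hw)
      · exact h5 u (mem_insert_of_mem hu) w hw
      · exact hvΦ (hw.1 ▸ hu)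
      · exact hyΦ (hw.1 ▸ hu)
    -- The partner `y` is not counted, which brings three remaining neighbours down to two.
    · have hmem : y ∈ univ.filter fun w => H.Adj v w ∧ w ∉ B := by simp [hvy, hyB]
      have hcard := card_erase_of_mem hmem
      refine le_trans (card_le_card (t := (univ.filter fun w => H.Adj v w ∧ w ∉ B).erase y) ?_) ?_
      · intro w hw
        simp only [mem_filter, mem_univ, true_and, mem_erase] at hw ⊢
        refine ⟨fun hwy => hw.2 (Or.inr (Or.inl (by simp [hwy]))), hw.1.1, hw.1.2.2⟩
      · rw [hcard]
        unfold rdeg at hr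
        omega

theorem decomposable (h : Peels H v₀ B ∅) (hB : Decomposable (isolate H B) v₀) :
    Decomposable H v₀ := by
  obtain ⟨M, r, h1, h2, h3, h4, h6, h7, h8⟩ := hB
  exact h.decomposable_aux M r h1 h2 h3 h4 (by simp) h6 h7 h8

end Peels

/-- A vertex of degree one can be made the root in place of its neighbour. -/
theorem Decomposable.of_leaf {H : SimpleGraph V} {v₀ w : V} (hw : ∀ x, H.Adj v₀ x ↔ x = w)
    (h : Decomposable (isolate H {v₀}) w) : Decomposable H v₀ := by
  obtain ⟨M, r, h1, h2, h3, h4, h6, h7, h8⟩ := h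
  have hv₀ : ∀ x, ¬ M v₀ x := fun x hx => (h1 _ _ hx).2.1 (mem_singleton_self v₀)
  have hadj : ∀ x y, H.Adj x y → x ≠ v₀ → y ≠ v₀ → (isolate H {v₀}).Adj x y :=
    fun x y h hx hy => ⟨h, by simpa using hx, by simpa using hy⟩
  -- The vertex `v₀` goes to the bottom. As the root of the rest, `w` had no lower neighbour and now
  -- has only `v₀`; all other vertices keep their lower neighbours.
  refine ⟨M, fun x => if x = v₀ then 0 else r x + 1, fun u v h => (h1 u v h).1, h2, h3, hv₀, ?_, ?_, ?_⟩
  · intro a b hab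
    by_cases ha : a = v₀ <;> by_cases hb : b = v₀ <;> simp [ha, hb] at hab ⊢
    exact h6 hab
  · intro v
    by_cases hv : v = v₀
    · simp [hv]
    by_cases hvw : v = w
    · refine le_trans (card_le_card (t := {v₀}) ?_) (by simp)
      intro x hx
      simp only [mem_filter, mem_univ, true_and, mem_singleton] at hx ⊢
      by_contra hxv
      have := h8 x (hvw ▸ hadj _ _ hx.1 hv hxv)
      have h9 := hx.2.2
      rw [if_neg hxv, if_neg hv, hvw] at h9
      omega
    · refine le_trans (card_le_card ?_) (h7 v)
      intro x hx
      simp only [mem_filter, mem_univ, true_and] at hx ⊢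
      have hxv : x ≠ v₀ := by
        rintro rfl
        exact hvw ((hw v).mp hx.1.symm)
      refine ⟨hadj _ _ hx.1 hv hxv, hx.2.1, ?_⟩
      have h9 := hx.2.2
      rw [if_neg hxv, if_neg hv] at h9
      omega
  · intro v hv
    simp [hv.ne']

end Peeling

/-! ### Acyclic orientations are Alon–Tarsi -/

section Orientation

variable {V : Type*}

/-- Among the tails of arcs, take one of largest rank. It has an outgoing arc, hence an incoming
one, and the tail of the latter has larger rank. -/
theorem eq_bot_of_isEulerian [Finite V] {D K : Digraph V} {r : V → ℕ}
    (hr : ∀ u v, D.Adj u v → r v < r u) (hK : K ≤ D) (hE : IsEulerian K) : K = ⊥ := by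
  by_contra hne
  have hex : ∃ u v, K.Adj u v := by
    by_contra hcon
    push Not at hcon
    apply hne
    ext u v
    simp [hcon u v]
  obtain ⟨u, ⟨v, huv⟩, hmax⟩ := (Set.toFinite {u | ∃ v, K.Adj u v}).exists_maximalFor r _ hex
  have hpos : 0 < outDegree K u := (Set.ncard_pos (Set.toFinite _)).mpr ⟨v, huv⟩
  rw [hE u] at hpos
  obtain ⟨w, hw⟩ := (Set.ncard_pos (Set.toFinite _)).mp hpos
  have h1 := hr w u (hK hw)
  have h2 := hmax (j := w) ⟨u, hw⟩ h1.le
  omega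

theorem diff_eq_one [Finite V] {D : Digraph V} {r : V → ℕ}
    (hr : ∀ u v, D.Adj u v → r v < r u) : diff D = 1 := by
  have hcount : arcCount (⊥ : Digraph V) = 0 := by simp [arcCount]
  have hbot : IsEulerian (⊥ : Digraph V) := fun v => by simp [outDegree, inDegree]
  have h1 : {K : Digraph V | K ≤ D ∧ IsEulerian K ∧ Even (arcCount K)} = {⊥} := by
    ext K
    simp only [Set.mem_ofPred_eq, Set.mem_singleton_iff]
    constructor
    · exact fun h => eq_bot_of_isEulerian hr h.1 h.2.1
    · rintro rfl
      exact ⟨bot_le, hbot, by simp [hcount]⟩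
  have h2 : {K : Digraph V | K ≤ D ∧ IsEulerian K ∧ Odd (arcCount K)} = ∅ := by
    ext K
    simp only [Set.mem_ofPred_eq, Set.mem_empty_iff_false, iff_false]
    rintro ⟨h1, h2, h3⟩
    rw [eq_bot_of_isEulerian hr h1 h2, hcount] at h3
    exact absurd h3 (by decide)
  simp [diff, h1, h2]

/-- Unmatched edges are oriented towards the lower rank; injectivity of the rank makes the choice of
direction unambiguous. -/
theorem Decomposable.exists_goodOrientation [Fintype V] {G : SimpleGraph V} {v₀ : V}
    (h : Decomposable G v₀) : ∃ M : G.Subgraph, IsValidMatching v₀ M ∧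
      ∃ D : Digraph V, IsGoodOrientation (G.deleteEdges M.edgeSet) v₀ D := by
  obtain ⟨M, r, h1, h2, h3, h4, h6, h7, h8⟩ := h
  let S : G.Subgraph :=
    { verts := {v | ∃ w, M v w}
      Adj := M
      adj_sub := fun h => h1 _ _ h
      edge_vert := fun h => ⟨_, h⟩
      symm := ⟨h2⟩ }
  have hS : ∀ u v, (G.deleteEdges S.edgeSet).Adj u v ↔ G.Adj u v ∧ ¬ M u v := by
    intro u v
    rw [SimpleGraph.deleteEdges_adj, SimpleGraph.Subgraph.mem_edgeSet]
  refine ⟨S, ⟨fun v hv => ?_, fun hv => ?_⟩, ⟨fun u v => G.Adj u v ∧ ¬ M u v ∧ r v < r u⟩, ⟨⟨?_, ?_⟩, ?_⟩, ?_, ?_⟩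
  · obtain ⟨w, hw⟩ := hv
    exact ⟨w, hw, fun y hy => h3 v y w hy hw⟩
  · obtain ⟨w, hw⟩ := hv
    exact h4 w hw
  · exact fun u v h => (hS u v).mpr ⟨h.1, h.2.1⟩
  · intro u v h
    have hG := (hS u v).mp h
    have hne : r u ≠ r v := fun he => hG.1.ne (h6 he)
    rcases lt_or_gt_of_ne hne with hlt | hlt
    · exact Or.inr ⟨⟨hG.1.symm, fun h => hG.2 (h2 _ _ h), hlt⟩, fun h => absurd h.2.2 hlt.not_gt⟩
    · exact Or.inl ⟨⟨hG.1, hG.2, hlt⟩, fun h => absurd h.2.2 hlt.not_gt⟩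
  · rw [diff_eq_one (r := r) fun u v (h : G.Adj u v ∧ ¬ M u v ∧ r v < r u) => h.2.2]
    exact one_ne_zero
  · intro v
    have := h7 v
    rw [← Set.ncard_coe_finset] at this
    refine lt_of_le_of_lt (le_of_eq ?_) (Nat.lt_succ_of_le this)
    simp [outDegree]
  · unfold outDegree
    rw [Set.ncard_eq_zero (Set.toFinite _)]
    ext w
    simp only [Set.mem_ofPred_eq, Set.mem_empty_iff_false, iff_false]
    rintro ⟨a, -, c⟩
    exact absurd (h8 w a) c.not_gt

end Orientation

/-! ### Light triangles and the propagation of removals -/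

section Light

variable {V : Type*} [Fintype V]

/-- `H` has no `4`-cycle, and only isolated vertices of `H` can be peeled. -/
structure Irreducible (H : SimpleGraph V) (v₀ : V) : Prop where
  no_four : ∀ a b c d, H.Adj a b → H.Adj b c → H.Adj c d → H.Adj d a → a ≠ c → b = d
  peels : ∀ B, Peels H v₀ B ∅ → ∀ v ∈ B, deg H v = 0

/-- `v` is a vertex of degree `3` other than the root. -/
def D3 (H : SimpleGraph V) (v₀ v : V) : Prop := v ≠ v₀ ∧ deg H v = 3

/-- `v` is a vertex of degree `4` other than the root. -/
def D4 (H : SimpleGraph V) (v₀ v : V) : Prop := v ≠ v₀ ∧ deg H v = 4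

/-- `v` is a vertex of degree `3` or `4` other than the root. -/
def Small (H : SimpleGraph V) (v₀ v : V) : Prop := D3 H v₀ v ∨ D4 H v₀ v

/-- The graph of the edges in light triangles, those whose vertices are all small. -/
def light (H : SimpleGraph V) (v₀ : V) : SimpleGraph V where
  Adj a b := H.Adj a b ∧ ∃ c, H.Adj a c ∧ H.Adj b c ∧ Small H v₀ a ∧ Small H v₀ b ∧ Small H v₀ c
  symm := ⟨fun _ _ ⟨h, c, h1, h2, h3, h4, h5⟩ => ⟨h.symm, c, h2, h1, h4, h3, h5⟩⟩
  loopless := ⟨fun v h => H.loopless.irrefl v h.1⟩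

/-- `v` lies in a light triangle that is linked to a light triangle with a vertex of degree `3`. -/
def Active (H : SimpleGraph V) (v₀ v : V) : Prop :=
  (∃ a, (light H v₀).Adj v a) ∧ ∃ u, D3 H v₀ u ∧ (light H v₀).Reachable u v

/-- An active vertex of degree `4` that has a neighbour outside its light triangles. -/
def Slot (H : SimpleGraph V) (v₀ v : V) : Prop :=
  D4 H v₀ v ∧ Active H v₀ v ∧ ∃ w, H.Adj v w ∧ ¬ (light H v₀).Adj v w

/-- The vertices that can be peeled with one edge of a matching, vertices of degree `3` and
slots. -/
def Star (H : SimpleGraph V) (v₀ v : V) : Prop := D3 H v₀ v ∨ Slot H v₀ v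

/-- A light triangle `c y z` of which `c` has been removed, and either of `y`, `z` may be taken as
the only partner of a removed vertex. -/
structure PairState (H : SimpleGraph V) (v₀ : V) (B : Finset V) (c y z : V) : Prop where
  left : Peels H v₀ B {y}
  right : Peels H v₀ B {z}
  mem : c ∈ B
  adj_cy : H.Adj c y
  adj_cz : H.Adj c z
  adj_yz : H.Adj y z
  small_c : Small H v₀ c
  small_y : Small H v₀ y
  small_z : Small H v₀ z

variable {H : SimpleGraph V} {v₀ : V} {B Φ : Finset V}

theorem Small.ne {v : V} (h : Small H v₀ v) : v ≠ v₀ := h.elim And.left And.left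

theorem Small.deg_le {v : V} (h : Small H v₀ v) : deg H v ≤ 4 :=
  h.elim (fun h => h.2.le.trans (by norm_num)) (fun h => h.2.le)

theorem Small.deg_pos {v : V} (h : Small H v₀ v) : 0 < deg H v :=
  h.elim (fun h => h.2 ▸ by norm_num) (fun h => h.2 ▸ by norm_num)

theorem D3.not_D4 {v : V} (h : D3 H v₀ v) : ¬ D4 H v₀ v := fun h' => by
  have := h.2.symm.trans h'.2; omega

/-- An edge thus lies in at most one triangle. Many distinctness claims below rest on this. -/
theorem Irreducible.common_unique (hI : Irreducible H v₀) {a b c d : V} (hab : a ≠ b)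
    (hac : H.Adj a c) (hbc : H.Adj b c) (had : H.Adj a d) (hbd : H.Adj b d) : c = d :=
  hI.no_four a c b d hac hbc.symm hbd had.symm hab

theorem Irreducible.not_peels (hI : Irreducible H v₀) (h : Peels H v₀ B ∅) {v : V} (hv : v ∈ B)
    (hpos : 0 < deg H v) : False := hpos.ne' (hI.peels B h v hv)

theorem Irreducible.three_le_deg (hI : Irreducible H v₀) {v : V} (hv : v ≠ v₀)
    (hpos : 0 < deg H v) : 3 ≤ deg H v := by
  by_contra hlt
  have h := Peels.peel' (H := H) (v₀ := v₀) Peels.nil hv ((rdeg_le_deg H ∅ v).trans (by omega))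
  exact hI.not_peels h (mem_insert_self v _) hpos

theorem light_small {a b : V} (h : (light H v₀).Adj a b) : Small H v₀ a :=
  let ⟨_, _, _, _, h, _, _⟩ := h; h

theorem light_reachable_exists_adj {a b : V} (h : (light H v₀).Reachable a b) (hab : a ≠ b) :
    ∃ c, (light H v₀).Adj b c := by
  obtain ⟨p⟩ := h.symm
  cases p with
  | nil => exact absurd rfl hab
  | cons h _ => exact ⟨_, h⟩

theorem exists_adj_dist_lt {W : Type*} {K : SimpleGraph W} {a b : W} (h : K.Reachable a b) (hab : a ≠ b) :
    ∃ c, K.Adj a c ∧ K.dist c b < K.dist a b := by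
  obtain ⟨p, hp⟩ := h.exists_walk_length_eq_dist
  cases p with
  | nil => exact absurd rfl hab
  | @cons _ c _ h q =>
    refine ⟨c, h, lt_of_le_of_lt (SimpleGraph.dist_le q) ?_⟩
    rw [← hp, SimpleGraph.Walk.length_cons]
    omega

theorem Star.active_of_reachable {e s : V} (he : Star H v₀ e)
    (h : (light H v₀).Reachable e s) (hne : e ≠ s) : Active H v₀ s := by
  refine ⟨light_reachable_exists_adj h hne, ?_⟩
  rcases he with he | he
  · exact ⟨e, he, h⟩
  · obtain ⟨u, hu, hr⟩ := he.2.1.2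
    exact ⟨u, hu, hr.trans h⟩

namespace PairState

variable {c y z : V}

theorem swap (h : PairState H v₀ B c y z) : PairState H v₀ B c z y :=
  ⟨h.right, h.left, h.mem, h.adj_cz, h.adj_cy, h.adj_yz.symm, h.small_c, h.small_z, h.small_y⟩

theorem notMem_left (h : PairState H v₀ B c y z) : y ∉ B := fun hy =>
  Finset.disjoint_left.mp h.left.disjoint hy (mem_singleton_self y)

theorem notMem_right (h : PairState H v₀ B c y z) : z ∉ B := h.swap.notMem_left

theorem light_cy (h : PairState H v₀ B c y z) : (light H v₀).Adj c y :=
  ⟨h.adj_cy, z, h.adj_cz, h.adj_yz, h.small_c, h.small_y, h.small_z⟩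

theorem light_yz (h : PairState H v₀ B c y z) : (light H v₀).Adj y z :=
  ⟨h.adj_yz, c, h.adj_cy.symm, h.adj_cz.symm, h.small_y, h.small_z, h.small_c⟩

theorem rdeg_left_le (h : PairState H v₀ B c y z) : rdeg H B y ≤ 3 := by
  have h1 := rdeg_add_one_le h.adj_cy.symm h.mem
  have h2 := h.small_y.deg_le
  omega

/-- With a second neighbour removed, `y` can go without a partner while `z` is pending. Then `z` has
lost `c` and `y` and follows, and nothing is pending. -/
theorem false_of_mem (h : PairState H v₀ B c y z) (hI : Irreducible H v₀) {n : V} (hn : n ∈ B)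
    (hyn : H.Adj y n) (hnc : n ≠ c) : False := by
  have h1 := rdeg_add_two_le h.adj_cy.symm hyn hnc.symm h.mem hn
  have h2 := h.small_y.deg_le
  have h3 := h.right.peel' h.small_y.ne (by omega)
  rw [erase_eq_of_notMem (by simpa using h.adj_yz.ne)] at h3
  have h4 := rdeg_add_two_le (B := insert y B) h.adj_cz.symm h.adj_yz.symm h.adj_cy.ne
    (by simp [h.mem]) (by simp)
  have h5 := h.small_z.deg_le
  have h6 := h3.peel' h.small_z.ne (by omega)
  exact hI.not_peels (by simpa using h6) (mem_insert_self z _) h.small_z.deg_pos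

/-- While `z` is pending, `y` is removed with a partner in the next triangle `y y' z'`; then `z` has
lost `c` and `y` and goes as well. Either of `y'`, `z'` can be that partner, so the freedom of
choice is handed on. -/
theorem advance (h : PairState H v₀ B c y z) (hI : Irreducible H v₀) {y' z' : V}
    (hyy : H.Adj y y') (hyz : H.Adj y z') (hyz' : H.Adj y' z') (hc : y' ≠ c) (hz : y' ≠ z)
    (hs : Small H v₀ y') (hs' : Small H v₀ z') :
    PairState H v₀ (insert z (insert y B)) y y' z' := by
  have hc' : z' ≠ c := by
    rintro rfl
    exact hz (hI.common_unique hyz.ne hyy hyz'.symm h.adj_yz h.adj_cz)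
  have hz' : z' ≠ z := by
    rintro rfl
    exact hc (hI.common_unique hyz.ne hyy hyz'.symm h.adj_cy.symm h.adj_cz.symm)
  have key : ∀ t, H.Adj y t → t ≠ c → t ≠ z → Small H v₀ t →
      Peels H v₀ (insert z (insert y B)) {t} := by
    intro t hyt htc htz hst
    have htB : t ∉ B := fun ht => h.false_of_mem hI ht hyt htc
    have h1 := h.right.pair (v := y) (y := t) h.small_y.ne hst.ne h.notMem_left htB
      (by simpa using h.adj_yz.ne) (by simpa using htz) hyt h.rdeg_left_le
    have h4 := rdeg_add_two_le (B := insert y B) h.adj_cz.symm h.adj_yz.symm h.adj_cy.ne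
      (by simp [h.mem]) (by simp)
    have h5 := h.small_z.deg_le
    have h6 := h1.peel' h.small_z.ne (by omega)
    rwa [erase_insert_of_ne htz, erase_singleton, insert_empty_eq] at h6
  exact ⟨key y' hyy hc hz hs, key z' hyz hc' hz' hs', by simp, hyy, hyz, hyz', h.small_y, hs, hs'⟩

end PairState

/-- Every edge at a vertex of degree 3 may serve as its matching edge, and this starts a chain of
light triangles. -/
theorem D3.pairState {u y : V} (hu : D3 H v₀ u) (h : (light H v₀).Adj u y) :
    ∃ z, PairState H v₀ {u} u y z := by
  obtain ⟨huy, z, huz, hyz, hsu, hsy, hsz⟩ := h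
  have key : ∀ t, H.Adj u t → Small H v₀ t → Peels H v₀ {u} {t} := fun t ht hst => by
    simpa using Peels.pair (H := H) (v₀ := v₀) Peels.nil hu.1 hst.ne (by simp) (by simp) (by simp)
      (by simp) ht ((rdeg_le_deg H ∅ u).trans hu.2.le)
  exact ⟨z, key y huy hsy, key z huz hsz, by simp, huy, huz, hyz, hsu, hsy, hsz⟩

/-- The chain follows a shortest light path to `e`. Since `z` is nearer to `e` than `c`, the next
vertex on the path is not `c`. If it is `y`, the two free vertices exchange roles, otherwise the
chain advances; the distance from `z` decreases either way. The chain stops as soon as a free vertex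
is a target, so no target is removed. -/
theorem PairState.exists_target_aux (hI : Irreducible H v₀) (T : V → Prop) {e u : V} (hT : T e) :
    ∀ n B c y z, PairState H v₀ B c y z → (∀ x ∈ B, ¬ T x) →
      (∀ x ∈ B, (light H v₀).Reachable u x) → (light H v₀).Reachable u e →
      (light H v₀).dist z e = n → (light H v₀).dist z e < (light H v₀).dist c e →
      ∃ B c y z, PairState H v₀ B c y z ∧ T z ∧ (∀ x ∈ B, ¬ T x) ∧
        ∀ x ∈ B, (light H v₀).Reachable u x := by
  intro n
  induction n using Nat.strong_induction_on with
  | _ n ih =>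
  intro B c y z h hB hr hue hn hlt
  by_cases hz : T z
  · exact ⟨B, c, y, z, h, hz, hB, hr⟩
  by_cases hy : T y
  · exact ⟨B, c, z, y, h.swap, hy, hB, hr⟩
  have hrz : (light H v₀).Reachable u z := (hr c h.mem).trans h.swap.light_cy.reachable
  have hry : (light H v₀).Reachable u y := (hr c h.mem).trans h.light_cy.reachable
  obtain ⟨w, hw, hwlt⟩ := exists_adj_dist_lt (hrz.symm.trans hue) (fun he => hz (he ▸ hT))
  have hwc : w ≠ c := by rintro rfl; omega
  by_cases hwy : w = y
  · subst hwy
    exact ih _ (hn ▸ hwlt) B c z w h.swap hB hr hue rfl (hwlt.trans hlt)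
  · obtain ⟨hzw, t, hzt, hwt, -, hsw, hst⟩ := hw
    have h' := (h.swap.advance hI hzw hzt hwt hwc hwy hsw hst).swap
    refine ih _ (hn ▸ hwlt) _ _ _ _ h' ?_ ?_ hue rfl hwlt
    · intro x hx
      simp only [mem_insert] at hx
      rcases hx with rfl | rfl | hx
      exacts [hy, hz, hB x hx]
    · intro x hx
      simp only [mem_insert] at hx
      rcases hx with rfl | rfl | hx
      exacts [hry, hrz, hr x hx]

/-- Peeling along light triangles from a vertex of degree `3` until a target is met. -/
theorem Irreducible.exists_pairState (hI : Irreducible H v₀) (T : V → Prop) {e u : V}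
    (hu : D3 H v₀ u) (hue : (light H v₀).Reachable u e) (hT : T e) (hTu : ¬ T u) :
    ∃ B c y z, PairState H v₀ B c y z ∧ T z ∧ (∀ x ∈ B, ¬ T x) ∧
        ∀ x ∈ B, (light H v₀).Reachable u x := by
  obtain ⟨w, hw, hwlt⟩ := exists_adj_dist_lt hue (fun he => hTu (he ▸ hT))
  obtain ⟨z, hz⟩ := hu.pairState hw
  exact PairState.exists_target_aux hI T hT _ {u} u z w hz.swap (by simpa using hTu)
    (by simp) hue rfl hwlt

/-- Once a vertex of a component of the light graph is removed, the removal spreads through it. -/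
theorem Peels.spread {e : V} : ∀ n B c, Peels H v₀ B Φ → c ∈ B →
    (light H v₀).Reachable c e → e ∉ B → (∀ x ∈ Φ, (light H v₀).Reachable c x → x = e) →
    (light H v₀).dist c e = n → ∃ B', B ⊆ B' ∧ Peels H v₀ B' Φ ∧ e ∉ B' ∧
      (∃ m ∈ B', (light H v₀).Adj e m) ∧ ∀ x ∈ B', x ∈ B ∨ (light H v₀).Reachable c x := by
  intro n
  induction n using Nat.strong_induction_on with
  | _ n ih =>
  intro B c h hc hce he hΦ hn
  obtain ⟨w, hw, hwlt⟩ := exists_adj_dist_lt hce (fun hh => he (hh ▸ hc))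
  by_cases hwe : w = e
  · subst hwe
    exact ⟨B, Subset.rfl, h, he, ⟨c, hc, hw.symm⟩, fun x hx => Or.inl hx⟩
  have hcw : (light H v₀).Reachable c w := hw.reachable
  have step : ∀ B₁, B ⊆ B₁ → Peels H v₀ B₁ Φ → w ∈ B₁ → e ∉ B₁ →
      (∀ x ∈ B₁, x ∈ B ∨ (light H v₀).Reachable c x) →
      ∃ B', B ⊆ B' ∧ Peels H v₀ B' Φ ∧ e ∉ B' ∧
      (∃ m ∈ B', (light H v₀).Adj e m) ∧ ∀ x ∈ B', x ∈ B ∨ (light H v₀).Reachable c x := by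
    intro B₁ hB₁ h₁ hw₁ he₁ hr₁
    obtain ⟨B', h1, h2, h3, h4, h5⟩ := ih _ (hn ▸ hwlt) B₁ w h₁ hw₁ (hcw.symm.trans hce) he₁
      (fun x hx hr => hΦ x hx (hcw.trans hr)) rfl
    exact ⟨B', hB₁.trans h1, h2, h3, h4, fun x hx =>
      (h5 x hx).elim (hr₁ x) (fun hr => Or.inr (hcw.trans hr))⟩
  by_cases hwB : w ∈ B
  · exact step B Subset.rfl h hwB he (fun x hx => Or.inl hx)
  obtain ⟨hcw', t, hct, hwt, hsc, hsw, hst⟩ := hw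
  have hlct : (light H v₀).Adj c t := ⟨hct, w, hcw', hwt.symm, hsc, hst, hsw⟩
  by_cases hte : t = e
  · subst hte
    exact ⟨B, Subset.rfl, h, he, ⟨c, hc, hlct.symm⟩, fun x hx => Or.inl hx⟩
  have hwΦ : w ∉ Φ := fun hh => hwe (hΦ w hh hcw)
  have htΦ : t ∉ Φ := fun hh => hte (hΦ t hh hlct.reachable)
  have hdw := hsw.deg_le
  have hdt := hst.deg_le
  -- If `t` is gone too, `w` has lost two neighbours. Otherwise `w` is matched to `t`, which then
  -- has lost `c` and `w`. In both cases no additional partner remains pending.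
  by_cases htB : t ∈ B
  · have h1 := rdeg_add_two_le hcw'.symm hwt hct.ne hc htB
    have h2 := h.peel' hsw.ne (by omega)
    rw [erase_eq_of_notMem hwΦ] at h2
    refine step _ (subset_insert _ _) h2 (mem_insert_self _ _) (by simp [he, Ne.symm hwe]) ?_
    intro x hx
    rcases mem_insert.mp hx with rfl | hx
    exacts [Or.inr hcw, Or.inl hx]
  · have h1 := rdeg_add_one_le hcw'.symm hc
    have h2 := h.pair hsw.ne hst.ne hwB htB hwΦ htΦ hwt (by omega)
    have h3 := rdeg_add_two_le (B := insert w B) hct.symm hwt.symm hcw'.ne (by simp [hc])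
      (by simp)
    have h4 := h2.peel' hst.ne (by omega)
    rw [erase_insert htΦ] at h4
    refine step _ ((subset_insert _ _).trans (subset_insert _ _)) h4 (by simp)
      (by simp [he, Ne.symm hwe, Ne.symm hte]) ?_
    intro x hx
    simp only [mem_insert] at hx
    rcases hx with rfl | rfl | hx
    exacts [Or.inr hlct.reachable, Or.inr hcw, Or.inl hx]

end Light

/-! ### Stars: vertices of degree 3 and slots -/

section Stars

variable {V : Type*} [Fintype V] {H : SimpleGraph V} {v₀ : V} {B Φ : Finset V}

theorem PairState.rdeg_right_le {c y z : V} (h : PairState H v₀ B c y z) : rdeg H B z ≤ 3 :=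
  h.swap.rdeg_left_le

/-- Removing `z` from a pair state with the help of its partner `s`. -/
theorem PairState.finish {c y z s : V} (h : PairState H v₀ B c y z) (hzs : H.Adj z s)
    (hs : s ≠ v₀) (hsB : s ∉ B) (hsy : s ≠ y) : Peels H v₀ (insert y (insert z B)) {s} := by
  have h1 := h.left.pair (v := z) (y := s) h.small_z.ne hs h.notMem_right hsB
    (by simpa using h.adj_yz.ne') (by simpa using hsy) hzs h.rdeg_right_le
  have h4 := rdeg_add_two_le (B := insert z B) h.adj_cy.symm h.adj_yz h.adj_cz.ne
    (by simp [h.mem]) (by simp)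
  have h5 := h.small_y.deg_le
  have h6 := h1.peel' h.small_y.ne (by omega)
  rwa [erase_insert_of_ne hsy, erase_singleton, insert_empty_eq] at h6

theorem D3.peels_pair {u s : V} (hu : D3 H v₀ u) (hus : H.Adj u s) (hs : s ≠ v₀) :
    Peels H v₀ {u} {s} := by
  simpa using Peels.pair (H := H) (v₀ := v₀) Peels.nil hu.1 hs (by simp) (by simp) (by simp)
      (by simp) hus ((rdeg_le_deg H ∅ u).trans hu.2.le)

namespace Irreducible

/-- Once `u` is removed with partner `v`, only two neighbours of `v` remain. -/
theorem d3_not_adj (hI : Irreducible H v₀) {u v : V} (hu : D3 H v₀ u) (hv : D3 H v₀ v) :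
    ¬ H.Adj u v := by
  intro h
  have h1 := hu.peels_pair h hv.1
  have h2 := rdeg_add_one_le (B := {u}) h.symm (by simp)
  have h3 := hv.2
  have h4 := h1.peel' hv.1 (by omega)
  rw [erase_singleton] at h4
  exact hI.not_peels h4 (mem_insert_self v _) (by omega)

/-- A chain starting at `u` reaches `v` as a free vertex. Having degree 3 and one neighbour removed,
`v` needs no partner, and the chain closes with nothing pending. -/
theorem d3_unique (hI : Irreducible H v₀) {u v : V} (hu : D3 H v₀ u) (hv : D3 H v₀ v)
    (huv : (light H v₀).Reachable u v) : u = v := by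
  by_contra hne
  obtain ⟨B, c, y, z, h, rfl, -, -⟩ := hI.exists_pairState (· = v) hu huv rfl hne
  have h1 := rdeg_add_one_le h.adj_cz.symm h.mem
  have h2 := hv.2
  have h3 := h.left.peel' hv.1 (by omega)
  rw [erase_eq_of_notMem (by simpa using h.adj_yz.ne')] at h3
  have h4 := rdeg_add_two_le (B := insert z B) h.adj_cy.symm h.adj_yz h.adj_cz.ne
    (by simp [h.mem]) (by simp)
  have h5 := h.small_y.deg_le
  have h6 := h3.peel' h.small_y.ne (by omega)
  exact hI.not_peels (by simpa using h6) (mem_insert_self y _) h.small_y.deg_pos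

/-- A free vertex has degree 4 by uniqueness of the vertex of degree 3. If it is not a slot, all its
edges are light, so it has a further light triangle and the chain advances. The removed set grows,
so eventually both free vertices are slots. -/
theorem exists_two_slots_aux (hI : Irreducible H v₀) {u : V} (hu : D3 H v₀ u) :
    ∀ n B c y z, PairState H v₀ B c y z → #(univ \ B) = n → u ∈ B →
      (light H v₀).Reachable u c →
      ∃ e₁ e₂, e₁ ≠ e₂ ∧ Slot H v₀ e₁ ∧ Slot H v₀ e₂ ∧ (light H v₀).Reachable u e₁ ∧
        (light H v₀).Reachable u e₂ := by
  intro n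
  induction n using Nat.strong_induction_on with
  | _ n ih =>
  intro B c y z h hn huB huc
  have main : ∀ y z, PairState H v₀ B c y z → ¬ Slot H v₀ y →
      ∃ e₁ e₂, e₁ ≠ e₂ ∧ Slot H v₀ e₁ ∧ Slot H v₀ e₂ ∧ (light H v₀).Reachable u e₁ ∧
        (light H v₀).Reachable u e₂ := by
    intro y z h hns
    have huy := huc.trans h.light_cy.reachable
    have hy4 : D4 H v₀ y := by
      rcases h.small_y with hy | hy
      · exact absurd (hI.d3_unique hu hy huy ▸ huB) h.notMem_left
      · exact hy
    have hall : ∀ w, H.Adj y w → (light H v₀).Adj y w := by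
      by_contra hcon
      push Not at hcon
      exact hns ⟨hy4, ⟨⟨z, h.light_yz⟩, u, hu, huy⟩, hcon⟩
    have hex : ∃ w, H.Adj y w ∧ w ≠ c ∧ w ≠ z := by
      by_contra hcon
      push Not at hcon
      have hsub : (univ.filter fun w => H.Adj y w) ⊆ {c, z} := by
        intro w hw
        simp only [mem_filter, mem_univ, true_and] at hw
        by_cases hwc : w = c
        · simp [hwc]
        · simp [hcon w hw hwc]
      have hcard := card_le_card hsub
      have h4 : #(univ.filter fun w => H.Adj y w) = 4 := hy4.2
      have := card_le_two (a := c) (b := z)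
      omega
    obtain ⟨w, hyw, hwc, hwz⟩ := hex
    obtain ⟨-, t, hyt, hwt, -, hsw, hst⟩ := hall w hyw
    have h' := h.advance hI hyw hyt hwt hwc hwz hsw hst
    refine ih _ ?_ _ _ _ _ h' rfl (by simp [huB]) huy
    rw [← hn]
    apply card_lt_card
    refine ⟨sdiff_subset_sdiff Subset.rfl
      ((subset_insert _ _).trans (subset_insert _ _)), fun hsub => ?_⟩
    have := hsub (mem_sdiff.mpr ⟨mem_univ y, h.notMem_left⟩)
    simp at this
  by_cases hy : Slot H v₀ y
  · by_cases hz : Slot H v₀ z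
    · exact ⟨y, z, h.adj_yz.ne, hy, hz, huc.trans h.light_cy.reachable,
        huc.trans h.swap.light_cy.reachable⟩
    · exact main z y h.swap hz
  · exact main y z h hy

theorem exists_two_slots (hI : Irreducible H v₀) {u a : V} (hu : D3 H v₀ u)
    (ha : (light H v₀).Adj u a) :
    ∃ e₁ e₂, e₁ ≠ e₂ ∧ Slot H v₀ e₁ ∧ Slot H v₀ e₂ ∧ (light H v₀).Reachable u e₁ ∧
        (light H v₀).Reachable u e₂ := by
  obtain ⟨z, h⟩ := hu.pairState ha
  exact hI.exists_two_slots_aux hu _ _ _ _ _ h rfl (by simp) (SimpleGraph.Reachable.refl u)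

/-- The vertices of degree `3` in light triangles are at most half as many as the slots. -/
theorem two_mul_card_le (hI : Irreducible H v₀) :
    2 * #{u | D3 H v₀ u ∧ ∃ a, (light H v₀).Adj u a} ≤ #{e | Slot H v₀ e} := by
  set S : Finset V := {u | D3 H v₀ u ∧ ∃ a, (light H v₀).Adj u a} with hS
  have hex : ∀ u ∈ S, ∃ e : V × V, e.1 ≠ e.2 ∧ Slot H v₀ e.1 ∧ Slot H v₀ e.2 ∧
      (light H v₀).Reachable u e.1 ∧ (light H v₀).Reachable u e.2 := by
    intro u hu
    simp only [hS, mem_filter, mem_univ, true_and] at hu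
    obtain ⟨h3, a, ha⟩ := hu
    obtain ⟨e₁, e₂, h⟩ := hI.exists_two_slots h3 ha
    exact ⟨(e₁, e₂), h⟩
  choose! f hf using hex
  have h1 : 2 * #S = ∑ u ∈ S, #({(f u).1, (f u).2} : Finset V) := by
    rw [sum_congr rfl (fun u hu => card_pair (hf u hu).1), sum_const, smul_eq_mul, mul_comm]
  -- Slots chosen for different vertices of degree 3 lie in different light components, so the pairs
  -- are disjoint.
  rw [h1, ← card_biUnion]
  · apply card_le_card
    intro e he
    simp only [mem_biUnion, mem_insert, mem_singleton, mem_filter, mem_univ, true_and] at he ⊢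
    obtain ⟨u, hu, rfl | rfl⟩ := he
    · exact (hf u hu).2.1
    · exact (hf u hu).2.2.1
  · intro u hu v hv huv
    rw [Function.onFun, Finset.disjoint_left]
    intro e he he'
    simp only [mem_insert, mem_singleton] at he he'
    have hue : (light H v₀).Reachable u e := by
      rcases he with rfl | rfl
      exacts [(hf u hu).2.2.2.1, (hf u hu).2.2.2.2]
    have hve : (light H v₀).Reachable v e := by
      rcases he' with rfl | rfl
      exacts [(hf v hv).2.2.2.1, (hf v hv).2.2.2.2]
    have hu3 : D3 H v₀ u := (mem_filter.mp hu).2.1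
    have hv3 : D3 H v₀ v := (mem_filter.mp hv).2.1
    exact huv (hI.d3_unique hu3 hv3 (hue.trans hve.symm))

/-- A star can be removed with the help of one partner. -/
theorem peels_star (hI : Irreducible H v₀) {e s : V} (he : Star H v₀ e) (hes : H.Adj e s)
    (hs : s ≠ v₀) (hr : ¬ (light H v₀).Reachable e s) :
    ∃ B, Peels H v₀ B {s} ∧ e ∈ B ∧ ∀ x ∈ B, (light H v₀).Reachable e x := by
  rcases he with he | he
  · exact ⟨{e}, he.peels_pair hes hs, by simp, by simp⟩
  obtain ⟨u, hu, hue⟩ := he.2.1.2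
  obtain ⟨B, c, y, z, h, rfl, -, hB⟩ := hI.exists_pairState (· = e) hu hue rfl
    (fun hh => hu.not_D4 (hh ▸ he.1))
  have hB' : ∀ x ∈ B, (light H v₀).Reachable z x := fun x hx => hue.symm.trans (hB x hx)
  have hzy := h.light_yz.symm
  refine ⟨_, h.finish hes hs (fun hsB => hr (hB' s hsB)) ?_, by simp, ?_⟩
  · rintro rfl; exact hr hzy.reachable
  · intro x hx
    simp only [mem_insert] at hx
    rcases hx with rfl | rfl | hx
    exacts [hzy.reachable, SimpleGraph.Reachable.refl _, hB' x hx]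

/-- Two slots of one component, not in a common light triangle: after the removal of one of them,
all but a neighbour of the other is removed. -/
theorem peels_two_aux (hI : Irreducible H v₀) {e₁ e₂ : V} (h₁ : Slot H v₀ e₁) (h₂ : Slot H v₀ e₂)
    (hne : e₁ ≠ e₂) (hnl : ¬ (light H v₀).Adj e₁ e₂) (hr : (light H v₀).Reachable e₁ e₂) :
    ∃ B c y z z', PairState H v₀ B c y z ∧ (z = e₁ ∧ z' = e₂ ∨ z = e₂ ∧ z' = e₁) ∧ z' ∉ B ∧
      z' ≠ y ∧ ∀ x ∈ B, (light H v₀).Reachable e₁ x := by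
  obtain ⟨u, hu, hue⟩ := h₁.2.1.2
  obtain ⟨B, c, y, z, h, hz, hT, hB⟩ := hI.exists_pairState (fun x => x = e₁ ∨ x = e₂) hu hue
    (Or.inl rfl)
    (by rintro (hh | hh); exacts [hu.not_D4 (hh ▸ h₁.1), hu.not_D4 (hh ▸ h₂.1)])
  rcases hz with rfl | rfl
  · refine ⟨B, c, y, z, e₂, h, Or.inl ⟨rfl, rfl⟩, fun hh => hT _ hh (Or.inr rfl), ?_,
      fun x hx => hue.symm.trans (hB x hx)⟩
    rintro rfl; exact hnl h.light_yz.symm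
  · refine ⟨B, c, y, z, e₁, h, Or.inr ⟨rfl, rfl⟩, fun hh => hT _ hh (Or.inl rfl), ?_,
      fun x hx => hue.symm.trans (hB x hx)⟩
    rintro rfl; exact hnl h.light_yz

/-- If the edge were not light, `z` could be removed with partner `z'`, and the removal would spread
through the light component to another neighbour `m` of `z'`. Having lost `z` and `m`, the pending
vertex `z'` could then be removed too. -/
theorem slot_light_aux (hI : Irreducible H v₀) {z z' c y : V} (hz' : Slot H v₀ z')
    (h : PairState H v₀ B c y z) (hadj : H.Adj z z') (hzB : z' ∉ B) (hzy : z' ≠ y)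
    (hr : (light H v₀).Reachable z z') : (light H v₀).Adj z z' := by
  by_contra hnl
  have h1 := h.finish hadj hz'.1.1 hzB hzy
  obtain ⟨B', hBB, hP, hz'B, ⟨m, hm, hlm⟩, -⟩ := Peels.spread _ _ z h1 (by simp) hr
    (by simp [hzB, hzy, hadj.ne']) (by simp) rfl
  have h2 := rdeg_add_two_le (B := B') hadj.symm hlm.1 (by rintro rfl; exact hnl hlm.symm)
    (hBB (by simp)) hm
  have h3 := hz'.1.2
  have h4 := hP.peel' hz'.1.1 (by omega)
  rw [erase_singleton] at h4
  exact hI.not_peels h4 (mem_insert_self _ _) (by omega)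

/-- Adjacent stars lie in a common light triangle. -/
theorem star_adj_light (hI : Irreducible H v₀) {e₁ e₂ : V} (h₁ : Star H v₀ e₁)
    (h₂ : Star H v₀ e₂) (h : H.Adj e₁ e₂) : (light H v₀).Adj e₁ e₂ := by
  have key : ∀ {u e : V}, D3 H v₀ u → Slot H v₀ e → H.Adj u e → (light H v₀).Adj u e := by
    intro u e hu he hue
    by_contra hnl
    by_cases hr : (light H v₀).Reachable u e
    · obtain ⟨B', hBB, hP, -, ⟨m, hm, hlm⟩, -⟩ := Peels.spread _ _ u (hu.peels_pair hue he.1.1)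
        (by simp) hr (by simpa using hue.ne') (by simp) rfl
      have h2 := rdeg_add_two_le (B := B') hue.symm hlm.1 (by rintro rfl; exact hnl hlm.symm)
        (hBB (by simp)) hm
      have h3 := he.1.2
      have h4 := hP.peel' he.1.1 (by omega)
      rw [erase_singleton] at h4
      exact hI.not_peels h4 (mem_insert_self _ _) (by omega)
    · obtain ⟨B, hB, heB, -⟩ := hI.peels_star (Or.inr he) hue.symm hu.1 (fun hh => hr hh.symm)
      have h2 := rdeg_add_one_le hue heB
      have h3 := hu.2
      have h4 := hB.peel' hu.1 (by omega)
      rw [erase_singleton] at h4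
      exact hI.not_peels h4 (mem_insert_self _ _) (by omega)
  rcases h₁ with h₁ | h₁ <;> rcases h₂ with h₂ | h₂
  · exact absurd h (hI.d3_not_adj h₁ h₂)
  · exact key h₁ h₂ h
  · exact (key h₂ h₁ h.symm).symm
  · by_contra hnl
    by_cases hr : (light H v₀).Reachable e₁ e₂
    · obtain ⟨B, c, y, z, z', hP, hz, hzB, hzy, -⟩ := hI.peels_two_aux h₁ h₂ h.ne hnl hr
      rcases hz with ⟨rfl, rfl⟩ | ⟨rfl, rfl⟩
      · exact hnl (hI.slot_light_aux h₂ hP h hzB hzy hr)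
      · exact hnl (hI.slot_light_aux h₁ hP h.symm hzB hzy hr.symm).symm
    -- In different components, `e₁` is removed with partner `e₂`, and independently a chain reaches
    -- `e₂`, now called `z`, with `y` pending. Then `z` has lost `e₁` and `c`, and after it `y` has
    -- lost `c` and `z`.
    · obtain ⟨B, hB, heB, hBr⟩ := hI.peels_star (Or.inr h₁) h h₂.1.1 hr
      obtain ⟨u, hu, hue⟩ := h₂.2.1.2
      obtain ⟨B₂, c, y, z, hP, rfl, -, hB₂⟩ := hI.exists_pairState (· = e₂) hu hue rfl
        (fun hh => hu.not_D4 (hh ▸ h₂.1))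
      have hne : ∀ x, (light H v₀).Reachable z x → x ∉ B := fun x hx hxB =>
        hr ((hBr x hxB).trans hx.symm)
      have hF := hB.frame hP.left (by
        intro v hv
        have hzv : (light H v₀).Reachable z v := by
          rcases hv with hv | hv
          · exact hue.symm.trans (hB₂ v hv)
          · rw [mem_singleton.mp hv]; exact hP.light_yz.symm.reachable
        refine ⟨hne v hzv, ?_⟩
        rintro hv'
        rw [mem_singleton.mp hv'] at hv
        rcases hv with hv | hv
        · exact hP.notMem_right hv
        · exact hP.adj_yz.ne' (mem_singleton.mp hv))
      have h5 := rdeg_add_two_le (B := B ∪ B₂) h.symm hP.adj_cz.symm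
        (by rintro rfl; exact hne _ hP.swap.light_cy.symm.reachable heB) (by simp [heB])
        (by simp [hP.mem])
      have h6 := h₂.1.2
      have h7 := hF.peel' h₂.1.1 (by omega)
      have h8 := rdeg_add_two_le (B := insert z (B ∪ B₂)) hP.adj_cy.symm hP.adj_yz hP.adj_cz.ne
        (by simp [hP.mem]) (by simp)
      have h9 := hP.small_y.deg_le
      have h10 := h7.peel' hP.small_y.ne (by omega)
      have h11 : (({z} ∪ {y} : Finset V).erase z).erase y = ∅ := by
        ext x; simp; tauto
      rw [h11] at h10
      exact hI.not_peels h10 (mem_insert_self _ _) hP.small_y.deg_pos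

end Irreducible

end Stars

/-! ### Excluded configurations at vertices of degree 5 -/

section Configurations

variable {V : Type*} [Fintype V] {H : SimpleGraph V} {v₀ : V} {B Φ : Finset V}

theorem Star.not_reachable {e s : V} (he : Star H v₀ e) (hs : ¬ Active H v₀ s) (hne : e ≠ s) :
    ¬ (light H v₀).Reachable e s := fun h => hs (he.active_of_reachable h hne)

/-- The removal of `z` spreads to a neighbour of `z'`. With one of its four neighbours gone, `z'`
can be matched to `s'`. -/
theorem Peels.spread_pair {z z' s s' : V} (h : Peels H v₀ B {s}) (hz : z ∈ B)
    (hr : (light H v₀).Reachable z z') (hz' : D4 H v₀ z') (hzB : z' ∉ B) (hzs : z' ≠ s)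
    (hs : ¬ (light H v₀).Reachable z s) (hadj : H.Adj z' s') (hs'₀ : s' ≠ v₀)
    (hs' : ¬ (light H v₀).Reachable z s') (hs'B : s' ∉ B) (hss : s' ≠ s) :
    ∃ B', Peels H v₀ B' {s', s} ∧ B ⊆ B' ∧ z' ∈ B' ∧
      ∀ x ∈ B', x ∈ B ∨ (light H v₀).Reachable z x := by
  obtain ⟨B', hBB, hP, hz'B, ⟨m, hm, hlm⟩, hB'⟩ := Peels.spread _ _ z h hz hr hzB
    (by intro x hx hrx; rw [mem_singleton.mp hx] at hrx; exact absurd hrx hs) rfl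
  have h1 := rdeg_add_one_le hlm.1 hm
  have h2 := hz'.2
  have h3 := hP.pair hz'.1 hs'₀ hz'B (fun hh => (hB' _ hh).elim hs'B hs') (by simpa using hzs)
    (by simpa using hss) hadj (by omega)
  refine ⟨_, h3, hBB.trans (subset_insert _ _), mem_insert_self _ _, ?_⟩
  intro x hx
  rcases mem_insert.mp hx with rfl | hx
  exacts [Or.inr hr, hB' x hx]

/-- Two stars, not in a common light triangle, can be removed with the help of one partner each. -/
theorem Irreducible.peels_two_stars (hI : Irreducible H v₀) {e₁ e₂ s₁ s₂ : V}
    (h₁ : Star H v₀ e₁) (h₂ : Star H v₀ e₂) (hne : e₁ ≠ e₂) (hnl : ¬ (light H v₀).Adj e₁ e₂)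
    (ha₁ : H.Adj e₁ s₁) (ha₂ : H.Adj e₂ s₂) (hs₁ : s₁ ≠ v₀) (hs₂ : s₂ ≠ v₀) (hss : s₁ ≠ s₂)
    (hn₁ : ¬ Active H v₀ s₁) (hn₂ : ¬ Active H v₀ s₂) (h12 : s₁ ≠ e₂) (h21 : s₂ ≠ e₁) :
    ∃ B, Peels H v₀ B {s₁, s₂} ∧ e₁ ∈ B ∧ e₂ ∈ B ∧
      ∀ x ∈ B, (light H v₀).Reachable e₁ x ∨ (light H v₀).Reachable e₂ x := by
  have r11 := h₁.not_reachable hn₁ ha₁.ne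
  have r12 := h₁.not_reachable hn₂ h21.symm
  have r21 := h₂.not_reachable hn₁ h12.symm
  have r22 := h₂.not_reachable hn₂ ha₂.ne
  -- In one component, one star is removed first and the removal spreads to the other. In two
  -- components the removals do not interfere.
  by_cases hr : (light H v₀).Reachable e₁ e₂
  · have key : ∀ {z z' s s' : V} {B : Finset V}, Peels H v₀ B {s} → z ∈ B → D4 H v₀ z' → z' ∉ B →
        H.Adj z' s' → (z = e₁ ∧ z' = e₂ ∧ s = s₁ ∧ s' = s₂ ∨ z = e₂ ∧ z' = e₁ ∧ s = s₂ ∧ s' = s₁) →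
        (∀ x ∈ B, (light H v₀).Reachable e₁ x) →
        ∃ B, Peels H v₀ B {s₁, s₂} ∧ e₁ ∈ B ∧ e₂ ∈ B ∧
          ∀ x ∈ B, (light H v₀).Reachable e₁ x ∨ (light H v₀).Reachable e₂ x := by
      rintro z z' s s' B hP hz hz' hzB hadj (⟨rfl, rfl, rfl, rfl⟩ | ⟨rfl, rfl, rfl, rfl⟩) hB
      · obtain ⟨B', hP', hBB, hm, hr'⟩ := hP.spread_pair hz hr hz' hzB h12.symm r11 hadj hs₂ r12
          (fun hh => r12 (hB _ hh)) hss.symm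
        refine ⟨B', by rwa [pair_comm], hBB hz, hm, fun x hx => Or.inl ?_⟩
        exact (hr' x hx).elim (hB x) id
      · obtain ⟨B', hP', hBB, hm, hr'⟩ := hP.spread_pair hz hr.symm hz' hzB h21.symm r22 hadj hs₁
          r21 (fun hh => r11 (hB _ hh)) hss
        refine ⟨B', hP', hm, hBB hz, fun x hx => Or.inl ?_⟩
        exact (hr' x hx).elim (hB x) (fun h => hr.trans h)
    rcases h₁ with h₁ | h₁ <;> rcases h₂ with h₂ | h₂
    · exact absurd (hI.d3_unique h₁ h₂ hr) hne
    · exact key (h₁.peels_pair ha₁ hs₁) (mem_singleton_self _) h₂.1 (by simpa using hne.symm) ha₂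
        (Or.inl ⟨rfl, rfl, rfl, rfl⟩) (by simp)
    · exact key (h₂.peels_pair ha₂ hs₂) (mem_singleton_self _) h₁.1 (by simpa using hne) ha₁
        (Or.inr ⟨rfl, rfl, rfl, rfl⟩) (by simpa using hr)
    · obtain ⟨B, c, y, z, z', hP, hz, hzB, hzy, hB⟩ := hI.peels_two_aux h₁ h₂ hne hnl hr
      have hy : (light H v₀).Reachable e₁ y :=
        (hB c hP.mem).trans hP.light_cy.reachable
      have hB' : ∀ w, (light H v₀).Reachable e₁ w →
          ∀ x ∈ insert y (insert w B), (light H v₀).Reachable e₁ x := by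
        intro w hw x hx
        simp only [mem_insert] at hx
        rcases hx with rfl | rfl | hx
        exacts [hy, hw, hB x hx]
      rcases hz with ⟨rfl, rfl⟩ | ⟨rfl, rfl⟩
      · exact key (hP.finish ha₁ hs₁ (fun hh => r11 (hB _ hh)) (by rintro rfl; exact r11 hy))
          (by simp) h₂.1 (by simp [hzB, hzy, hne.symm]) ha₂ (Or.inl ⟨rfl, rfl, rfl, rfl⟩)
          (hB' _ (SimpleGraph.Reachable.refl _))
      · exact key (hP.finish ha₂ hs₂ (fun hh => r12 (hB _ hh)) (by rintro rfl; exact r12 hy))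
          (by simp) h₁.1 (by simp [hzB, hzy, hne]) ha₁ (Or.inr ⟨rfl, rfl, rfl, rfl⟩) (hB' _ hr)
  · obtain ⟨B₁, hP₁, hm₁, hB₁⟩ := hI.peels_star h₁ ha₁ hs₁ r11
    obtain ⟨B₂, hP₂, hm₂, hB₂⟩ := hI.peels_star h₂ ha₂ hs₂ r22
    refine ⟨B₁ ∪ B₂, hP₁.frame hP₂ ?_, by simp [hm₁], by simp [hm₂], ?_⟩
    · rintro v (hv | hv)
      · refine ⟨fun hh => hr ((hB₁ v hh).trans (hB₂ v hv).symm), fun hh => ?_⟩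
        rw [mem_singleton.mp hh] at hv
        exact r21 (hB₂ _ hv)
      · rw [mem_singleton.mp hv]
        exact ⟨fun hh => r12 (hB₁ _ hh), by simpa using hss.symm⟩
    · intro x hx
      exact (mem_union.mp hx).imp (hB₁ x) (hB₂ x)

/-- The edge `a b` lies in a triangle. -/
def Tri (H : SimpleGraph V) (a b : V) : Prop := H.Adj a b ∧ ∃ c, H.Adj a c ∧ H.Adj b c

/-- The triangle `p a w` with `a` of degree `3` and `w` of degree `4`. -/
structure ATri (H : SimpleGraph V) (v₀ p a w : V) : Prop where
  d3 : D3 H v₀ a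
  d4 : D4 H v₀ w
  pa : H.Adj p a
  pw : H.Adj p w
  aw : H.Adj a w

theorem Tri.symm {W : Type*} {H : SimpleGraph W} {a b : W} (h : Tri H a b) : Tri H b a :=
  ⟨h.1.symm, let ⟨c, h1, h2⟩ := h.2; ⟨c, h2, h1⟩⟩

theorem tri_of_light {a b : V} (h : (light H v₀).Adj a b) : Tri H a b :=
  ⟨h.1, let ⟨c, h1, h2, _⟩ := h.2; ⟨c, h1, h2⟩⟩

theorem not_active_of_not_small {p : V} (hp : ¬ Small H v₀ p) : ¬ Active H v₀ p :=
  fun h => hp (light_small h.1.choose_spec)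

theorem not_star_of_not_small {p : V} (hp : ¬ Small H v₀ p) : ¬ Star H v₀ p :=
  fun h => hp (h.imp id And.left)

theorem not_active_of_not_star {s n : V} (hs : D4 H v₀ s) (hns : ¬ Star H v₀ s) (hsn : H.Adj s n)
    (hn : ¬ (light H v₀).Adj s n) : ¬ Active H v₀ s :=
  fun h => hns (Or.inr ⟨hs, h, n, hsn, hn⟩)

theorem four_le_deg {v a b c d : V} (ha : H.Adj v a) (hb : H.Adj v b) (hc : H.Adj v c)
    (hd : H.Adj v d) (hab : a ≠ b) (hac : a ≠ c) (had : a ≠ d) (hbc : b ≠ c) (hbd : b ≠ d)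
    (hcd : c ≠ d) : 4 ≤ deg H v := by
  have h4 : #({a, b, c, d} : Finset V) = 4 := by
    rw [card_insert_of_notMem, card_insert_of_notMem, card_pair hcd] <;> simp [*]
  rw [← h4]
  apply card_le_card
  intro x hx
  simp only [mem_insert, mem_singleton, mem_filter, mem_univ, true_and] at hx ⊢
  rcases hx with rfl | rfl | rfl | rfl <;> assumption

/-- A vertex of degree `3` in a triangle that is not light is not in a light triangle. -/
theorem Irreducible.d3_not_light (hI : Irreducible H v₀) {u p w x : V} (hu : D3 H v₀ u)
    (hp : ¬ Small H v₀ p) (hup : H.Adj u p) (huw : H.Adj u w) (hpw : H.Adj p w) :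
    ¬ (light H v₀).Adj u x := by
  rintro ⟨hux, c, huc, hxc, -, hsx, hsc⟩
  have hxp : x ≠ p := fun h => hp (h ▸ hsx)
  have hcp : c ≠ p := fun h => hp (h ▸ hsc)
  have hxw : x ≠ w := by
    rintro rfl
    exact hcp (hI.common_unique hux.ne huc hxc hup hpw.symm)
  have hcw : c ≠ w := by
    rintro rfl
    exact hxp (hI.common_unique huc.ne hux hxc.symm hup hpw.symm)
  have := four_le_deg hux huc hup huw hxc.ne hxp hxw hcp hcw hpw.ne
  have := hu.2
  omega

theorem Irreducible.d3_not_active (hI : Irreducible H v₀) {u p w : V} (hu : D3 H v₀ u)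
    (hp : ¬ Small H v₀ p) (hup : H.Adj u p) (huw : H.Adj u w) (hpw : H.Adj p w) :
    ¬ Active H v₀ u := fun h => hI.d3_not_light hu hp hup huw hpw h.1.choose_spec

namespace ATri

variable {p a w a' w' : V}

theorem tri_pa (h : ATri H v₀ p a w) : Tri H p a := ⟨h.pa, w, h.pw, h.aw⟩

theorem tri_pw (h : ATri H v₀ p a w) : Tri H p w := ⟨h.pw, a, h.pa, h.aw.symm⟩

theorem not_active_a (h : ATri H v₀ p a w) (hI : Irreducible H v₀) (hp : ¬ Small H v₀ p) :
    ¬ Active H v₀ a := hI.d3_not_active h.d3 hp h.pa.symm h.aw h.pw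

/-- A star `w` would share a light triangle with `a`, but at degree 3 there is room for one triangle
only, and that one contains `p`. -/
theorem not_star_w (h : ATri H v₀ p a w) (hI : Irreducible H v₀) (hp : ¬ Small H v₀ p) :
    ¬ Star H v₀ w := fun hw =>
  hI.d3_not_light h.d3 hp h.pa.symm h.aw h.pw (hI.star_adj_light (Or.inl h.d3) hw h.aw)

theorem not_active_w (h : ATri H v₀ p a w) (hI : Irreducible H v₀) (hp : ¬ Small H v₀ p) :
    ¬ Active H v₀ w :=
  not_active_of_not_star h.d4 (h.not_star_w hI hp) h.pw.symm (fun hl => hp (light_small hl.symm))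

theorem ne_aw (h : ATri H v₀ p a w) (h' : ATri H v₀ p a' w') : a ≠ w' :=
  fun he => h.d3.not_D4 (he ▸ h'.d4)

theorem ne_w (h : ATri H v₀ p a w) (h' : ATri H v₀ p a' w') (hI : Irreducible H v₀)
    (hne : a ≠ a') : w ≠ w' := by
  rintro rfl
  exact hne (hI.common_unique h.pw.ne h.pa h.aw.symm h'.pa h'.aw.symm)

end ATri

theorem notMem_of_not_active {e x : V} (he : Star H v₀ e)
    (hB : ∀ x ∈ B, (light H v₀).Reachable e x) (hx : ¬ Active H v₀ x) (hne : e ≠ x) : x ∉ B :=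
  fun hh => he.not_reachable hx hne (hB x hh)

variable {p a w a' w' q r s y z : V}

theorem not_small_of_deg_five (hp : deg H p = 5) : ¬ Small H v₀ p := fun h => by
  have := h.deg_le; omega

/-- A vertex of degree `5` in two triangles with vertices of degrees `3` and `4`: its fifth
neighbour is not a star. -/
theorem Irreducible.poor_not_star (hI : Irreducible H v₀) (hp₀ : p ≠ v₀) (hp : deg H p = 5)
    (h : ATri H v₀ p a w) (h' : ATri H v₀ p a' w') (haa : a ≠ a') (hpq : H.Adj p q)
    (hnt : ¬ Tri H p q) : ¬ Star H v₀ q := by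
  intro hq
  have hps := not_small_of_deg_five (v₀ := v₀) hp
  have hpa := not_active_of_not_small hps
  have hqa : q ≠ a := by rintro rfl; exact hnt h.tri_pa
  have hqw : q ≠ w := by rintro rfl; exact hnt h.tri_pw
  have hqa' : q ≠ a' := by rintro rfl; exact hnt h'.tri_pa
  have hqw' : q ≠ w' := by rintro rfl; exact hnt h'.tri_pw
  obtain ⟨B, hP, hqB, hB⟩ := hI.peels_star hq hpq.symm hp₀ (hq.not_reachable hpa hpq.ne')
  have haB := notMem_of_not_active hq hB (h.not_active_a hI hps) hqa
  have hwB := notMem_of_not_active hq hB (h.not_active_w hI hps) hqw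
  have haB' := notMem_of_not_active hq hB (h'.not_active_a hI hps) hqa'
  have hwB' := notMem_of_not_active hq hB (h'.not_active_w hI hps) hqw'
  have hww := h.ne_w h' hI haa
  have haw := h.ne_aw h'
  have haw' := h'.ne_aw h
  have d1 := h.d3.2
  have d2 := h.d4.2
  have d3 := h'.d3.2
  have d4 := h'.d4.2
  -- After `q` with partner `p`: `a` is matched to `w` and `a'` to `w'`; then `p` has lost `q`, `a`,
  -- `a'`; then `w` has lost `a`, `p`, and `w'` has lost `a'`, `p`.
  have P1 := hP.pair h.d3.1 h.d4.1 haB hwB (by simpa using h.pa.ne') (by simpa using h.pw.ne') h.aw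
    ((rdeg_le_deg _ _ _).trans d1.le)
  have P2 := P1.pair h'.d3.1 h'.d4.1 (by simp [haB', haa.symm]) (by simp [hwB', haw.symm])
    (by simp [haw', h'.pa.ne']) (by simp [hww.symm, h'.pw.ne']) h'.aw
    ((rdeg_le_deg _ _ _).trans d3.le)
  have e1 := rdeg_add_three_le (B := insert a' (insert a B)) hpq h.pa h'.pa hqa hqa' haa
    (by simp [hqB]) (by simp) (by simp)
  have P3 := P2.peel' hp₀ (by omega)
  have e2 := rdeg_add_two_le (B := insert p (insert a' (insert a B))) h.aw.symm h.pw.symm h.pa.ne'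
    (by simp) (by simp)
  have P4 := P3.peel' h.d4.1 (by omega)
  have e3 := rdeg_add_two_le (B := insert w (insert p (insert a' (insert a B)))) h'.aw.symm
    h'.pw.symm h'.pa.ne' (by simp) (by simp)
  have P5 := P4.peel' h'.d4.1 (by omega)
  refine hI.not_peels (B := insert w' (insert w (insert p (insert a' (insert a B))))) ?_
    (mem_insert_self _ _) (by omega)
  convert P5 using 1
  symm
  ext x
  simp
  tauto

/-- In the situation of `Irreducible.poor_not_star`, the neighbours of the vertices of degree `4`
are not stars. -/
theorem Irreducible.poor_not_star_of_adj (hI : Irreducible H v₀) (hp₀ : p ≠ v₀) (hp : deg H p = 5)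
    (h : ATri H v₀ p a w) (h' : ATri H v₀ p a' w') (haa : a ≠ a') (hws : H.Adj w s)
    (hsa : s ≠ a) : ¬ Star H v₀ s := by
  intro hs
  have hps := not_small_of_deg_five (v₀ := v₀) hp
  have hpa := not_active_of_not_small hps
  have hsp : s ≠ p := by rintro rfl; exact not_star_of_not_small hps hs
  have hsa' : s ≠ a' := by
    rintro rfl
    exact haa (hI.common_unique h.pw.ne h.pa h.aw.symm h'.pa hws)
  have hsw' : s ≠ w' := by rintro rfl; exact h'.not_star_w hI hps hs
  obtain ⟨B, hP, hsB, hB⟩ := hI.peels_star hs hws.symm h.d4.1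
    (hs.not_reachable (h.not_active_w hI hps) hws.ne')
  have haB := notMem_of_not_active hs hB (h.not_active_a hI hps) hsa
  have hwB := notMem_of_not_active hs hB (h.not_active_w hI hps) hws.ne'
  have hpB := notMem_of_not_active hs hB hpa hsp
  have haB' := notMem_of_not_active hs hB (h'.not_active_a hI hps) hsa'
  have hwB' := notMem_of_not_active hs hB (h'.not_active_w hI hps) hsw'
  have hww := h.ne_w h' hI haa
  have haw := h.ne_aw h'
  have haw' := h'.ne_aw h
  have d1 := h.d3.2
  have d2 := h.d4.2
  have d3 := h'.d3.2
  have d4 := h'.d4.2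
  -- After `s` with partner `w`: `a` is matched to `p`; `w` has lost `s`, `a`; `a'` is matched to
  -- `w'`; `p` has lost `a`, `w`, `a'`; `w'` has lost `a'`, `p`.
  have P1 := hP.pair h.d3.1 hp₀ haB hpB (by simpa using h.aw.ne) (by simpa using h.pw.ne) h.pa.symm
    ((rdeg_le_deg _ _ _).trans d1.le)
  have e1 := rdeg_add_two_le (B := insert a B) hws h.aw.symm hsa (by simp [hsB]) (by simp)
  have P2 := P1.peel' h.d4.1 (by omega)
  have P3 := P2.pair h'.d3.1 h'.d4.1 (by simp [haB', haa.symm, haw'])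
    (by simp [hwB', haw.symm, hww.symm]) (by simp [h'.pa.ne']) (by simp [h'.pw.ne']) h'.aw
    ((rdeg_le_deg _ _ _).trans d3.le)
  have e2 := rdeg_add_three_le (B := insert a' (insert w (insert a B))) h.pa h.pw h'.pa
    h.aw.ne haa haw'.symm (by simp) (by simp) (by simp)
  have P4 := P3.peel' hp₀ (by omega)
  have e3 := rdeg_add_two_le (B := insert p (insert a' (insert w (insert a B)))) h'.aw.symm
    h'.pw.symm h'.pa.ne' (by simp) (by simp)
  have P5 := P4.peel' h'.d4.1 (by omega)
  refine hI.not_peels (B := insert w' (insert p (insert a' (insert w (insert a B))))) ?_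
    (mem_insert_self _ _) (by omega)
  convert P5 using 1
  symm
  ext x
  simp
  tauto

/-- In a `5`-cycle `a p q r s` with no edge in a triangle except `a p`, the vertices `q` and `s` are
not active if they have degree `4` and `r` is a star. -/
theorem Irreducible.not_active_of_cycle (hI : Irreducible H v₀) {n : V} (hr : Star H v₀ r)
    (hq : D4 H v₀ q) (hqr : H.Adj q r) (hn : H.Adj q n) (hqrt : ¬ Tri H q r) (hnt : ¬ Tri H q n) :
    ¬ Active H v₀ q := by
  refine not_active_of_not_star hq (fun hs => hqrt ?_) hn (fun hl => hnt (tri_of_light hl))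
  exact tri_of_light (hI.star_adj_light hs hr hqr)

/-- In the situation of `Irreducible.poor_not_star`, a `5`-cycle `a p q r s` has at most two
vertices that are stars or of degree at least `5`. -/
theorem Irreducible.poor_cycle (hI : Irreducible H v₀) (hp₀ : p ≠ v₀) (hp : deg H p = 5)
    (h : ATri H v₀ p a w) (h' : ATri H v₀ p a' w') (haa : a ≠ a') (hpq : H.Adj p q)
    (hqr : H.Adj q r) (hrs : H.Adj r s) (hsa : H.Adj s a) (nra : r ≠ a) (npr : p ≠ r)
    (tpq : ¬ Tri H p q) (tqr : ¬ Tri H q r) (trs : ¬ Tri H r s)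
    (tsa : ¬ Tri H s a) (hr : Star H v₀ r) (hq : D4 H v₀ q) : ¬ D4 H v₀ s := by
  intro hs
  have hps := not_small_of_deg_five (v₀ := v₀) hp
  have hpa := not_active_of_not_small hps
  have hqA : ¬ Active H v₀ q := hI.not_active_of_cycle hr hq hqr hpq.symm tqr (fun t => tpq t.symm)
  have hsA : ¬ Active H v₀ s := hI.not_active_of_cycle hr hs hrs.symm hsa (fun t => trs t.symm) tsa
  have hqa : q ≠ a := by rintro rfl; exact tpq h.tri_pa
  have hqw : q ≠ w := by rintro rfl; exact tpq h.tri_pw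
  have hqa' : q ≠ a' := by rintro rfl; exact tpq h'.tri_pa
  have hqw' : q ≠ w' := by rintro rfl; exact tpq h'.tri_pw
  have hadj : ∀ x, H.Adj p x → r ≠ x := by
    rintro x hx rfl
    exact tpq ⟨hpq, r, hx, hqr⟩
  have hra' := hadj a' h'.pa
  have hrw := hadj w h.pw
  have hrw' := hadj w' h'.pw
  have hsw : s ≠ w := by rintro rfl; exact tsa ⟨h.aw.symm, p, h.pw.symm, h.pa.symm⟩
  have hsp : ∀ x, H.Adj p x → x ≠ w → s ≠ x := by
    rintro x hx hxw rfl
    exact hxw (hI.common_unique h.pa.ne hx hsa.symm h.pw h.aw)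
  have hww := h.ne_w h' hI haa
  have haw := h.ne_aw h'
  have haw' := h'.ne_aw h
  have hsa' := hsp a' h'.pa haw'
  have hsw' := hsp w' h'.pw hww.symm
  have hnps : s ≠ p := by rintro rfl; exact hps (Or.inr hs)
  obtain ⟨B, hP, hrB, hB⟩ := hI.peels_star hr hqr.symm hq.1 (hr.not_reachable hqA hqr.ne')
  have haB := notMem_of_not_active hr hB (h.not_active_a hI hps) nra
  have hwB := notMem_of_not_active hr hB (h.not_active_w hI hps) hrw
  have hpB := notMem_of_not_active hr hB hpa npr.symm
  have hsB := notMem_of_not_active hr hB hsA hrs.ne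
  have haB' := notMem_of_not_active hr hB (h'.not_active_a hI hps) hra'
  have hwB' := notMem_of_not_active hr hB (h'.not_active_w hI hps) hrw'
  have hnqs : s ≠ q := by rintro rfl; exact tsa ⟨hsa, p, hpq.symm, h.pa.symm⟩
  have d1 := h.d3.2
  have d2 := h.d4.2
  have d3 := h'.d3.2
  have d4 := h'.d4.2
  have d5 := hq.2
  have d6 := hs.2
  -- After `r` with partner `q`: `a` is matched to `s` and `a'` to `w'`; `p`, having lost `a` and
  -- `a'`, is matched to `w`. The pending vertices follow: `w` has lost `a`, `p`; `w'` has lost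
  -- `a'`, `p`; `q` has lost `r`, `p`; `s` has lost `a`, `r`.
  have P1 := hP.pair h.d3.1 hs.1 haB hsB (by simpa using hqa.symm) (by simpa using hnqs) hsa.symm
    ((rdeg_le_deg _ _ _).trans d1.le)
  have P2 := P1.pair h'.d3.1 h'.d4.1 (by simp [haB', haa.symm]) (by simp [hwB', haw.symm])
    (by simp [hsa'.symm, hqa'.symm]) (by simp [hsw'.symm, hqw'.symm]) h'.aw
    ((rdeg_le_deg _ _ _).trans d3.le)
  have e1 := rdeg_add_two_le (B := insert a' (insert a B)) h.pa h'.pa haa (by simp) (by simp)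
  have P3 := P2.pair (v := p) (y := w) hp₀ h.d4.1 (by simp [hpB, h.pa.ne, h'.pa.ne])
    (by simp [hwB, h.aw.ne', haw'.symm]) (by simp [h'.pw.ne, hnps.symm, hpq.ne])
    (by simp [hww, hsw.symm, hqw.symm]) h.pw (by omega)
  have e2 := rdeg_add_two_le (B := insert p (insert a' (insert a B))) h.aw.symm h.pw.symm h.pa.ne'
    (by simp) (by simp)
  have P4 := P3.peel' h.d4.1 (by omega)
  have e3 := rdeg_add_two_le (B := insert w (insert p (insert a' (insert a B)))) h'.aw.symm
    h'.pw.symm h'.pa.ne' (by simp) (by simp)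
  have P5 := P4.peel' h'.d4.1 (by omega)
  have e4 := rdeg_add_two_le (B := insert w' (insert w (insert p (insert a' (insert a B))))) hqr
    hpq.symm npr.symm (by simp [hrB]) (by simp)
  have P6 := P5.peel' hq.1 (by omega)
  have e5 := rdeg_add_two_le
    (B := insert q (insert w' (insert w (insert p (insert a' (insert a B)))))) hsa hrs.symm
    nra.symm (by simp) (by simp [hrB])
  have P7 := P6.peel' hs.1 (by omega)
  refine hI.not_peels
    (B := insert s (insert q (insert w' (insert w (insert p (insert a' (insert a B))))))) ?_
    (mem_insert_self _ _) (by omega)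
  convert P7 using 1
  symm
  ext x
  simp
  tauto

/-- A vertex of degree `5` in a triangle with vertices of degrees `3` and `4` and in a triangle with
a slot and a vertex of degree `4`: its fifth neighbour is not a star. -/
theorem Irreducible.slot_not_star (hI : Irreducible H v₀) (hp₀ : p ≠ v₀) (hp : deg H p = 5)
    (h : ATri H v₀ p a w) (hy : Slot H v₀ y) (hz : D4 H v₀ z) (hpy : H.Adj p y) (hpz : H.Adj p z)
    (hyz : H.Adj y z) (hpq : H.Adj p q) (hnt : ¬ Tri H p q) : ¬ Star H v₀ q := by
  intro hq
  have hps := not_small_of_deg_five (v₀ := v₀) hp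
  have hpa := not_active_of_not_small hps
  have hya : y ≠ a := fun he => h.d3.not_D4 (he ▸ hy.1)
  have hza : z ≠ a := fun he => h.d3.not_D4 (he ▸ hz)
  have hyw : y ≠ w := by rintro rfl; exact h.not_star_w hI hps (Or.inr hy)
  have hzw : z ≠ w := by
    rintro rfl
    exact hya (hI.common_unique hpz.ne hpy hyz.symm h.pa h.aw.symm)
  have hqa : q ≠ a := by rintro rfl; exact hnt h.tri_pa
  have hqw : q ≠ w := by rintro rfl; exact hnt h.tri_pw
  have hqy : q ≠ y := by rintro rfl; exact hnt ⟨hpq, z, hpz, hyz⟩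
  have hqz : q ≠ z := by rintro rfl; exact hnt ⟨hpq, y, hpy, hyz.symm⟩
  have hnl : ¬ (light H v₀).Adj y z := by
    rintro ⟨-, c, hyc, hzc, -, -, hsc⟩
    exact hps (hI.common_unique hyz.ne hyc hzc hpy.symm hpz.symm ▸ hsc)
  have hzA : ¬ Active H v₀ z := not_active_of_not_star hz
    (fun hs => hnl (hI.star_adj_light (Or.inr hy) hs hyz)) hyz.symm (fun hl => hnl hl.symm)
  obtain ⟨B, hP, hqB, hyB, hB⟩ := hI.peels_two_stars hq (Or.inr hy) hqy
    (fun hl => hnt ⟨hpq, y, hpy, hl.1⟩) hpq.symm hyz hp₀ hz.1 hpz.ne hpa hzA hpy.ne hqz.symm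
  have hB' : ∀ x, ¬ Active H v₀ x → q ≠ x → y ≠ x → x ∉ B := fun x hx h1 h2 hh =>
    (hB x hh).elim (hq.not_reachable hx h1) (Star.not_reachable (Or.inr hy) hx h2)
  have haB := hB' a (h.not_active_a hI hps) hqa hya
  have hwB := hB' w (h.not_active_w hI hps) hqw hyw
  have d1 := h.d3.2
  have d2 := h.d4.2
  have d3 := hz.2
  -- After the stars `q` with partner `p` and `y` with partner `z`: `a` is matched to `w`; `p` has
  -- lost `q`, `y`, `a`; `w` has lost `a`, `p`; `z` has lost `y`, `p`.
  have P1 := hP.pair h.d3.1 h.d4.1 haB hwB (by simp [h.pa.ne', hza.symm])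
    (by simp [h.pw.ne', hzw.symm]) h.aw ((rdeg_le_deg _ _ _).trans d1.le)
  have e1 := rdeg_add_three_le (B := insert a B) hpq hpy h.pa hqy hqa hya (by simp [hqB])
    (by simp [hyB]) (by simp)
  have P2 := P1.peel' hp₀ (by omega)
  have e2 := rdeg_add_two_le (B := insert p (insert a B)) h.aw.symm h.pw.symm h.pa.ne' (by simp)
    (by simp)
  have P3 := P2.peel' h.d4.1 (by omega)
  have e3 := rdeg_add_two_le (B := insert w (insert p (insert a B))) hyz.symm hpz.symm hpy.ne'
    (by simp [hyB]) (by simp)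
  have P4 := P3.peel' hz.1 (by omega)
  refine hI.not_peels (B := insert z (insert w (insert p (insert a B)))) ?_
    (mem_insert_self _ _) (by omega)
  convert P4 using 1
  symm
  ext x
  simp
  tauto

/-- A triangle with a vertex of degree `3` and two vertices of degree `5`, both of them in a triangle
with vertices of degrees `3` and `4`: the fifth neighbours are not stars. -/
theorem Irreducible.twin_not_star (hI : Irreducible H v₀) (hp₀ : p ≠ v₀) (hp : deg H p = 5)
    (hz₀ : z ≠ v₀) (hz : deg H z = 5) (h : ATri H v₀ p a w) (h' : ATri H v₀ z a' w')
    (hy : D3 H v₀ y) (hpy : H.Adj p y) (hpz : H.Adj p z) (hyz : H.Adj y z) (hpq : H.Adj p q)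
    (hnt : ¬ Tri H p q) : ¬ Star H v₀ q := by
  intro hq
  have hps := not_small_of_deg_five (v₀ := v₀) hp
  have hzs := not_small_of_deg_five (v₀ := v₀) hz
  have hpa := not_active_of_not_small hps
  have hyA := hI.d3_not_active hy hps hpy.symm hyz hpz
  have hpz' : ∀ x, H.Adj p x → H.Adj z x → x = y := fun x h1 h2 =>
    hI.common_unique hpz.ne h1 h2 hpy hyz.symm
  have hzw : z ≠ w := by rintro rfl; exact hzs (Or.inr h.d4)
  have hpw' : p ≠ w' := by rintro rfl; exact hps (Or.inr h'.d4)
  have hza : z ≠ a := by rintro rfl; exact hzs (Or.inl h.d3)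
  have hpa' : p ≠ a' := by rintro rfl; exact hps (Or.inl h'.d3)
  have hya : y ≠ a := by
    rintro rfl
    exact hzw (hI.common_unique hpy.ne hpz hyz h.pw h.aw)
  have hya' : y ≠ a' := by
    rintro rfl
    exact hpw' (hI.common_unique hyz.ne hpy.symm hpz.symm h'.aw h'.pw)
  have hyw : y ≠ w := fun he => hy.not_D4 (he ▸ h.d4)
  have hyw' : y ≠ w' := fun he => hy.not_D4 (he ▸ h'.d4)
  have haa : a ≠ a' := by rintro rfl; exact hya (hpz' a h.pa h'.pa).symm
  have hww : w ≠ w' := by rintro rfl; exact hyw (hpz' w h.pw h'.pw).symm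
  have haw : a ≠ w' := fun he => h.d3.not_D4 (he ▸ h'.d4)
  have haw' : a' ≠ w := fun he => h'.d3.not_D4 (he ▸ h.d4)
  have hqa : q ≠ a := by rintro rfl; exact hnt h.tri_pa
  have hqw : q ≠ w := by rintro rfl; exact hnt h.tri_pw
  have hqa' : q ≠ a' := by rintro rfl; exact hnt ⟨hpq, z, hpz, h'.pa.symm⟩
  have hqw' : q ≠ w' := by rintro rfl; exact hnt ⟨hpq, z, hpz, h'.pw.symm⟩
  have hqy : q ≠ y := by rintro rfl; exact hnt ⟨hpq, z, hpz, hyz⟩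
  have hqz : q ≠ z := by rintro rfl; exact hnt ⟨hpq, y, hpy, hyz.symm⟩
  obtain ⟨B, hP, hqB, hB⟩ := hI.peels_star hq hpq.symm hp₀ (hq.not_reachable hpa hpq.ne')
  have haB := notMem_of_not_active hq hB (h.not_active_a hI hps) hqa
  have hwB := notMem_of_not_active hq hB (h.not_active_w hI hps) hqw
  have haB' := notMem_of_not_active hq hB (h'.not_active_a hI hzs) hqa'
  have hwB' := notMem_of_not_active hq hB (h'.not_active_w hI hzs) hqw'
  have hyB := notMem_of_not_active hq hB hyA hqy
  have hzB := notMem_of_not_active hq hB (not_active_of_not_small hzs) hqz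
  have d1 := h.d3.2
  have d2 := h.d4.2
  have d3 := h'.d3.2
  have d4 := h'.d4.2
  have d5 := hy.2
  -- After `q` with partner `p`: `a` is matched to `w`, `a'` to `w'` and `y` to `z`; `p` has lost
  -- `q`, `a`, `y`; `z` has lost `y`, `a'`, `p`; `w` has lost `a`, `p`; `w'` has lost `a'`, `z`.
  have P1 := hP.pair h.d3.1 h.d4.1 haB hwB (by simpa using h.pa.ne') (by simpa using h.pw.ne') h.aw
    ((rdeg_le_deg _ _ _).trans d1.le)
  have P2 := P1.pair h'.d3.1 h'.d4.1 (by simp [haB', haa.symm]) (by simp [hwB', haw.symm])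
    (by simp [haw', hpa'.symm]) (by simp [hww.symm, hpw'.symm]) h'.aw
    ((rdeg_le_deg _ _ _).trans d3.le)
  have P3 := P2.pair (v := y) (y := z) hy.1 hz₀ (by simp [hyB, hya, hya'])
    (by simp [hzB, hza, h'.pa.ne]) (by simp [hyw, hyw', hpy.ne'])
    (by simp [hzw, h'.pw.ne, hpz.ne']) hyz ((rdeg_le_deg _ _ _).trans d5.le)
  have e1 := rdeg_add_three_le (B := insert y (insert a' (insert a B))) hpq h.pa hpy hqa hqy
    hya.symm (by simp [hqB]) (by simp) (by simp)
  have P4 := P3.peel' hp₀ (by omega)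
  have e2 := rdeg_add_three_le (B := insert p (insert y (insert a' (insert a B)))) hyz.symm h'.pa
    hpz.symm hya' hpy.ne' hpa'.symm (by simp) (by simp) (by simp)
  have P5 := P4.peel' hz₀ (by omega)
  have e3 := rdeg_add_two_le (B := insert z (insert p (insert y (insert a' (insert a B)))))
    h.aw.symm h.pw.symm h.pa.ne' (by simp) (by simp)
  have P6 := P5.peel' h.d4.1 (by omega)
  have e4 := rdeg_add_two_le
    (B := insert w (insert z (insert p (insert y (insert a' (insert a B))))))
    h'.aw.symm h'.pw.symm h'.pa.ne' (by simp) (by simp)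
  have P7 := P6.peel' h'.d4.1 (by omega)
  refine hI.not_peels
    (B := insert w' (insert w (insert z (insert p (insert y (insert a' (insert a B))))))) ?_
    (mem_insert_self _ _) (by omega)
  convert P7 using 1
  symm
  ext x
  simp
  tauto

/-- A vertex `p` of degree `5` in a triangle with vertices of degrees `3` and `4` and in another
triangle with a vertex `y` of degree `3`: if `a p q r s` is a `5`-cycle with `r` a star and `q`, `s`
of degree `4`, then `q` has no second neighbour that is a star. -/
theorem Irreducible.double_cycle (hI : Irreducible H v₀) {r' : V} (hp₀ : p ≠ v₀) (hp : deg H p = 5)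
    (h : ATri H v₀ p a w) (hy : D3 H v₀ y) (hpy : H.Adj p y) (hpz : H.Adj p z) (hyz : H.Adj y z)
    (hya : y ≠ a) (hpq : H.Adj p q)
    (hqr : H.Adj q r) (hrs : H.Adj r s) (hsa : H.Adj s a) (nra : r ≠ a) (npr : p ≠ r)
    (tpq : ¬ Tri H p q) (tqr : ¬ Tri H q r) (trs : ¬ Tri H r s)
    (tsa : ¬ Tri H s a) (hr : Star H v₀ r) (hq : D4 H v₀ q) (hs : D4 H v₀ s)
    (hqr' : H.Adj q r') (hrr : r ≠ r') (npr' : p ≠ r') : ¬ Star H v₀ r' := by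
  intro hr'
  have hps := not_small_of_deg_five (v₀ := v₀) hp
  have hpa := not_active_of_not_small hps
  have hyA := hI.d3_not_active hy hps hpy.symm hyz hpz
  have hqA : ¬ Active H v₀ q := hI.not_active_of_cycle hr hq hqr hpq.symm tqr (fun t => tpq t.symm)
  have hsA : ¬ Active H v₀ s := hI.not_active_of_cycle hr hs hrs.symm hsa (fun t => trs t.symm) tsa
  have hqa : q ≠ a := by rintro rfl; exact tpq h.tri_pa
  have hqw : q ≠ w := by rintro rfl; exact tpq h.tri_pw
  have hqy : q ≠ y := by rintro rfl; exact tpq ⟨hpq, z, hpz, hyz⟩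
  have hadj : ∀ x, H.Adj p x → r ≠ x := by
    rintro x hx rfl
    exact tpq ⟨hpq, r, hx, hqr⟩
  have hadj' : ∀ x, H.Adj p x → r' ≠ x := by
    rintro x hx rfl
    exact tpq ⟨hpq, r', hx, hqr'⟩
  have hsw : s ≠ w := by rintro rfl; exact tsa ⟨h.aw.symm, p, h.pw.symm, h.pa.symm⟩
  have hyw : y ≠ w := fun he => hy.not_D4 (he ▸ h.d4)
  have hsy : s ≠ y := fun he => hy.not_D4 (he ▸ hs)
  have hsp : s ≠ p := by rintro rfl; exact hps (Or.inr hs)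
  have hnqs : s ≠ q := by rintro rfl; exact tsa ⟨hsa, p, hpq.symm, h.pa.symm⟩
  have hsr' : s ≠ r' := by
    rintro rfl
    exact trs ⟨hrs, q, hqr.symm, hqr'.symm⟩
  obtain ⟨B, hP, hrB, hrB', hB⟩ := hI.peels_two_stars hr hr' hrr
    (fun hl => tqr ⟨hqr, r', hqr', hl.1⟩) hrs hqr'.symm hs.1 hq.1 hnqs hsA hqA hsr' hqr.ne
  have hB' : ∀ x, ¬ Active H v₀ x → r ≠ x → r' ≠ x → x ∉ B := fun x hx h1 h2 hh =>
    (hB x hh).elim (hr.not_reachable hx h1) (hr'.not_reachable hx h2)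
  have haB := hB' a (h.not_active_a hI hps) (hadj a h.pa) (hadj' a h.pa)
  have hwB := hB' w (h.not_active_w hI hps) (hadj w h.pw) (hadj' w h.pw)
  have hyB := hB' y hyA (hadj y hpy) (hadj' y hpy)
  have hpB := hB' p hpa npr.symm npr'.symm
  have d1 := h.d3.2
  have d2 := h.d4.2
  have d3 := hy.2
  have d5 := hq.2
  have d6 := hs.2
  -- After `r` with partner `s` and `r'` with partner `q`: `q` has lost `r`, `r'`; `a` is matched to
  -- `w` and `y` to `p`; `p` has lost `q`, `a`, `y`; `w` has lost `a`, `p`; `s` has lost `a`, `r`.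
  have e1 := rdeg_add_two_le hqr hqr' hrr hrB hrB'
  have P1 := hP.peel' hq.1 (by omega)
  have P2 := P1.pair (v := a) (y := w) h.d3.1 h.d4.1 (by simp [haB, hqa.symm])
    (by simp [hwB, hqw.symm]) (by simp [hsa.ne', hqa.symm]) (by simp [hsw.symm, hqw.symm])
    h.aw ((rdeg_le_deg _ _ _).trans d1.le)
  have P3 := P2.pair (v := y) (y := p) hy.1 hp₀ (by simp [hyB, hqy.symm, hya])
    (by simp [hpB, hpq.ne, h.pa.ne]) (by simp [hyw, hsy.symm, hqy.symm])
    (by simp [h.pw.ne, hsp.symm, hpq.ne]) hpy.symm ((rdeg_le_deg _ _ _).trans d3.le)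
  have e2 := rdeg_add_three_le (B := insert y (insert a (insert q B))) hpq h.pa hpy hqa hqy
    hya.symm (by simp) (by simp) (by simp)
  have P4 := P3.peel' hp₀ (by omega)
  have e3 := rdeg_add_two_le (B := insert p (insert y (insert a (insert q B))))
    h.aw.symm h.pw.symm h.pa.ne' (by simp) (by simp)
  have P5 := P4.peel' h.d4.1 (by omega)
  have e4 := rdeg_add_two_le (B := insert w (insert p (insert y (insert a (insert q B))))) hsa
    hrs.symm nra.symm (by simp) (by simp [hrB])
  have P6 := P5.peel' hs.1 (by omega)
  refine hI.not_peels (B := insert s (insert w (insert p (insert y (insert a (insert q B)))))) ?_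
    (mem_insert_self _ _) (by omega)
  convert P6 using 1
  symm
  ext x
  simp
  tauto

end Configurations

/-! ### Euler's inequality for subgraphs -/

section Faces

/-- At most the classes of `a` and `b` are merged. Sending the class of `a` to `none` and every
other class to its image is injective. This serves for faces and for components. -/
theorem card_quotient_le_succ {α : Type*} [Finite α] {s s' : Setoid α} {a b : α}
    (h : ∀ x y, s' x y → s x y ∨ (s x a ∧ s b y) ∨ (s x b ∧ s a y)) (hle : s ≤ s') :
    Nat.card (Quotient s) ≤ Nat.card (Quotient s') + 1 := by
  have hf : Function.Injective (fun q : Quotient s =>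
      if q = Quotient.mk s a then (none : Option (Quotient s'))
      else some (Quotient.map' id (fun x y hxy => hle hxy) q)) := by
    intro q q'
    induction q using Quotient.inductionOn with | _ x =>
    induction q' using Quotient.inductionOn with | _ y =>
    intro hxy
    by_cases hx : Quotient.mk s x = Quotient.mk s a <;>
      by_cases hy : Quotient.mk s y = Quotient.mk s a
    · rw [hx, hy]
    · simp [hx, hy] at hxy
    · simp [hx, hy] at hxy
    · simp only [hx, hy, if_false, Option.some.injEq] at hxy
      have hxy' : s' x y := Quotient.exact hxy
      rcases h x y hxy' with h1 | h1 | h1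
      · exact Quotient.sound h1
      · exact absurd (Quotient.sound h1.1) hx
      · exact absurd (Quotient.sound (s.symm h1.2)) hy
  calc Nat.card (Quotient s) ≤ Nat.card (Option (Quotient s')) := Nat.card_le_card_of_injective _ hf
    _ = Nat.card (Quotient s') + 1 := Finite.card_option

theorem pairJoin_trans {α : Type*} {s : Setoid α} {a b x y z : α}
    (h₁ : s x y ∨ (s x a ∧ s b y) ∨ (s x b ∧ s a y))
    (h₂ : s y z ∨ (s y a ∧ s b z) ∨ (s y b ∧ s a z)) :
    s x z ∨ (s x a ∧ s b z) ∨ (s x b ∧ s a z) := by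
  rcases h₁ with h₁ | ⟨h₁, h₁'⟩ | ⟨h₁, h₁'⟩ <;> rcases h₂ with h₂ | ⟨h₂, h₂'⟩ | ⟨h₂, h₂'⟩
  · exact Or.inl (s.trans h₁ h₂)
  · exact Or.inr (Or.inl ⟨s.trans h₁ h₂, h₂'⟩)
  · exact Or.inr (Or.inr ⟨s.trans h₁ h₂, h₂'⟩)
  · exact Or.inr (Or.inl ⟨h₁, s.trans h₁' h₂⟩)
  · exact Or.inr (Or.inl ⟨h₁, h₂'⟩)
  · exact Or.inl (s.trans h₁ h₂')
  · exact Or.inr (Or.inr ⟨h₁, s.trans h₁' h₂⟩)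
  · exact Or.inl (s.trans h₁ h₂')
  · exact Or.inr (Or.inr ⟨h₁, h₂'⟩)

variable {V : Type*} {G : SimpleGraph V}

/-- The faces of the subgraph `H`: the faces on both sides of an edge outside `H` are merged. -/
def PlaneEmbedding.faces (E : PlaneEmbedding G) (H : SimpleGraph V) : Setoid (Corner G) :=
  Relation.EqvGen.setoid fun s t => E.sameFace s t ∨
    ∃ d : G.Dart, ¬ H.Adj d.fst d.snd ∧ s = .inl d ∧ t = .inl (E.rot d)

namespace PlaneEmbedding

variable (E : PlaneEmbedding G) {H : SimpleGraph V}

theorem faces_of_sameFace {s t : Corner G} (h : E.sameFace s t) : E.faces H s t :=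
  Relation.EqvGen.rel _ _ (Or.inl h)

theorem faces_rot {d : G.Dart} (hd : ¬ H.Adj d.fst d.snd) :
    E.faces H (.inl d) (.inl (E.rot d)) :=
  Relation.EqvGen.rel _ _ (Or.inr ⟨d, hd, rfl, rfl⟩)

theorem faces_next (d : G.Dart) : E.faces H (.inl d) (.inl (E.rot d.symm)) :=
  E.faces_of_sameFace (E.sameFace_next d)

theorem faces_next_symm (d : G.Dart) : E.faces H (.inl d.symm) (.inl (E.rot d)) := by
  simpa using E.faces_next (H := H) d.symm

theorem faces_self : E.faces G = E.sameFace := by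
  refine le_antisymm ?_ (fun s t h => E.faces_of_sameFace h)
  intro s t h
  induction h with
  | rel s t h =>
    rcases h with h | ⟨d, hd, -⟩
    · exact h
    · exact absurd d.adj hd
  | refl s => exact E.sameFace.refl s
  | symm s t _ ih => exact E.sameFace.symm ih
  | trans s t u _ _ ih₁ ih₂ => exact E.sameFace.trans ih₁ ih₂

theorem faces_anti {H' : SimpleGraph V} (h : H' ≤ H) : E.faces H ≤ E.faces H' := by
  intro s t hst
  induction hst with
  | rel s t h' =>
    rcases h' with h' | ⟨d, hd, rfl, rfl⟩
    · exact E.faces_of_sameFace h'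
    · exact E.faces_rot (fun h' => hd (h h'))
  | refl s => exact (E.faces H').refl s
  | symm s t _ ih => exact (E.faces H').symm ih
  | trans s t u _ _ ih₁ ih₂ => exact (E.faces H').trans ih₁ ih₂

/-- The deletion identifies the two sides of `d` and nothing else: by the boundary steps, `d.symm`
gives the same identification. -/
theorem faces_deleteEdge (d : G.Dart) {s t : Corner G}
    (h : E.faces (H.deleteEdges {d.edge}) s t) :
    E.faces H s t ∨ (E.faces H s (.inl d) ∧ E.faces H (.inl (E.rot d)) t) ∨
      (E.faces H s (.inl (E.rot d)) ∧ E.faces H (.inl d) t) := by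
  induction h with
  | rel s t h =>
    rcases h with h | ⟨c, hc, rfl, rfl⟩
    · exact Or.inl (E.faces_of_sameFace h)
    · by_cases hcH : H.Adj c.fst c.snd
      · have hce : c.edge = d.edge := by
          by_contra hne
          exact hc (by rw [SimpleGraph.deleteEdges_adj]; exact ⟨hcH, hne⟩)
        rcases SimpleGraph.dart_edge_eq_iff c d |>.mp hce with rfl | rfl
        · exact Or.inr (Or.inl ⟨(E.faces H).refl _, (E.faces H).refl _⟩)
        · exact Or.inr (Or.inr ⟨E.faces_next_symm d, E.faces_next d⟩)
      · exact Or.inl (E.faces_rot hcH)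
  | refl s => exact Or.inl ((E.faces H).refl s)
  | symm s t _ ih =>
    rcases ih with h | ⟨h, h'⟩ | ⟨h, h'⟩
    · exact Or.inl ((E.faces H).symm h)
    · exact Or.inr (Or.inr ⟨(E.faces H).symm h', (E.faces H).symm h⟩)
    · exact Or.inr (Or.inl ⟨(E.faces H).symm h', (E.faces H).symm h⟩)
  | trans s t u _ _ ih₁ ih₂ => exact pairJoin_trans ih₁ ih₂

/-- An edge with different faces on its two sides is not a bridge. -/
theorem reachable_deleteEdge [Finite V] (d : G.Dart) (hd : H.Adj d.fst d.snd)
    (hf : ¬ E.faces H (.inl d) (.inl (E.rot d))) :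
    (H.deleteEdges {d.edge}).Reachable d.fst d.snd := by
  have : Fintype V := Fintype.ofFinite V
  by_contra hr
  set S : V → Prop := fun v => (H.deleteEdges {d.edge}).Reachable d.fst v with hS
  -- A count modulo 2 over the darts from the vertices of `S`, where `g` is the indicator of the
  -- face of `d` and each dart contributes `g` on both of its sides. The total is 0 because `rot`
  -- permutes the darts at each vertex. Darts outside `H` contribute 0, and darts of the other edges
  -- cancel with their reverses. As `d.snd` is assumed outside `S`, only the contribution 1 of `d`
  -- is left.
  set g : G.Dart → ZMod 2 := fun c => if E.faces H (.inl c) (.inl d) then 1 else 0 with hg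
  have hgeq : ∀ c c' : G.Dart, E.faces H (.inl c) (.inl c') → g c = g c' := by
    intro c c' h
    have : E.faces H (.inl c) (.inl d) ↔ E.faces H (.inl c') (.inl d) :=
      ⟨fun h' => (E.faces H).trans ((E.faces H).symm h) h', fun h' => (E.faces H).trans h h'⟩
    simp only [hg, this]
  have h0 : ∑ c : G.Dart with S c.fst, (g c + g (E.rot c)) = 0 := by
    rw [sum_add_distrib]
    have : ∑ c : G.Dart with S c.fst, g (E.rot c) = ∑ c : G.Dart with S c.fst, g c :=
      sum_equiv E.rot (by intro c; simp [E.rot_fst]) (by intro c _; rfl)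
    rw [this]
    exact CharTwo.add_self_eq_zero _
  have h1 : ∑ c : G.Dart with S c.fst, (g c + g (E.rot c)) =
      ∑ c : G.Dart with S c.fst ∧ H.Adj c.fst c.snd, (g c + g (E.rot c)) := by
    symm
    apply sum_subset
    · intro c hc
      simp only [mem_filter, mem_univ, true_and] at hc ⊢
      exact hc.1
    · intro c hc hc'
      simp only [mem_filter, mem_univ, true_and] at hc hc'
      have hcH : ¬ H.Adj c.fst c.snd := fun h => hc' ⟨hc, h⟩
      rw [hgeq _ _ (E.faces_rot hcH)]
      exact CharTwo.add_self_eq_zero _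
  have hdm : d ∈ (univ.filter fun c : G.Dart => S c.fst ∧ H.Adj c.fst c.snd) := by
    simp only [mem_filter, mem_univ, true_and]
    exact ⟨SimpleGraph.Reachable.refl _, hd⟩
  rw [h1, ← add_sum_erase _ _ hdm] at h0
  have h2 : ∑ c ∈ (univ.filter fun c : G.Dart => S c.fst ∧ H.Adj c.fst c.snd).erase d,
      (g c + g (E.rot c)) = 0 := by
    have hcond : ∀ c ∈ (univ.filter fun c : G.Dart => S c.fst ∧ H.Adj c.fst c.snd).erase d,
        c ≠ d ∧ c ≠ d.symm ∧ S c.fst ∧ H.Adj c.fst c.snd := by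
      intro c hc
      simp only [mem_erase, mem_filter, mem_univ, true_and] at hc
      refine ⟨hc.1, ?_, hc.2.1, hc.2.2⟩
      rintro rfl
      exact hr hc.2.1
    refine sum_involution (fun c _ => c.symm) ?_ ?_ ?_ ?_
    · intro c _
      rw [hgeq _ _ (E.faces_next c), hgeq _ _ (E.faces_next_symm c), add_comm (g (E.rot c.symm))]
      exact CharTwo.add_self_eq_zero _
    · intro c _ _
      exact c.symm_ne
    · intro c hc
      obtain ⟨h1, h2, h3, h4⟩ := hcond c hc
      simp only [mem_erase, mem_filter, mem_univ, true_and]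
      refine ⟨fun h => h2 (by rw [← h, SimpleGraph.Dart.symm_symm]), ?_, h4.symm⟩
      refine h3.trans (SimpleGraph.Adj.reachable ?_)
      rw [SimpleGraph.deleteEdges_adj]
      refine ⟨h4, fun h => ?_⟩
      rcases SimpleGraph.dart_edge_eq_iff c d |>.mp h with h | h
      exacts [h1 h, h2 h]
    · intro c _
      exact c.symm_symm
  rw [h2, add_zero] at h0
  have hgd : g d = 1 := if_pos ((E.faces H).refl _)
  have hgr : g (E.rot d) = 0 := if_neg (fun h => hf ((E.faces H).symm h))
  rw [hgd, hgr] at h0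
  exact absurd h0 (by decide)

end PlaneEmbedding

theorem reachable_deleteEdge_cases {H : SimpleGraph V} {a b x y : V} (h : H.Reachable x y) :
    (H.deleteEdges {s(a, b)}).Reachable x y ∨
      ((H.deleteEdges {s(a, b)}).Reachable x a ∧ (H.deleteEdges {s(a, b)}).Reachable b y) ∨
      ((H.deleteEdges {s(a, b)}).Reachable x b ∧ (H.deleteEdges {s(a, b)}).Reachable a y) := by
  obtain ⟨p⟩ := h
  induction p with
  | nil => exact Or.inl (SimpleGraph.Reachable.refl _)
  | @cons x z y h p ih =>
    refine pairJoin_trans (s := (H.deleteEdges {s(a, b)}).reachableSetoid) ?_ ih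
    by_cases he : s(x, z) = s(a, b)
    · rcases Sym2.eq_iff.mp he with ⟨rfl, rfl⟩ | ⟨rfl, rfl⟩
      · exact Or.inr (Or.inl ⟨SimpleGraph.Reachable.refl _, SimpleGraph.Reachable.refl _⟩)
      · exact Or.inr (Or.inr ⟨SimpleGraph.Reachable.refl _, SimpleGraph.Reachable.refl _⟩)
    · refine Or.inl (SimpleGraph.Adj.reachable ?_)
      rw [SimpleGraph.deleteEdges_adj]
      exact ⟨h, he⟩

/-- Euler's inequality for the subgraphs of a plane graph. -/
theorem PlaneEmbedding.euler [Finite V] (E : PlaneEmbedding G) : ∀ n (H : SimpleGraph V), H ≤ G →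
    (G.edgeSet \ H.edgeSet).ncard = n →
    Nat.card H.edgeSet + 1 + Nat.card H.ConnectedComponent ≤
      Nat.card V + Nat.card (Quotient (E.faces H)) := by
  intro n
  induction n with
  | zero =>
    intro H hH hn
    rw [Set.ncard_eq_zero (Set.toFinite _), Set.sdiff_eq_empty] at hn
    have : H = G := le_antisymm hH (SimpleGraph.edgeSet_subset_edgeSet.mp hn)
    subst this
    rw [E.faces_self, E.genus_zero]
  | succ n ih =>
    intro K hK hn
    obtain ⟨e, he⟩ : (G.edgeSet \ K.edgeSet).Nonempty :=
      (Set.ncard_pos (Set.toFinite _)).mp (by omega)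
    obtain ⟨d, rfl⟩ : ∃ d : G.Dart, d.edge = e := by
      induction e with | _ a b => exact ⟨⟨(a, b), he.1⟩, rfl⟩
    set H : SimpleGraph V := K ⊔ SimpleGraph.fromEdgeSet {d.edge} with hH
    have hHe : H.edgeSet = insert d.edge K.edgeSet := by
      rw [hH, SimpleGraph.edgeSet_sup, SimpleGraph.edgeSet_fromEdgeSet]
      ext x
      simp only [Set.mem_union, Set.mem_sdiff, Set.mem_singleton_iff, Set.mem_insert_iff]
      constructor
      · rintro (h | h)
        exacts [Or.inr h, Or.inl h.1]
      · rintro (rfl | h)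
        · exact Or.inr ⟨rfl, G.not_isDiag_of_mem_edgeSet d.edge_mem⟩
        · exact Or.inl h
    have hHG : H ≤ G := by
      rw [← SimpleGraph.edgeSet_subset_edgeSet, hHe]
      exact Set.insert_subset d.edge_mem (SimpleGraph.edgeSet_subset_edgeSet.mpr hK)
    have hKH : K = H.deleteEdges {d.edge} := by
      rw [← SimpleGraph.edgeSet_inj, SimpleGraph.edgeSet_deleteEdges, hHe]
      ext x
      simp only [Set.mem_sdiff, Set.mem_insert_iff, Set.mem_singleton_iff]
      constructor
      · intro h
        exact ⟨Or.inr h, fun hx => he.2 (hx ▸ h)⟩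
      · rintro ⟨h | h, h'⟩
        exacts [absurd h h', h]
    have hdH : H.Adj d.fst d.snd := by
      have : d.edge ∈ H.edgeSet := by rw [hHe]; exact Set.mem_insert _ _
      exact this
    have hcard : Nat.card H.edgeSet = Nat.card K.edgeSet + 1 := by
      rw [Nat.card_coe_set_eq, Nat.card_coe_set_eq, hHe, Set.ncard_insert_of_notMem he.2]
    have hih := ih H hHG (by
      have : G.edgeSet \ K.edgeSet = insert d.edge (G.edgeSet \ H.edgeSet) := by
        rw [hHe]
        ext x
        simp only [Set.mem_sdiff, Set.mem_insert_iff]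
        constructor
        · intro h
          by_cases hx : x = d.edge
          · exact Or.inl hx
          · exact Or.inr ⟨h.1, by simp [hx, h.2]⟩
        · rintro (rfl | h)
          exacts [he, ⟨h.1, fun hx => h.2 (Or.inr hx)⟩]
      rw [this, Set.ncard_insert_of_notMem (by rw [hHe]; simp)] at hn
      omega)
    have hKle : K ≤ H := le_sup_left
    have : Finite G.Dart := by
      have : Fintype V := Fintype.ofFinite V
      infer_instance
    have hc : Nat.card K.ConnectedComponent ≤ Nat.card H.ConnectedComponent + 1 :=
      card_quotient_le_succ (s := K.reachableSetoid) (s' := H.reachableSetoid) (a := d.fst)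
        (b := d.snd) (fun x y h => by
          have := reachable_deleteEdge_cases (a := d.fst) (b := d.snd) h
          rw [show s(d.fst, d.snd) = d.edge from rfl, ← hKH] at this
          exact this)
        (fun x y h => SimpleGraph.Reachable.mono hKle h)
    -- If one face is on both sides of the deleted edge, the faces are unchanged and there is at
    -- most one more component. Otherwise the edge is not a bridge, so the components are unchanged
    -- and at most one face is lost.
    by_cases hf : E.faces H (.inl d) (.inl (E.rot d))
    · have hfe : E.faces K = E.faces H := by
        refine le_antisymm (fun s t h => ?_) (E.faces_anti hKle)
        rw [hKH] at h
        rcases E.faces_deleteEdge d h with h | h | h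
        · exact h
        · exact (E.faces H).trans h.1 ((E.faces H).trans hf h.2)
        · exact (E.faces H).trans h.1 ((E.faces H).trans ((E.faces H).symm hf) h.2)
      rw [hfe]
      omega
    · have hr := E.reachable_deleteEdge d hdH hf
      rw [← hKH] at hr
      have hce : K.reachableSetoid = H.reachableSetoid := by
        refine le_antisymm (fun x y h => SimpleGraph.Reachable.mono hKle h) (fun x y h => ?_)
        have := reachable_deleteEdge_cases (a := d.fst) (b := d.snd) h
        rw [show s(d.fst, d.snd) = d.edge from rfl, ← hKH] at this
        rcases this with h | h | h
        · exact h
        · exact h.1.trans (hr.trans h.2)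
        · exact h.1.trans (hr.symm.trans h.2)
      have hce' : Nat.card K.ConnectedComponent = Nat.card H.ConnectedComponent := by
        change Nat.card (Quotient K.reachableSetoid) = Nat.card (Quotient H.reachableSetoid)
        rw [hce]
      have hF : Nat.card (Quotient (E.faces H)) ≤ Nat.card (Quotient (E.faces K)) + 1 :=
        card_quotient_le_succ (fun x y h => E.faces_deleteEdge d (hKH ▸ h)) (E.faces_anti hKle)
      omega

end Faces

/-! ### First return maps of permutations -/

section Return

variable {D D' : Type*} [Finite D]

theorem exists_pow_eq_self (σ : Equiv.Perm D) : ∃ n, 0 < n ∧ ∀ x, (σ ^ n) x = x := by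
  obtain ⟨n, hn, h⟩ := isOfFinOrder_iff_pow_eq_one.mp (isOfFinOrder_of_finite σ)
  exact ⟨n, hn, fun x => by rw [h]; rfl⟩

/-- The first return map of a permutation to a subset. -/
theorem exists_returnMap (σ : Equiv.Perm D) {ι : D' → D} (hι : Function.Injective ι) :
    ∃ τ : Equiv.Perm D', ∀ x, ∃ n, 0 < n ∧ (σ ^ n) (ι x) = ι (τ x) ∧
      ∀ m, 0 < m → m < n → (σ ^ m) (ι x) ∉ Set.range ι := by
  have hex : ∀ x, ∃ n, 0 < n ∧ (σ ^ n) (ι x) ∈ Set.range ι := by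
    obtain ⟨n, hn, h⟩ := exists_pow_eq_self σ
    exact fun x => ⟨n, hn, x, (h (ι x)).symm⟩
  have hf : ∀ x, ∃ y, (σ ^ Nat.find (hex x)) (ι x) = ι y := fun x =>
    let ⟨y, hy⟩ := (Nat.find_spec (hex x)).2; ⟨y, hy.symm⟩
  choose f hf using hf
  have : Finite D' := Finite.of_injective ι hι
  have aux : ∀ x y, f x = f y → Nat.find (hex x) ≤ Nat.find (hex y) → x = y := by
    intro x y hxy hle
    have h1 : (σ ^ Nat.find (hex x)) (ι x) = (σ ^ Nat.find (hex y)) (ι y) := by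
      rw [hf, hf, hxy]
    obtain ⟨k, hk⟩ := Nat.exists_eq_add_of_le hle
    rw [hk, pow_add, Equiv.Perm.mul_apply] at h1
    have h2 : ι x = (σ ^ k) (ι y) := (σ ^ Nat.find (hex x)).injective h1
    rcases Nat.eq_zero_or_pos k with rfl | hk0
    · exact hι (by simpa using h2)
    · have h3 := Nat.find_spec (hex x)
      exact absurd ⟨hk0, x, h2⟩ (Nat.find_min (hex y) (by omega))
  have hinj : Function.Injective f := by
    intro x y hxy
    rcases le_total (Nat.find (hex x)) (Nat.find (hex y)) with h | h
    · exact aux x y hxy h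
    · exact (aux y x hxy.symm h).symm
  refine ⟨Equiv.ofBijective f (Finite.injective_iff_bijective.mp hinj), fun x =>
    ⟨Nat.find (hex x), (Nat.find_spec (hex x)).1, hf x, fun m hm hlt h => ?_⟩⟩
  exact Nat.find_min (hex x) hlt ⟨hm, h⟩

theorem sameCycle_returnMap {σ : Equiv.Perm D} {ι : D' → D} (hι : Function.Injective ι)
    {τ : Equiv.Perm D'} (hτ : ∀ x, ∃ n, 0 < n ∧ (σ ^ n) (ι x) = ι (τ x) ∧
      ∀ m, 0 < m → m < n → (σ ^ m) (ι x) ∉ Set.range ι) {x y : D'}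
    (h : σ.SameCycle (ι x) (ι y)) : τ.SameCycle x y := by
  obtain ⟨k, hk⟩ := h.exists_nat_pow_eq
  induction k using Nat.strong_induction_on generalizing x with
  | _ k ih =>
  rcases Nat.eq_zero_or_pos k with rfl | hk0
  · have hxy : x = y := hι (by simpa using hk)
    rw [hxy]
  obtain ⟨n, hn, h1, h2⟩ := hτ x
  have hnk : n ≤ k := by
    by_contra hlt
    exact h2 k hk0 (by omega) ⟨y, hk.symm⟩
  obtain ⟨j, rfl⟩ := Nat.exists_eq_add_of_le' hnk
  rw [pow_add, Equiv.Perm.mul_apply, h1] at hk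
  have := ih j (by omega) ⟨j, by simpa using hk⟩ hk
  exact (Equiv.Perm.sameCycle_apply_left.mp this)

end Return

/-! ### Rotation systems of subgraphs -/

section Rotation

variable {V : Type*} {G : SimpleGraph V}

/-- A rotation system: a cyclic order of the darts at each vertex. -/
structure Rotation (H : SimpleGraph V) where
  /-- The next dart at the same vertex. -/
  rot : Equiv.Perm H.Dart
  rot_fst : ∀ d, (rot d).fst = d.fst
  rot_sameCycle : ∀ d e : H.Dart, d.fst = e.fst → rot.SameCycle d e

/-- The next dart along the boundary of a face. -/
def Rotation.next {H : SimpleGraph V} (R : Rotation H) : Equiv.Perm H.Dart :=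
  SimpleGraph.Dart.symm_involutive.toPerm.trans R.rot

theorem Rotation.next_apply {H : SimpleGraph V} (R : Rotation H) (d : H.Dart) :
    R.next d = R.rot d.symm := rfl

/-- The darts of a subgraph as darts of the graph. -/
def dartIncl {H : SimpleGraph V} (hH : H ≤ G) (d : H.Dart) : G.Dart := ⟨d.toProd, hH d.adj⟩

theorem dartIncl_injective {H : SimpleGraph V} (hH : H ≤ G) :
    Function.Injective (dartIncl hH) := by
  intro d e h
  have h' : (dartIncl hH d).toProd = (dartIncl hH e).toProd := congrArg _ h
  exact SimpleGraph.Dart.ext _ _ h'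

theorem mem_range_dartIncl {H : SimpleGraph V} (hH : H ≤ G) (d : G.Dart) :
    d ∈ Set.range (dartIncl hH) ↔ H.Adj d.fst d.snd :=
  ⟨by rintro ⟨e, rfl⟩; exact e.adj, fun h => ⟨⟨d.toProd, h⟩, rfl⟩⟩

namespace PlaneEmbedding

variable (E : PlaneEmbedding G) {H : SimpleGraph V}

theorem rot_pow_fst (n : ℕ) (d : G.Dart) : ((E.rot ^ n) d).fst = d.fst := by
  induction n with
  | zero => rfl
  | succ n ih => rw [pow_succ', Equiv.Perm.mul_apply, E.rot_fst, ih]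

theorem faces_pow (d : G.Dart) (n : ℕ) (h : ∀ m < n, ¬ H.Adj ((E.rot ^ m) d).fst ((E.rot ^ m) d).snd) :
    E.faces H (.inl d) (.inl ((E.rot ^ n) d)) := by
  induction n with
  | zero => exact (E.faces H).refl _
  | succ n ih =>
    refine (E.faces H).trans (ih fun m hm => h m (by omega)) ?_
    rw [pow_succ', Equiv.Perm.mul_apply]
    exact E.faces_rot (h n (by omega))

theorem exists_corner (v : V) : ∃ s : Corner G, s.vertex = v := by
  by_cases h : ∃ w, G.Adj v w
  · obtain ⟨w, hw⟩ := h
    exact ⟨.inl ⟨(v, w), hw⟩, rfl⟩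
  · push Not at h
    exact ⟨.inr ⟨v, h⟩, rfl⟩

variable [Finite V]

instance : Finite G.Dart := by
  have : Fintype V := Fintype.ofFinite V
  infer_instance

theorem exists_face_dart (hH : H ≤ G) {s : Corner G} {w : V} (hw : H.Adj s.vertex w) :
    ∃ x : H.Dart, E.faces H s (.inl (dartIncl hH x)) := by
  rcases s with d | v
  · have hsc := E.rot_sameCycle d ⟨(d.fst, w), hH hw⟩ rfl
    obtain ⟨k, hk⟩ := hsc.exists_nat_pow_eq
    have hex : ∃ n, H.Adj ((E.rot ^ n) d).fst ((E.rot ^ n) d).snd := ⟨k, by rw [hk]; exact hw⟩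
    obtain ⟨x, hx⟩ := (mem_range_dartIncl hH _).mpr (Nat.find_spec hex)
    refine ⟨x, ?_⟩
    rw [hx]
    exact E.faces_pow d _ (fun m hm => Nat.find_min hex hm)
  · exact absurd (hH hw) (v.2 w)

theorem faces_of_isolated {s t : Corner G} (hs : ∀ w, ¬ H.Adj s.vertex w)
    (hst : s.vertex = t.vertex) : E.faces H s t := by
  rcases s with d | v <;> rcases t with d' | v'
  · obtain ⟨k, rfl⟩ := (E.rot_sameCycle d d' hst).exists_nat_pow_eq
    refine E.faces_pow d k (fun m _ => ?_)
    rw [E.rot_pow_fst]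
    exact hs _
  · exact absurd (by rw [← show d.fst = v'.1 from hst]; exact d.adj) (v'.2 d.snd)
  · exact absurd (by rw [show v.1 = d'.fst from hst]; exact d'.adj) (v.2 d'.snd)
  · rw [show v = v' from Subtype.ext hst]

/-- A face of `H` without darts of `H` meets only vertices isolated in `H` and contains all their
corners. By connectedness of the surface this spreads to every vertex, also to the end `a` of an
edge. -/
theorem exists_face_dart_of_edge (hH : H ≤ G) {a b : V} (hab : H.Adj a b) (s : Corner G) :
    ∃ x : H.Dart, E.faces H s (.inl (dartIncl hH x)) := by
  by_contra hno
  push Not at hno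
  have hiso : ∀ t, E.faces H s t → ∀ w, ¬ H.Adj t.vertex w := by
    intro t ht w hw
    obtain ⟨x, hx⟩ := E.exists_face_dart hH hw
    exact hno x ((E.faces H).trans ht hx)
  set Q : V → Prop := fun v => ∀ t : Corner G, t.vertex = v → E.faces H s t with hQ
  have hQ' : ∀ t, E.faces H s t → Q t.vertex := by
    intro t ht t' ht'
    exact (E.faces H).trans ht (E.faces_of_isolated (hiso t ht) ht'.symm)
  have hstep : ∀ u v, (G.Adj u v ∨ ∃ s t : Corner G, s.vertex = u ∧ t.vertex = v ∧
      E.sameFace s t) → Q u → Q v := by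
    rintro u v (h | ⟨t, t', rfl, rfl, h⟩) hu
    · have h1 := hu (.inl ⟨(u, v), h⟩) rfl
      have h2 := hQ' _ ((E.faces H).trans h1 (E.faces_next _))
      have h3 : Corner.vertex (G := G) (.inl (E.rot (SimpleGraph.Dart.symm ⟨(u, v), h⟩))) = v :=
        E.rot_fst _
      rwa [h3] at h2
    · exact hQ' _ ((E.faces H).trans (hu t rfl) (E.faces_of_sameFace h))
  have hall : ∀ u v, Q u ↔ Q v := by
    intro u v
    induction E.connected u v with
    | rel u v h =>
      refine ⟨hstep u v h, hstep v u ?_⟩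
      rcases h with h | ⟨t, t', h1, h2, h3⟩
      · exact Or.inl h.symm
      · exact Or.inr ⟨t', t, h2, h1, E.sameFace.symm h3⟩
    | refl => exact Iff.rfl
    | symm _ _ _ ih => exact ih.symm
    | trans _ _ _ _ _ ih₁ ih₂ => exact ih₁.trans ih₂
  have hQa : Q a := (hall s.vertex a).mp (hQ' s ((E.faces H).refl s))
  obtain ⟨t, rfl⟩ := exists_corner (G := G) a
  exact hiso t (hQa t rfl) b hab

/-- A subgraph of a plane graph has a rotation system that satisfies Euler's inequality. -/
theorem exists_rotation (E : PlaneEmbedding G) (hH : H ≤ G) {a b : V} (hab : H.Adj a b) : ∃ R : Rotation H,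
    Nat.card H.edgeSet + 2 + Nat.card {v : V // ∀ w, ¬ H.Adj v w} ≤
      Nat.card V + Nat.card (Quotient (Equiv.Perm.SameCycle.setoid R.next)) := by
  -- The rotation of `H` is the first return of the rotation of `G` to the darts of `H`. Each orbit
  -- of its boundary steps stays within one face of `H`, and every face contains an orbit, so there
  -- are at least as many orbits as faces.
  obtain ⟨τ, hτ⟩ := exists_returnMap E.rot (dartIncl_injective hH)
  let R : Rotation H :=
    { rot := τ
      rot_fst := by
        intro d
        obtain ⟨n, -, h, -⟩ := hτ d
        have := congrArg (fun c : G.Dart => c.fst) h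
        rw [E.rot_pow_fst] at this
        exact this.symm
      rot_sameCycle := fun d e h =>
        sameCycle_returnMap (dartIncl_injective hH) hτ (E.rot_sameCycle _ _ h) }
  have hnext : ∀ d : H.Dart, E.faces H (.inl (dartIncl hH d)) (.inl (dartIncl hH (R.next d))) := by
    intro d
    obtain ⟨n, hn, h1, h2⟩ := hτ d.symm
    refine (E.faces H).trans (E.faces_next _) ?_
    rw [R.next_apply]
    change E.faces H _ (.inl (dartIncl hH (τ d.symm)))
    rw [← h1]
    obtain ⟨k, rfl⟩ := Nat.exists_eq_add_of_le' hn
    have := E.faces_pow (H := H) (E.rot (dartIncl hH d.symm)) k (fun m hm => by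
      have := h2 (m + 1) (by omega) (by omega)
      rwa [mem_range_dartIncl, pow_succ, Equiv.Perm.mul_apply] at this)
    rw [pow_succ, Equiv.Perm.mul_apply]
    exact this
  have hcyc : ∀ d e : H.Dart, R.next.SameCycle d e →
      E.faces H (.inl (dartIncl hH d)) (.inl (dartIncl hH e)) := by
    intro d e h
    obtain ⟨k, rfl⟩ := h.exists_nat_pow_eq
    clear h
    induction k with
    | zero => exact (E.faces H).refl _
    | succ k ih =>
      rw [pow_succ', Equiv.Perm.mul_apply]
      exact (E.faces H).trans ih (hnext _)
  refine ⟨R, ?_⟩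
  have hF : Nat.card (Quotient (E.faces H)) ≤
      Nat.card (Quotient (Equiv.Perm.SameCycle.setoid R.next)) := by
    let f : Quotient (Equiv.Perm.SameCycle.setoid R.next) → Quotient (E.faces H) :=
      Quotient.map' (fun d => .inl (dartIncl hH d)) hcyc
    refine Nat.card_le_card_of_surjective f ?_
    intro q
    induction q using Quotient.inductionOn with | _ s =>
    obtain ⟨x, hx⟩ := E.exists_face_dart_of_edge hH hab s
    exact ⟨Quotient.mk _ x, Quotient.sound ((E.faces H).symm hx)⟩
  -- This raises the constant 1 in Euler's inequality to 2 and discounts the isolated vertices,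
  -- which have no darts and would not be seen by the discharging.
  have hc : Nat.card {v : V // ∀ w, ¬ H.Adj v w} + 1 ≤ Nat.card H.ConnectedComponent := by
    rw [← Finite.card_option]
    have : Finite H.ConnectedComponent := Quot.finite _
    let f : Option {v : V // ∀ w, ¬ H.Adj v w} → H.ConnectedComponent := fun o =>
      o.elim (H.connectedComponentMk a) (fun v => H.connectedComponentMk v.1)
    have hiso : ∀ u v : V, (∀ w, ¬ H.Adj u w) → H.Reachable u v → u = v := by
      intro u v hu h
      obtain ⟨p⟩ := h
      cases p with
      | nil => rfl
      | cons h _ => exact absurd h (hu _)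
    refine Nat.card_le_card_of_injective f ?_
    rintro (_ | u) (_ | v) huv
    · rfl
    · have := hiso v.1 a v.2 (SimpleGraph.ConnectedComponent.exact huv.symm)
      exact absurd hab (this ▸ v.2 b)
    · have := hiso u.1 a u.2 (SimpleGraph.ConnectedComponent.exact huv)
      exact absurd hab (this ▸ u.2 b)
    · rw [show u = v from Subtype.ext (hiso u.1 v.1 u.2 (SimpleGraph.ConnectedComponent.exact huv))]
  have := E.euler _ H hH rfl
  omega

end PlaneEmbedding

end Rotation

/-! ### Counting orbits by weights -/

section Counting

variable {D : Type*} [Fintype D]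

theorem sum_le_sum_orbit {τ : Equiv.Perm D} (f : D → ℕ) (d : D) (m c : ℕ)
    (hd : ∀ k, 0 < k → k < m → (τ ^ k) d ≠ d) (hf : ∀ k < m, c ≤ f ((τ ^ k) d)) :
    m * c ≤ ∑ x with Quotient.mk (Equiv.Perm.SameCycle.setoid τ) x =
      Quotient.mk (Equiv.Perm.SameCycle.setoid τ) d, f x := by
  have hinj : Set.InjOn (fun k => (τ ^ k) d) (range m : Finset ℕ) := by
    have aux : ∀ i j, i ≤ j → j < m → (τ ^ i) d = (τ ^ j) d → i = j := by
      intro i j hij hj h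
      obtain ⟨k, rfl⟩ := Nat.exists_eq_add_of_le hij
      rw [pow_add, Equiv.Perm.mul_apply] at h
      have h' := (τ ^ i).injective h
      by_contra hne
      exact hd k (by omega) (by omega) h'.symm
    intro i hi j hj h
    simp only [coe_range, Set.mem_Iio] at hi hj
    rcases le_total i j with hij | hij
    · exact aux i j hij hj h
    · exact (aux j i hij hi h.symm).symm
  calc m * c = ∑ k ∈ range m, c := by simp
    _ ≤ ∑ k ∈ range m, f ((τ ^ k) d) := sum_le_sum fun k hk => hf k (mem_range.mp hk)
    _ = ∑ x ∈ (range m).image (fun k => (τ ^ k) d), f x := (sum_image hinj).symm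
    _ ≤ _ := by
      apply sum_le_sum_of_subset
      intro x hx
      obtain ⟨k, -, rfl⟩ := mem_image.mp hx
      simp only [mem_filter, mem_univ, true_and]
      exact Quotient.sound (s := Equiv.Perm.SameCycle.setoid τ)
        (Equiv.Perm.SameCycle.symm ⟨k, by simp⟩)

/-- A permutation without cycles of length `1`, `2` and `4` has few cycles. -/
theorem card_orbits_le {τ : Equiv.Perm D} (h₁ : ∀ d, τ d ≠ d) (h₂ : ∀ d, (τ ^ 2) d ≠ d)
    (h₄ : ∀ d, (τ ^ 4) d ≠ d) :
    30 * Nat.card (Quotient (Equiv.Perm.SameCycle.setoid τ)) ≤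
      5 * Fintype.card D + 5 * #{d | (τ ^ 3) d = d} + #{d | (τ ^ 5) d = d} := by
  -- The weights give every orbit at least 30: `3 * 10` for length 3, `5 * 6` for length 5, and at
  -- least `6 * 5` for the remaining lengths, which are at least 6.
  set f : D → ℕ := fun d => 5 + (if (τ ^ 3) d = d then 5 else 0) + (if (τ ^ 5) d = d then 1 else 0)
    with hf
  have hsum : ∑ d, f d = 5 * Fintype.card D + 5 * #{d | (τ ^ 3) d = d} + #{d | (τ ^ 5) d = d} := by
    simp only [hf, sum_add_distrib, sum_const, smul_eq_mul, card_univ, ← sum_filter]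
    ring
  have hcomm : ∀ (i k : ℕ) d, (τ ^ i) d = d → (τ ^ i) ((τ ^ k) d) = (τ ^ k) d := by
    intro i k d h
    rw [← Equiv.Perm.mul_apply, ← pow_add, add_comm, pow_add, Equiv.Perm.mul_apply, h]
  have horb : ∀ d, 30 ≤ ∑ x with Quotient.mk (Equiv.Perm.SameCycle.setoid τ) x =
      Quotient.mk (Equiv.Perm.SameCycle.setoid τ) d, f x := by
    intro d
    have e1 := h₁ d
    have e2 := h₂ d
    have e4 := h₄ d
    by_cases e3 : (τ ^ 3) d = d
    · have := sum_le_sum_orbit (τ := τ) f d 3 10 (by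
        intro k hk hk'
        interval_cases k
        · simpa using e1
        · exact e2) (by
        intro k _
        simp only [hf, if_pos (hcomm 3 k d e3)]
        omega)
      omega
    by_cases e5 : (τ ^ 5) d = d
    · have := sum_le_sum_orbit (τ := τ) f d 5 6 (by
        intro k hk hk'
        interval_cases k
        · simpa using e1
        · exact e2
        · exact e3
        · exact e4) (by
        intro k _
        simp only [hf, if_pos (hcomm 5 k d e5)]
        omega)
      omega
    · have := sum_le_sum_orbit (τ := τ) f d 6 5 (by
        intro k hk hk'
        interval_cases k
        · simpa using e1
        · exact e2
        · exact e3
        · exact e4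
        · exact e5) (by
        intro k _
        simp only [hf]
        omega)
      omega
  rw [← hsum, Nat.card_eq_fintype_card]
  calc 30 * Fintype.card (Quotient (Equiv.Perm.SameCycle.setoid τ))
      = ∑ q : Quotient (Equiv.Perm.SameCycle.setoid τ), 30 := by
        rw [sum_const, card_univ, smul_eq_mul, mul_comm]
    _ ≤ ∑ q : Quotient (Equiv.Perm.SameCycle.setoid τ),
        ∑ x with Quotient.mk (Equiv.Perm.SameCycle.setoid τ) x = q, f x := by
        apply sum_le_sum
        intro q _
        induction q using Quotient.inductionOn with | _ d => exact horb d
    _ = ∑ d, f d := sum_fiberwise _ _ _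

end Counting

/-! ### Discharging rules and payments to triangles -/

section Payments

variable {V : Type*} [Fintype V] (H : SimpleGraph V) (v₀ : V)

/-- The number of edges at `v` that are not in triangles. -/
noncomputable def nt (v : V) : ℕ := #{w | H.Adj v w ∧ ¬ Tri H v w}

/-- A vertex of degree `5` with exactly one edge that is not in a triangle. -/
def Tight (v : V) : Prop := v ≠ v₀ ∧ deg H v = 5 ∧ nt H v = 1

/-- `p` has a triangle other than those with vertices of degrees `3` and `4`. -/
def HasOther (p : V) : Prop :=
  ∃ x y, H.Adj p x ∧ H.Adj p y ∧ H.Adj x y ∧ ¬ ATri H v₀ p x y ∧ ¬ ATri H v₀ p y x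

/-- A tight vertex in two triangles with vertices of degrees `3` and `4`. -/
def Poor (p : V) : Prop := Tight H v₀ p ∧ ¬ HasOther H v₀ p

/-- A tight vertex in exactly one triangle with vertices of degrees `3` and `4`. -/
def SemiPoor (p : V) : Prop := Tight H v₀ p ∧ (∃ a w, ATri H v₀ p a w) ∧ HasOther H v₀ p

/-- A semi-poor vertex whose other triangle is expensive. -/
def Restricted (p : V) : Prop := SemiPoor H v₀ p ∧ ∃ y z, H.Adj p y ∧ H.Adj p z ∧ H.Adj y z ∧
  ((Slot H v₀ y ∧ D4 H v₀ z) ∨ (D3 H v₀ y ∧ SemiPoor H v₀ z))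

/-- What a tight vertex `x` pays to its triangle `x y z`. -/
noncomputable def tightPay (x y z : V) : ℚ :=
  if ATri H v₀ x y z ∨ ATri H v₀ x z y then 2
  else if y = v₀ ∨ z = v₀ then 0
  -- A slot pays only 1/2 to a triangle that is not light, and `y`, `z` are not both slots, so 3/2 +
  -- 1/2 + 1 suffices.
  else if D4 H v₀ y ∧ D4 H v₀ z then (if Slot H v₀ y ∨ Slot H v₀ z then 3 / 2 else 1)
  else if D3 H v₀ y ∨ D3 H v₀ z then
    -- The vertex of degree 3 pays nothing here, so two large vertices share 3: as 1 + 2 if just one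
    -- is tight; if both are tight, as 4/3 + 5/3 when just one is semi-poor (it pays the smaller
    -- part), and equally otherwise.
    (if ¬ Tight H v₀ (if D3 H v₀ y then z else y) then 1
    else if SemiPoor H v₀ x ∧ ¬ SemiPoor H v₀ (if D3 H v₀ y then z else y) then 4 / 3
    else if ¬ SemiPoor H v₀ x ∧ SemiPoor H v₀ (if D3 H v₀ y then z else y) then 5 / 3
    else 3 / 2)
  else if D4 H v₀ y ∨ D4 H v₀ z then 5 / 4
  else 1

/-- What the vertex `x` pays to the facial triangle `x y z`. -/
noncomputable def pay3 (x y z : V) : ℚ :=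
  if x = v₀ then 3
  else if deg H x = 3 then (if (light H v₀).Adj x y then 1 else 0)
  else if deg H x = 4 then (if Slot H v₀ x ∧ ¬ (light H v₀).Adj x y then 1 / 2 else 1)
  else if ¬ Tight H v₀ x then 2
  else tightPay H v₀ x y z

/-- The `5`-cycle through a restricted vertex and the vertices `q`, `r`, `s`, `x` that needs a
payment from it. -/
def Needy (q r s x : V) : Prop := Star H v₀ r ∧ D4 H v₀ q ∧ D4 H v₀ s ∧ ¬ D4 H v₀ x

/-- What the vertex `x` pays to the face bounded by the `5`-cycle `x a b c e`. -/
noncomputable def pay5 (x a b c e : V) : ℚ :=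
  if x = v₀ then 1
  else if deg H x = 3 then 0
  else if deg H x = 4 then
    (if Slot H v₀ x then
      (if Tri H x a then (if D3 H v₀ a then 1 / 3 else 1 / 6)
      else if Tri H x e then (if D3 H v₀ e then 1 / 3 else 1 / 6)
      else 0)
    else 1 / 3)
  else if ¬ Tight H v₀ x then (if Tri H x a then 0 else 1 / 3) + (if Tri H x e then 0 else 1 / 3)
  else if Poor H v₀ x then 0
  else if Restricted H v₀ x then
    (if (if Tri H x a then Needy H v₀ e c b a else Needy H v₀ a b c e) then 1 / 3 else 0)
  else 1 / 3

variable {H v₀}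

theorem tightPay_nonneg (x y z : V) : 0 ≤ tightPay H v₀ x y z := by
  unfold tightPay; split_ifs <;> norm_num

theorem pay3_nonneg (x y z : V) : 0 ≤ pay3 H v₀ x y z := by
  have := tightPay_nonneg (H := H) (v₀ := v₀) x y z
  unfold pay3; split_ifs <;> first | assumption | norm_num

theorem pay5_nonneg (x a b c e : V) : 0 ≤ pay5 H v₀ x a b c e := by
  unfold pay5; split_ifs <;> norm_num

/-- The `5`-cycle `a b c d e`. -/
structure Cycle5 {W : Type*} (H : SimpleGraph W) (a b c d e : W) : Prop where
  ab : H.Adj a b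
  bc : H.Adj b c
  cd : H.Adj c d
  de : H.Adj d e
  ea : H.Adj e a
  ac : a ≠ c
  bd : b ≠ d
  ce : c ≠ e
  da : d ≠ a
  eb : e ≠ b

theorem Cycle5.rotate {W : Type*} {H : SimpleGraph W} {a b c d e : W} (h : Cycle5 H a b c d e) : Cycle5 H b c d e a :=
  ⟨h.bc, h.cd, h.de, h.ea, h.ab, h.bd, h.ce, h.da, h.eb, h.ac⟩

theorem Cycle5.reflect {W : Type*} {H : SimpleGraph W} {a b c d e : W} (h : Cycle5 H a b c d e) : Cycle5 H a e d c b :=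
  ⟨h.ea.symm, h.de.symm, h.cd.symm, h.bc.symm, h.ab.symm, h.da.symm, h.ce.symm, h.bd.symm,
    h.ac.symm, h.eb.symm⟩

/-- Every `5`-cycle has at most one edge in a triangle. -/
def FewTriangles {W : Type*} (H : SimpleGraph W) : Prop := ∀ a b c d e, Cycle5 H a b c d e → Tri H a b →
  ¬ Tri H b c ∧ ¬ Tri H c d

/-- The definition speaks only of the two edges following `a b`; rotating the cycle yields the other
two. -/
theorem FewTriangles.others {W : Type*} {H : SimpleGraph W} (hF : FewTriangles H) {a b c d e : W}
    (h : Cycle5 H a b c d e)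
    (ht : Tri H a b) : ¬ Tri H b c ∧ ¬ Tri H c d ∧ ¬ Tri H d e ∧ ¬ Tri H e a := by
  refine ⟨(hF _ _ _ _ _ h ht).1, (hF _ _ _ _ _ h ht).2, fun h' => ?_, fun h' => ?_⟩
  · exact (hF _ _ _ _ _ h.rotate.rotate.rotate h').2 ht
  · exact (hF _ _ _ _ _ h.rotate.rotate.rotate.rotate h').1 ht

theorem Tight.not_small {p : V} (h : Tight H v₀ p) : ¬ Small H v₀ p := not_small_of_deg_five h.2.1

theorem Tight.unique {p m n : V} (h : Tight H v₀ p) (hm : H.Adj p m) (hm' : ¬ Tri H p m)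
    (hn : H.Adj p n) (hn' : ¬ Tri H p n) : m = n :=
  card_le_one.mp h.2.2.le m (by simp [hm, hm']) n (by simp [hn, hn'])

theorem Irreducible.ne_of_two_triangles (hI : Irreducible H v₀) {p x y z t : V} (hx : H.Adj p x)
    (hy : H.Adj p y) (hxy : H.Adj x y) (hz : H.Adj p z) (ht : H.Adj p t) (hzt : H.Adj z t)
    (hzx : z ≠ x) (hzy : z ≠ y) : t ≠ x ∧ t ≠ y := by
  constructor
  · rintro rfl
    exact hzy (hI.common_unique ht.ne hz hzt.symm hy hxy)
  · rintro rfl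
    exact hzx (hI.common_unique ht.ne hz hzt.symm hx hxy.symm)

theorem five_cover {p q x y z t : V} (hd : deg H p = 5) (hq : H.Adj p q) (hx : H.Adj p x)
    (hy : H.Adj p y) (hz : H.Adj p z) (ht : H.Adj p t) (h1 : q ≠ x) (h2 : q ≠ y) (h3 : q ≠ z)
    (h4 : q ≠ t) (h5 : x ≠ y) (h6 : x ≠ z) (h7 : x ≠ t) (h8 : y ≠ z) (h9 : y ≠ t) (h10 : z ≠ t)
    {n : V} (hn : H.Adj p n) : n = q ∨ n = x ∨ n = y ∨ n = z ∨ n = t := by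
  have hc : #({q, x, y, z, t} : Finset V) = 5 := by
    rw [card_insert_of_notMem, card_insert_of_notMem, card_insert_of_notMem, card_pair h10] <;>
      simp [*]
  have hsub : ({q, x, y, z, t} : Finset V) ⊆ univ.filter fun w => H.Adj p w := by
    intro w hw
    simp only [mem_insert, mem_singleton, mem_filter, mem_univ, true_and] at hw ⊢
    rcases hw with rfl | rfl | rfl | rfl | rfl <;> assumption
  have heq := eq_of_subset_of_card_le hsub (by rw [hc]; exact hd.le)
  have : n ∈ ({q, x, y, z, t} : Finset V) := by rw [heq]; simp [hn]
  simpa using this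

theorem Tight.cover {p q x y z t : V} (h : Tight H v₀ p) (hI : Irreducible H v₀) (hq : H.Adj p q)
    (hq' : ¬ Tri H p q) (hx : H.Adj p x) (hy : H.Adj p y) (hxy : H.Adj x y) (hz : H.Adj p z)
    (ht : H.Adj p t) (hzt : H.Adj z t) (hzx : z ≠ x) (hzy : z ≠ y) {n : V} (hn : H.Adj p n) :
    n = q ∨ n = x ∨ n = y ∨ n = z ∨ n = t := by
  obtain ⟨htx, hty⟩ := hI.ne_of_two_triangles hx hy hxy hz ht hzt hzx hzy
  refine five_cover h.2.1 hq hx hy hz ht ?_ ?_ ?_ ?_ hxy.ne hzx.symm htx.symm hzy.symm hty.symm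
    hzt.ne hn
  · rintro rfl; exact hq' ⟨hq, y, hy, hxy⟩
  · rintro rfl; exact hq' ⟨hq, x, hx, hxy.symm⟩
  · rintro rfl; exact hq' ⟨hq, t, ht, hzt⟩
  · rintro rfl; exact hq' ⟨hq, z, hz, hzt.symm⟩

/-- Triangles at `p` do not share edges, so the four edges other than `p q` form two triangles with
`p`. -/
theorem Tight.exists_triangles {p : V} (h : Tight H v₀ p) (hI : Irreducible H v₀) :
    ∃ q x y z t, H.Adj p q ∧ ¬ Tri H p q ∧ H.Adj p x ∧ H.Adj p y ∧ H.Adj x y ∧ H.Adj p z ∧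
      H.Adj p t ∧ H.Adj z t ∧ z ≠ x ∧ z ≠ y ∧ t ≠ x ∧ t ≠ y := by
  have hnt : #(univ.filter fun w => H.Adj p w ∧ ¬ Tri H p w) = 1 := h.2.2
  obtain ⟨q, hq⟩ := card_pos.mp (hnt ▸ Nat.one_pos)
  simp only [mem_filter, mem_univ, true_and] at hq
  have hex : ∀ S : Finset V, #S ≤ 3 → q ∈ S → ∃ x, x ∉ S ∧ Tri H p x := by
    intro S hS hqS
    have : ∃ x ∈ univ.filter (fun w => H.Adj p w), x ∉ S := by
      by_contra hcon
      push Not at hcon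
      have h1 := card_le_card (show univ.filter (fun w => H.Adj p w) ⊆ S from hcon)
      have h2 : #(univ.filter fun w => H.Adj p w) = 5 := h.2.1
      omega
    obtain ⟨x, hx, hxS⟩ := this
    simp only [mem_filter, mem_univ, true_and] at hx
    refine ⟨x, hxS, ?_⟩
    by_contra hnt
    exact hxS (h.unique hx hnt hq.1 hq.2 ▸ hqS)
  obtain ⟨x, -, hpx, y, hpy, hxy⟩ := hex {q} (by simp) (by simp)
  obtain ⟨z, hz, hpz, t, hpt, hzt⟩ := hex {q, x, y} card_le_three (by simp)
  simp only [mem_insert, mem_singleton, not_or] at hz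
  obtain ⟨htx, hty⟩ := hI.ne_of_two_triangles hpx hpy hxy hpz hpt hzt hz.2.1 hz.2.2
  exact ⟨q, x, y, z, t, hq.1, hq.2, hpx, hpy, hxy, hpz, hpt, hzt, hz.2.1, hz.2.2, htx, hty⟩

theorem Irreducible.tightPay_comm (hI : Irreducible H v₀) {x y z : V} (hyz : H.Adj y z) :
    tightPay H v₀ x y z = tightPay H v₀ x z y := by
  simp only [tightPay, or_comm (a := ATri H v₀ x z y), or_comm (a := z = v₀),
    and_comm (a := D4 H v₀ z), or_comm (a := Slot H v₀ z), or_comm (a := D4 H v₀ z)]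
  by_cases hy : D3 H v₀ y
  · have hz : ¬ D3 H v₀ z := fun hz => hI.d3_not_adj hy hz hyz
    simp only [hy, hz, if_true, if_false, or_true, true_or]
  · by_cases hz : D3 H v₀ z
    · simp only [hy, hz, if_true, if_false, or_true, true_or]
    · simp only [hy, hz, or_self, if_false]

theorem light_third {a b c : V} (hI : Irreducible H v₀) (hab : H.Adj a b) (hac : H.Adj a c)
    (hbc : H.Adj b c) (h : (light H v₀).Adj a b) : (light H v₀).Adj a c := by
  obtain ⟨-, d, had, hbd, hsa, hsb, hsd⟩ := h
  obtain rfl := hI.common_unique hab.ne had hbd hac hbc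
  exact ⟨hac, b, hab, hbc.symm, hsa, hsd, hsb⟩

theorem Irreducible.pay3_comm (hI : Irreducible H v₀) {x y z : V} (hxy : H.Adj x y)
    (hxz : H.Adj x z) (hyz : H.Adj y z) : pay3 H v₀ x y z = pay3 H v₀ x z y := by
  have hl : (light H v₀).Adj x y ↔ (light H v₀).Adj x z :=
    ⟨light_third hI hxy hxz hyz, light_third hI hxz hxy hyz.symm⟩
  simp only [pay3, hl, hI.tightPay_comm hyz]

theorem Irreducible.pos_of_adj {x y : V} (h : H.Adj x y) : 0 < deg H x :=
  card_pos.mpr ⟨y, by simp [h]⟩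

/-- A vertex other than the root that has degree at least `5`. -/
def Big (H : SimpleGraph V) (v₀ v : V) : Prop := v ≠ v₀ ∧ 5 ≤ deg H v

theorem Irreducible.kinds (hI : Irreducible H v₀) {x y : V} (h : H.Adj x y) :
    x = v₀ ∨ D3 H v₀ x ∨ D4 H v₀ x ∨ Big H v₀ x := by
  by_cases hx : x = v₀
  · exact Or.inl hx
  have := hI.three_le_deg hx (Irreducible.pos_of_adj h)
  rcases Nat.lt_or_ge 4 (deg H x) with h5 | h5
  · exact Or.inr (Or.inr (Or.inr ⟨hx, h5⟩))
  · rcases Nat.lt_or_ge 3 (deg H x) with h4 | h4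
    · exact Or.inr (Or.inr (Or.inl ⟨hx, by omega⟩))
    · exact Or.inr (Or.inl ⟨hx, by omega⟩)

theorem Big.not_D3 {x : V} (h : Big H v₀ x) : ¬ D3 H v₀ x := fun h' => by
  have := h.2; have := h'.2; omega

theorem Big.not_D4 {x : V} (h : Big H v₀ x) : ¬ D4 H v₀ x := fun h' => by
  have := h.2; have := h'.2; omega

theorem Big.not_small {x : V} (h : Big H v₀ x) : ¬ Small H v₀ x := fun h' =>
  h'.elim h.not_D3 h.not_D4

theorem D4.not_D3 {x : V} (h : D4 H v₀ x) : ¬ D3 H v₀ x := fun h' => h'.not_D4 h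

theorem pay3_root (y z : V) : pay3 H v₀ v₀ y z = 3 := if_pos rfl

theorem D3.pay3_eq {x : V} (h : D3 H v₀ x) (y z : V) :
    pay3 H v₀ x y z = if (light H v₀).Adj x y then 1 else 0 := by
  simp only [pay3, h.1, h.2, if_true, if_false]

theorem D4.pay3_eq {x : V} (h : D4 H v₀ x) (y z : V) :
    pay3 H v₀ x y z = if Slot H v₀ x ∧ ¬ (light H v₀).Adj x y then 1 / 2 else 1 := by
  simp only [pay3, h.1, h.2, if_true, if_false, show ¬ (4 = 3) by norm_num]

theorem Big.pay3_eq {x : V} (h : Big H v₀ x) (y z : V) :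
    pay3 H v₀ x y z = if ¬ Tight H v₀ x then 2 else tightPay H v₀ x y z := by
  have h3 : deg H x ≠ 3 := by have := h.2; omega
  have h4 : deg H x ≠ 4 := by have := h.2; omega
  simp only [pay3, h.1, h3, h4, if_false]

/-- The vertex `y` is not a slot, for a star next to `x` would put `x` into a light triangle. Hence
`y` pays 1, and `z` pays at least 2. -/
theorem Irreducible.sum_pay3_D3D4Big (hI : Irreducible H v₀) {x y z : V} (hxy : H.Adj x y)
    (hyz : H.Adj y z) (hzx : H.Adj z x) (hx : D3 H v₀ x) (hy : D4 H v₀ y) (hz : Big H v₀ z) :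
    3 ≤ pay3 H v₀ x y z + pay3 H v₀ y z x + pay3 H v₀ z x y := by
  have hA : ATri H v₀ z x y := ⟨hx, hy, hzx, hyz.symm, hxy⟩
  have hns : ¬ Slot H v₀ y := fun h => hA.not_star_w hI hz.not_small (Or.inr h)
  have h1 := pay3_nonneg (H := H) (v₀ := v₀) x y z
  have h2 : pay3 H v₀ y z x = 1 := by rw [hy.pay3_eq]; simp [hns]
  have h3 : 2 ≤ pay3 H v₀ z x y := by
    rw [hz.pay3_eq]
    by_cases ht : Tight H v₀ z <;> simp [ht, tightPay, hA]
  linarith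

theorem Irreducible.sum_pay3_D4D4Big (hI : Irreducible H v₀) {x y z : V} (hxy : H.Adj x y)
    (hyz : H.Adj y z) (hzx : H.Adj z x) (hx : D4 H v₀ x) (hy : D4 H v₀ y) (hz : Big H v₀ z) :
    3 ≤ pay3 H v₀ x y z + pay3 H v₀ y z x + pay3 H v₀ z x y := by
  have hnl : ¬ (light H v₀).Adj x y := by
    rintro ⟨-, c, hxc, hyc, -, -, hsc⟩
    exact hz.not_small (hI.common_unique hxy.ne hxc hyc hzx.symm hyz ▸ hsc)
  have hnl' : ¬ (light H v₀).Adj y z := fun h => hz.not_small (light_small h.symm)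
  have hss : ¬ (Slot H v₀ x ∧ Slot H v₀ y) := fun h =>
    hnl (hI.star_adj_light (Or.inr h.1) (Or.inr h.2) hxy)
  rw [hx.pay3_eq, hy.pay3_eq, hz.pay3_eq]
  have h1 : ¬ ATri H v₀ z x y := fun h => hx.not_D3 h.d3
  have h2 : ¬ ATri H v₀ z y x := fun h => hy.not_D3 h.d3
  simp only [hnl, hnl', tightPay, h1, h2, hx.1, hy.1, hx, hy]
  by_cases s1 : Slot H v₀ x <;> by_cases s2 : Slot H v₀ y <;> by_cases ht : Tight H v₀ z <;>
    simp [s1, s2, ht] at hss ⊢ <;> norm_num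

theorem Irreducible.sum_pay3_D3BigBig (hI : Irreducible H v₀) {x y z : V} (hxy : H.Adj x y)
    (hyz : H.Adj y z) (hzx : H.Adj z x) (hx : D3 H v₀ x) (hy : Big H v₀ y) (hz : Big H v₀ z) :
    3 ≤ pay3 H v₀ x y z + pay3 H v₀ y z x + pay3 H v₀ z x y := by
  have h0 := pay3_nonneg (H := H) (v₀ := v₀) x y z
  suffices 3 ≤ pay3 H v₀ y z x + pay3 H v₀ z x y by linarith
  rw [hI.pay3_comm hyz hxy.symm hzx, hy.pay3_eq, hz.pay3_eq]
  have h1 : ¬ ATri H v₀ z x y := fun h => hy.not_D4 h.d4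
  have h2 : ¬ ATri H v₀ z y x := fun h => hy.not_D3 h.d3
  have h3 : ¬ ATri H v₀ y x z := fun h => hz.not_D4 h.d4
  have h4 : ¬ ATri H v₀ y z x := fun h => hz.not_D3 h.d3
  simp only [tightPay, h1, h2, h3, h4, hx.1, hy.1, hz.1, hx, hx.not_D4, or_self, false_and, if_true,
    if_false, true_or]
  by_cases ty : Tight H v₀ y <;> by_cases tz : Tight H v₀ z <;>
    by_cases sy : SemiPoor H v₀ y <;> by_cases sz : SemiPoor H v₀ z <;>
    simp [ty, tz, sy, sz] <;> norm_num

/-- A slot may pay only 1/2; each of the two large vertices pays at least 5/4. -/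
theorem Irreducible.sum_pay3_D4BigBig {x y z : V} (hx : D4 H v₀ x) (hy : Big H v₀ y)
    (hz : Big H v₀ z) : 3 ≤ pay3 H v₀ x y z + pay3 H v₀ y z x + pay3 H v₀ z x y := by
  have h0 : 1 / 2 ≤ pay3 H v₀ x y z := by rw [hx.pay3_eq]; split_ifs <;> norm_num
  have key : ∀ {u u' : V}, Big H v₀ u → Big H v₀ u' →
      5 / 4 ≤ pay3 H v₀ u u' x ∧ 5 / 4 ≤ pay3 H v₀ u x u' := by
    intro u u' hu hu'
    have h1 : ¬ ATri H v₀ u x u' := fun h => hu'.not_D4 h.d4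
    have h2 : ¬ ATri H v₀ u u' x := fun h => hu'.not_D3 h.d3
    rw [hu.pay3_eq, hu.pay3_eq]
    simp only [tightPay, h1, h2, hx.1, hu'.1, hx, hx.not_D3, hu'.not_D3, hu'.not_D4]
    by_cases tu : Tight H v₀ u
    · simp [tu]
    · simp [tu]; norm_num
  have h1 := (key hy hz).1
  have h2 := (key hz hy).2
  linarith

theorem Irreducible.sum_pay3_BigBigBig {x y z : V} (hx : Big H v₀ x) (hy : Big H v₀ y)
    (hz : Big H v₀ z) : 3 ≤ pay3 H v₀ x y z + pay3 H v₀ y z x + pay3 H v₀ z x y := by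
  have key : ∀ {u v w : V}, Big H v₀ u → Big H v₀ v → Big H v₀ w → 1 ≤ pay3 H v₀ u v w := by
    intro u v w hu hv hw
    have h1 : ¬ ATri H v₀ u v w := fun h => hw.not_D4 h.d4
    have h2 : ¬ ATri H v₀ u w v := fun h => hv.not_D4 h.d4
    rw [hu.pay3_eq]
    simp only [tightPay, h1, h2, hv.1, hw.1, hv.not_D3, hv.not_D4, hw.not_D3, hw.not_D4]
    by_cases tu : Tight H v₀ u <;> simp [tu]
  have h1 := key hx hy hz
  have h2 := key hy hz hx
  have h3 := key hz hx hy
  linarith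

theorem sum_pay3_light {x y z : V} (hxy : H.Adj x y)
    (hyz : H.Adj y z) (hzx : H.Adj z x) (hx : Small H v₀ x) (hy : Small H v₀ y)
    (hz : Small H v₀ z) : 3 ≤ pay3 H v₀ x y z + pay3 H v₀ y z x + pay3 H v₀ z x y := by
  have key : ∀ {u v w : V}, Small H v₀ u → (light H v₀).Adj u v → pay3 H v₀ u v w = 1 := by
    rintro u v w (hu | hu) hl
    · rw [hu.pay3_eq, if_pos hl]
    · rw [hu.pay3_eq, if_neg (fun h => h.2 hl)]
  rw [key hx ⟨hxy, z, hzx.symm, hyz, hx, hy, hz⟩, key hy ⟨hyz, x, hxy.symm, hzx, hy, hz, hx⟩,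
    key hz ⟨hzx, y, hyz.symm, hxy, hz, hx, hy⟩]
  norm_num

/-- Every triangle receives at least `3` from its vertices. -/
theorem Irreducible.three_le_sum_pay3 (hI : Irreducible H v₀) {x y z : V} (hxy : H.Adj x y)
    (hyz : H.Adj y z) (hzx : H.Adj z x) :
    3 ≤ pay3 H v₀ x y z + pay3 H v₀ y z x + pay3 H v₀ z x y := by
  have hpos : ∀ u v w, 0 ≤ pay3 H v₀ u v w := pay3_nonneg
  have hswap : pay3 H v₀ x z y + pay3 H v₀ z y x + pay3 H v₀ y x z =
      pay3 H v₀ x y z + pay3 H v₀ y z x + pay3 H v₀ z x y := by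
    rw [hI.pay3_comm hxy hzx.symm hyz, hI.pay3_comm hyz hxy.symm hzx,
      hI.pay3_comm hzx hyz.symm hxy]
    ring
  rcases hI.kinds hxy with rfl | hx
  · have := pay3_root (H := H) (v₀ := x) y z
    linarith [hpos y z x, hpos z x y]
  rcases hI.kinds hyz with rfl | hy
  · have := pay3_root (H := H) (v₀ := y) z x
    linarith [hpos x y z, hpos z x y]
  rcases hI.kinds hzx with rfl | hz
  · have := pay3_root (H := H) (v₀ := z) x y
    linarith [hpos x y z, hpos y z x]
  have L := @sum_pay3_light V _ H v₀ x y z hxy hyz hzx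
  rcases hx with hx | hx | hx <;> rcases hy with hy | hy | hy <;> rcases hz with hz | hz | hz
  · exact L (Or.inl hx) (Or.inl hy) (Or.inl hz)
  · exact L (Or.inl hx) (Or.inl hy) (Or.inr hz)
  · exact absurd hxy (hI.d3_not_adj hx hy)
  · exact L (Or.inl hx) (Or.inr hy) (Or.inl hz)
  · exact L (Or.inl hx) (Or.inr hy) (Or.inr hz)
  · exact hI.sum_pay3_D3D4Big hxy hyz hzx hx hy hz
  · exact absurd hzx (hI.d3_not_adj hz hx)
  · linarith [hI.sum_pay3_D3D4Big hzx.symm hyz.symm hxy.symm hx hz hy]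
  · exact hI.sum_pay3_D3BigBig hxy hyz hzx hx hy hz
  · exact L (Or.inr hx) (Or.inl hy) (Or.inl hz)
  · exact L (Or.inr hx) (Or.inl hy) (Or.inr hz)
  · linarith [hI.sum_pay3_D3D4Big hxy.symm hzx.symm hyz.symm hy hx hz]
  · exact L (Or.inr hx) (Or.inr hy) (Or.inl hz)
  · exact L (Or.inr hx) (Or.inr hy) (Or.inr hz)
  · exact hI.sum_pay3_D4D4Big hxy hyz hzx hx hy hz
  · linarith [hI.sum_pay3_D3D4Big hzx hxy hyz hz hx hy]
  · linarith [hI.sum_pay3_D4D4Big hzx hxy hyz hz hx hy]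
  · linarith [Irreducible.sum_pay3_D4BigBig hx hy hz]
  · exact absurd hyz (hI.d3_not_adj hy hz)
  · linarith [hI.sum_pay3_D3D4Big hyz hzx hxy hy hz hx]
  · linarith [hI.sum_pay3_D3BigBig hyz hzx hxy hy hz hx]
  · linarith [hI.sum_pay3_D3D4Big hyz.symm hxy.symm hzx.symm hz hy hx]
  · linarith [hI.sum_pay3_D4D4Big hyz hzx hxy hy hz hx]
  · linarith [Irreducible.sum_pay3_D4BigBig hy hz hx]
  · linarith [hI.sum_pay3_D3BigBig hzx hxy hyz hz hx hy]
  · linarith [Irreducible.sum_pay3_D4BigBig hz hx hy]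
  · exact Irreducible.sum_pay3_BigBigBig hx hy hz

end Payments

/-! ### Payments to 5-cycles -/

section FiveFaces

variable {V : Type*} [Fintype V] {H : SimpleGraph V} {v₀ : V}

theorem five_le_deg {v a b c d e : V} (ha : H.Adj v a) (hb : H.Adj v b) (hc : H.Adj v c)
    (hd : H.Adj v d) (he : H.Adj v e) (hab : a ≠ b) (hac : a ≠ c) (had : a ≠ d) (hae : a ≠ e)
    (hbc : b ≠ c) (hbd : b ≠ d) (hbe : b ≠ e) (hcd : c ≠ d) (hce : c ≠ e) (hde : d ≠ e) :
    5 ≤ deg H v := by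
  have hcard : #({a, b, c, d, e} : Finset V) = 5 := by
    rw [card_insert_of_notMem, card_insert_of_notMem, card_insert_of_notMem, card_pair hde] <;>
      simp [*]
  rw [← hcard]
  refine card_le_card fun w hw => ?_
  simp only [mem_insert, mem_singleton, mem_filter, mem_univ, true_and] at hw ⊢
  rcases hw with rfl | rfl | rfl | rfl | rfl <;> assumption

theorem pay5_root (a b c e : V) : pay5 H v₀ v₀ a b c e = 1 := if_pos rfl

theorem Slot.pay5_eq {x : V} (h : Slot H v₀ x) (a b c e : V) :
    pay5 H v₀ x a b c e = if Tri H x a then (if D3 H v₀ a then 1 / 3 else 1 / 6)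
      else if Tri H x e then (if D3 H v₀ e then 1 / 3 else 1 / 6) else 0 := by
  simp only [pay5, h.1.1, h.1.2, h, if_true, if_false, show ¬ (4 = 3) by norm_num]

theorem D4.pay5_eq {x : V} (h : D4 H v₀ x) (hs : ¬ Star H v₀ x) (a b c e : V) :
    pay5 H v₀ x a b c e = 1 / 3 := by
  have hs' : ¬ Slot H v₀ x := fun h' => hs (Or.inr h')
  simp only [pay5, h.1, h.2, hs', if_true, if_false, show ¬ (4 = 3) by norm_num]

theorem Big.pay5_eq {x : V} (h : Big H v₀ x) (ht : ¬ Tight H v₀ x) (a b c e : V) :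
    pay5 H v₀ x a b c e = (if Tri H x a then 0 else 1 / 3) + (if Tri H x e then 0 else 1 / 3) := by
  have h3 : deg H x ≠ 3 := by have := h.2; omega
  have h4 : deg H x ≠ 4 := by have := h.2; omega
  simp only [pay5, h.1, h3, h4, ht, not_false_iff, if_true, if_false]

theorem Tight.pay5_eq {x : V} (ht : Tight H v₀ x) (a b c e : V) :
    pay5 H v₀ x a b c e = if Poor H v₀ x then 0 else if Restricted H v₀ x then
      (if (if Tri H x a then Needy H v₀ e c b a else Needy H v₀ a b c e) then 1 / 3 else 0)
      else 1 / 3 := by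
  have h3 : deg H x ≠ 3 := by have := ht.2.1; omega
  have h4 : deg H x ≠ 4 := by have := ht.2.1; omega
  simp only [pay5, ht.1, h3, h4, ht, not_true, if_false]

theorem Tight.big {x : V} (ht : Tight H v₀ x) : Big H v₀ x := ⟨ht.1, ht.2.1.ge⟩

theorem FewTriangles.not_both {W : Type*} {H : SimpleGraph W} (hF : FewTriangles H)
    {x a b c e : W} (h : Cycle5 H x a b c e)
    (ha : Tri H x a) : ¬ Tri H x e := fun he => (hF.others h ha).2.2.2 he.symm

theorem Tight.tri_or {x a b c e : V} (ht : Tight H v₀ x) (h : Cycle5 H x a b c e) :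
    Tri H x a ∨ Tri H x e := by
  by_contra hcon
  push Not at hcon
  exact h.eb (ht.unique h.ab hcon.1 h.ea.symm hcon.2).symm

theorem FewTriangles.pay5_reflect (hF : FewTriangles H) (hI : Irreducible H v₀) {x a b c e : V}
    (h : Cycle5 H x a b c e) : pay5 H v₀ x a b c e = pay5 H v₀ x e c b a := by
  have hnb := hF.not_both h
  rcases hI.kinds h.ab with rfl | hx | hx | hx
  · rw [pay5_root, pay5_root]
  · simp only [pay5, hx.1, hx.2, if_true, if_false]
  · by_cases hs : Star H v₀ x
    · have hs := hs.resolve_left hx.not_D3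
      rw [hs.pay5_eq, hs.pay5_eq]
      by_cases h1 : Tri H x a
      · simp [h1, hnb h1]
      · simp [h1]
    · rw [hx.pay5_eq hs, hx.pay5_eq hs]
  · by_cases ht : Tight H v₀ x
    · rw [ht.pay5_eq, ht.pay5_eq]
      rcases ht.tri_or h with h1 | h1
      · simp [h1, hnb h1]
      · simp [h1, mt hnb (not_not_intro h1)]
    · rw [hx.pay5_eq ht, hx.pay5_eq ht, add_comm]

/-- The general rule, with the three exceptions treated separately. For a large vertex that is not
tight it holds because not both of its cycle edges lie in triangles. -/
theorem FewTriangles.third_le_pay5 (hF : FewTriangles H) (hI : Irreducible H v₀) {x a b c e : V}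
    (h : Cycle5 H x a b c e) (hs : ¬ Star H v₀ x) (hp : ¬ Poor H v₀ x)
    (hr : ¬ Restricted H v₀ x) : 1 / 3 ≤ pay5 H v₀ x a b c e := by
  have hnb := hF.not_both h
  rcases hI.kinds h.ab with rfl | hx | hx | hx
  · rw [pay5_root]; norm_num
  · exact absurd (Or.inl hx) hs
  · rw [hx.pay5_eq hs]
  · by_cases ht : Tight H v₀ x
    · rw [ht.pay5_eq, if_neg hp, if_neg hr]
    · rw [hx.pay5_eq ht]
      by_cases h1 : Tri H x a
      · simp [h1, hnb h1]
      · rw [if_neg h1]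
        split_ifs <;> norm_num

/-- Such a vertex is not tight, since a tight vertex has only one edge outside triangles. So a large
one pays 1/3 for each of its two cycle edges. -/
theorem Irreducible.third_le_pay5_of_not_tri (hI : Irreducible H v₀) {x a b c e : V}
    (h : Cycle5 H x a b c e) (hs : ¬ Star H v₀ x) (ha : ¬ Tri H x a) (he : ¬ Tri H x e) :
    1 / 3 ≤ pay5 H v₀ x a b c e ∧ (¬ D4 H v₀ x → 2 / 3 ≤ pay5 H v₀ x a b c e) := by
  have ht : ¬ Tight H v₀ x := fun ht => (ht.tri_or h).elim ha he
  rcases hI.kinds h.ab with rfl | hx | hx | hx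
  · rw [pay5_root]; norm_num
  · exact absurd (Or.inl hx) hs
  · rw [hx.pay5_eq hs]; exact ⟨le_rfl, fun h => absurd hx h⟩
  · rw [hx.pay5_eq ht, if_neg ha, if_neg he]; norm_num

/-- What the `5`-cycle `a b c d e` receives from its vertices. -/
noncomputable def total5 (H : SimpleGraph V) (v₀ a b c d e : V) : ℚ :=
  pay5 H v₀ a b c d e + pay5 H v₀ b c d e a + pay5 H v₀ c d e a b + pay5 H v₀ d e a b c +
    pay5 H v₀ e a b c d

theorem total5_rotate (a b c d e : V) : total5 H v₀ b c d e a = total5 H v₀ a b c d e := by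
  unfold total5; ring

theorem FewTriangles.total5_reflect (hF : FewTriangles H) (hI : Irreducible H v₀) {a b c d e : V}
    (h : Cycle5 H a b c d e) : total5 H v₀ a e d c b = total5 H v₀ a b c d e := by
  unfold total5
  rw [hF.pay5_reflect hI h, hF.pay5_reflect hI h.rotate, hF.pay5_reflect hI h.rotate.rotate,
    hF.pay5_reflect hI h.rotate.rotate.rotate, hF.pay5_reflect hI h.rotate.rotate.rotate.rotate]
  ring

theorem Irreducible.not_star_of_adj_star (hI : Irreducible H v₀) {a b : V} (ha : Star H v₀ a)
    (hab : H.Adj a b) (hnt : ¬ Tri H a b) : ¬ Star H v₀ b := fun hb =>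
  hnt (tri_of_light (hI.star_adj_light ha hb hab))

theorem Poor.exists_triangles {p : V} (h : Poor H v₀ p) (hI : Irreducible H v₀) :
    ∃ a w a' w', ATri H v₀ p a w ∧ ATri H v₀ p a' w' ∧ a ≠ a' ∧ w ≠ w' ∧
      ∀ n, Tri H p n → n = a ∨ n = w ∨ n = a' ∨ n = w' := by
  obtain ⟨q, x, y, z, t, hq, hnq, hx, hy, hxy, hz, ht, hzt, hzx, hzy, htx, hty⟩ :=
    h.1.exists_triangles hI
  have hA : ∀ {u v}, H.Adj p u → H.Adj p v → H.Adj u v → ATri H v₀ p u v ∨ ATri H v₀ p v u := by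
    intro u v hu hv huv
    by_contra hcon
    push Not at hcon
    exact h.2 ⟨u, v, hu, hv, huv, hcon⟩
  have hc : ∀ n, Tri H p n → n = x ∨ n = y ∨ n = z ∨ n = t := fun n hn =>
    (h.1.cover hI hq hnq hx hy hxy hz ht hzt hzx hzy hn.1).resolve_left
      (by rintro rfl; exact hnq hn)
  rcases hA hx hy hxy with h1 | h1 <;> rcases hA hz ht hzt with h2 | h2
  · exact ⟨x, y, z, t, h1, h2, hzx.symm, hty.symm, hc⟩
  · exact ⟨x, y, t, z, h1, h2, htx.symm, hzy.symm, fun n hn => by have := hc n hn; tauto⟩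
  · exact ⟨y, x, z, t, h1, h2, hzy.symm, htx.symm, fun n hn => by have := hc n hn; tauto⟩
  · exact ⟨y, x, t, z, h1, h2, hty.symm, hzx.symm, fun n hn => by have := hc n hn; tauto⟩

/-- Both `q` and `s` pay 1/3, and even 2/3 if the degree is not 4. The last third comes from `r`
unless it is a star, and from `p` if moreover `q` and `s` have degree 4. -/
theorem Irreducible.total5_of_two (hI : Irreducible H v₀) {p q r s x : V}
    (h : Cycle5 H p q r s x) (tpq : ¬ Tri H p q) (tqr : ¬ Tri H q r) (trs : ¬ Tri H r s)
    (tsx : ¬ Tri H s x) (hq : ¬ Star H v₀ q) (hs : ¬ Star H v₀ s)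
    (hn : Star H v₀ r → D4 H v₀ q → D4 H v₀ s → 1 / 3 ≤ pay5 H v₀ p q r s x) :
    1 ≤ total5 H v₀ p q r s x := by
  have nn := pay5_nonneg (H := H) (v₀ := v₀)
  obtain ⟨q1, q2⟩ := hI.third_le_pay5_of_not_tri h.rotate hq tqr (fun h => tpq h.symm)
  obtain ⟨s1, s2⟩ := hI.third_le_pay5_of_not_tri h.rotate.rotate.rotate hs tsx
    (fun h => trs h.symm)
  have n1 := nn p q r s x
  have n2 := nn r s x p q
  have n3 := nn x p q r s
  unfold total5
  by_cases hr : Star H v₀ r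
  · by_cases d1 : D4 H v₀ q
    · by_cases d2 : D4 H v₀ s
      · linarith [hn hr d1 d2]
      · linarith [s2 d2]
    · linarith [q2 d1]
  · linarith [(hI.third_le_pay5_of_not_tri h.rotate.rotate hr trs (fun h => tqr h.symm)).1]

/-- A poor vertex pays nothing. If `x` has degree 3, then `q` and `s` do not both have degree 4 when
`r` is a star (`poor_cycle`), so `p` is not needed. If `x` has degree 4, then `q`, `s` and `x` are
not stars and pay 1/3 each. -/
theorem FewTriangles.total5_of_poor (hF : FewTriangles H) (hI : Irreducible H v₀)
    {p q r s x : V} (h : Cycle5 H p q r s x) (hx : Tri H p x) (hp : Poor H v₀ p) :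
    1 ≤ total5 H v₀ p q r s x := by
  have nn := pay5_nonneg (H := H) (v₀ := v₀)
  obtain ⟨tpq, tqr, trs, tsx⟩ :=
    hF.others h.rotate.rotate.rotate.rotate hx.symm
  have key : ∀ {a w a' w'}, ATri H v₀ p a w → ATri H v₀ p a' w' → a ≠ a' → x = a ∨ x = w →
      1 ≤ total5 H v₀ p q r s x := by
    intro a w a' w' hA hA' haa hxa
    have hq := hI.poor_not_star hp.1.1 hp.1.2.1 hA hA' haa h.ab tpq
    rcases hxa with rfl | rfl
    · have hs : ¬ Star H v₀ s :=
        hI.not_star_of_adj_star (Or.inl hA.d3) h.de.symm (fun h => tsx h.symm)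
      exact hI.total5_of_two h tpq tqr trs tsx hq hs fun hr hq4 hs4 =>
        absurd hs4 (hI.poor_cycle hp.1.1 hp.1.2.1 hA hA' haa h.ab h.bc h.cd h.de
          h.ce h.ac tpq tqr trs tsx hr hq4)
    · have hs : ¬ Star H v₀ s := hI.poor_not_star_of_adj hp.1.1 hp.1.2.1 hA hA' haa h.de.symm
        (by rintro rfl; exact tsx ⟨hA.aw, p, hA.pa.symm, hA.pw.symm⟩)
      have hw := hA.d4.pay5_eq (hA.not_star_w hI hp.1.not_small) p q r s
      have h1 := (hI.third_le_pay5_of_not_tri h.rotate hq tqr (fun h => tpq h.symm)).1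
      have h2 := (hI.third_le_pay5_of_not_tri h.rotate.rotate.rotate hs tsx
        (fun h => trs h.symm)).1
      unfold total5
      linarith [nn p q r s x, nn r s x p q]
  obtain ⟨a, w, a', w', hA, hA', haa, -, hc⟩ := hp.exists_triangles hI
  rcases hc x hx with h1 | h1 | h1 | h1
  · exact key hA hA' haa (Or.inl h1)
  · exact key hA hA' haa (Or.inr h1)
  · exact key hA' hA haa.symm (Or.inl h1)
  · exact key hA' hA haa.symm (Or.inr h1)

/-- All edges at a slot that is in a triangle with a vertex of larger degree are in triangles. -/
theorem Slot.tri_of_adj {y p z s : V} (hy : Slot H v₀ y) (hI : Irreducible H v₀)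
    (hp : ¬ Small H v₀ p) (hyp : H.Adj y p) (hyz : H.Adj y z) (hpz : H.Adj p z)
    (hys : H.Adj y s) : Tri H y s := by
  by_contra hnt
  obtain ⟨⟨c, hyc, c', hyc', hcc, -, sc, sc'⟩, -⟩ := hy.2.1
  have h1 : c ≠ p := by rintro rfl; exact hp sc
  have h2 : c' ≠ p := by rintro rfl; exact hp sc'
  have h3 : c ≠ z := by
    rintro rfl
    exact h2 (hI.common_unique hyc.ne hyc' hcc hyp hpz.symm)
  have h4 : c' ≠ z := by
    rintro rfl
    exact h1 (hI.common_unique hyc'.ne hyc hcc.symm hyp hpz.symm)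
  have hne : ∀ u, Tri H y u → s ≠ u := by rintro u hu rfl; exact hnt hu
  have := five_le_deg hys hyc hyc' hyp hyz (hne _ ⟨hyc, c', hyc', hcc⟩)
    (hne _ ⟨hyc', c, hyc, hcc.symm⟩) (hne _ ⟨hyp, z, hyz, hpz⟩) (hne _ ⟨hyz, p, hyp, hpz.symm⟩)
    hcc.ne h1 h3 h2 h4 hpz.ne
  have := hy.1.2
  omega

/-- In both forms of the expensive triangle, `q` is not a star. If `x` has degree 4, it is not a
star; then `q`, `x` and one of `r`, `s` pay, since adjacent stars share a triangle. If `x` does not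
have degree 4, then `s` is not a star, and the only case that lacks a third is the needy one, in
which `p` pays it. -/
theorem FewTriangles.total5_of_restricted (hF : FewTriangles H) (hI : Irreducible H v₀)
    {p q r s x : V} (h : Cycle5 H p q r s x) (hx : Tri H p x) (hp : Restricted H v₀ p) :
    1 ≤ total5 H v₀ p q r s x := by
  have nn := pay5_nonneg (H := H) (v₀ := v₀)
  obtain ⟨tpq, tqr, trs, tsx⟩ :=
    hF.others h.rotate.rotate.rotate.rotate hx.symm
  have hR := hp
  obtain ⟨⟨ht, ⟨a, w, hA⟩, hO⟩, y, z, hpy, hpz, hyz, hcase⟩ := hp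
  have hnp : ¬ Small H v₀ p := ht.not_small
  have hq : ¬ Star H v₀ q := by
    rcases hcase with ⟨hy, hz⟩ | ⟨hy, hz, ⟨a', w', hA'⟩, -⟩
    · exact hI.slot_not_star ht.1 ht.2.1 hA hy hz hpy hpz hyz h.ab tpq
    · exact hI.twin_not_star ht.1 ht.2.1 hz.1 hz.2.1 hA hA' hy hpy hpz hyz h.ab tpq
  have caseA : D4 H v₀ x → ¬ Star H v₀ x → 1 ≤ total5 H v₀ p q r s x := by
    intro hx4 hxs
    have h0 := hx4.pay5_eq hxs p q r s
    have h1 := (hI.third_le_pay5_of_not_tri h.rotate hq tqr (fun h => tpq h.symm)).1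
    unfold total5
    by_cases hr : Star H v₀ r
    · have h2 := (hI.third_le_pay5_of_not_tri h.rotate.rotate.rotate
        (hI.not_star_of_adj_star hr h.cd trs) tsx (fun h => trs h.symm)).1
      linarith [nn p q r s x, nn r s x p q]
    · have h2 := (hI.third_le_pay5_of_not_tri h.rotate.rotate hr trs (fun h => tqr h.symm)).1
      linarith [nn p q r s x, nn s x p q r]
  have caseB : ¬ D4 H v₀ x → ¬ Star H v₀ s → 1 ≤ total5 H v₀ p q r s x := by
    intro hx4 hs
    refine hI.total5_of_two h tpq tqr trs tsx hq hs fun hr hq4 hs4 => ?_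
    have hN : Needy H v₀ q r s x := ⟨hr, hq4, hs4, hx4⟩
    rw [ht.pay5_eq, if_neg (fun h => h.2 hO), if_pos hR]
    simp [tpq, hN]
  have hys : Star H v₀ y := hcase.elim (fun h => Or.inr h.1) (fun h => Or.inl h.1)
  have hyw : y ≠ w := by rintro rfl; exact hA.not_star_w hI hnp hys
  have hya : y ≠ a := by
    rintro rfl
    obtain rfl := hI.common_unique hpy.ne hpz hyz hA.pw hA.aw
    rcases hcase with ⟨hy, -⟩ | ⟨-, hz⟩
    · exact hA.d3.not_D4 hy.1
    · exact hz.1.not_small (Or.inr hA.d4)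
  rcases ht.cover hI h.ab tpq hA.pa hA.pw hA.aw hpy hpz hyz hya hyw h.ea.symm with
    rfl | rfl | rfl | rfl | rfl
  · exact absurd rfl h.eb
  · exact caseB hA.d3.not_D4
      (hI.not_star_of_adj_star (Or.inl hA.d3) h.de.symm (fun h => tsx h.symm))
  · exact caseA hA.d4 (hA.not_star_w hI hnp)
  · rcases hcase with ⟨hy, -⟩ | ⟨hy, -⟩
    · exact absurd (hy.tri_of_adj hI hnp hpy.symm hyz hpz h.de.symm) (fun h => tsx h.symm)
    · exact caseB hy.not_D4
        (hI.not_star_of_adj_star hys h.de.symm (fun h => tsx h.symm))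
  · rcases hcase with ⟨hy, hz⟩ | ⟨hy, hz, ⟨a', w', hA'⟩, -⟩
    · refine caseA hz fun hzs => ?_
      obtain ⟨-, c, hyc, hzc, -, -, hc⟩ := hI.star_adj_light hys hzs hyz
      exact hnp (hI.common_unique hyz.ne hyc hzc hpy.symm hpz.symm ▸ hc)
    · exact caseB (fun h4 => hz.not_small (Or.inr h4))
        (hI.twin_not_star hz.1 hz.2.1 ht.1 ht.2.1 hA' hA hy hyz.symm hpz.symm hpy.symm h.de.symm
          (fun h => tsx h.symm))

/-- Adjacent stars share a light triangle, so the other four cycle edges lie in no triangle and `c`,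
`e` are not stars. These two pay 1/3 each, and `a`, `b` together pay 1/3. -/
theorem FewTriangles.total5_of_stars (hF : FewTriangles H) (hI : Irreducible H v₀)
    {a b c d e : V} (h : Cycle5 H a b c d e) (ha : Star H v₀ a) (hb : Star H v₀ b) :
    1 ≤ total5 H v₀ a b c d e := by
  have nn := pay5_nonneg (H := H) (v₀ := v₀)
  have tab := tri_of_light (hI.star_adj_light ha hb h.ab)
  obtain ⟨tbc, tcd, tde, tea⟩ := hF.others h tab
  have hc := (hI.third_le_pay5_of_not_tri h.rotate.rotate
    (hI.not_star_of_adj_star hb h.bc tbc) tcd (fun h => tbc h.symm)).1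
  have he := (hI.third_le_pay5_of_not_tri h.rotate.rotate.rotate.rotate
    (hI.not_star_of_adj_star ha h.ea.symm (fun h => tea h.symm)) tea (fun h => tde h.symm)).1
  -- A slot next to a vertex of degree 3 pays 1/3; two adjacent slots pay 1/6 each.
  have hsum : 1 / 3 ≤ pay5 H v₀ a b c d e + pay5 H v₀ b c d e a := by
    rcases ha with ha | ha <;> rcases hb with hb | hb
    · exact absurd h.ab (hI.d3_not_adj ha hb)
    · rw [hb.pay5_eq, if_neg tbc, if_pos tab.symm, if_pos ha]
      linarith [nn a b c d e]
    · rw [ha.pay5_eq, if_pos tab, if_pos hb]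
      linarith [nn b c d e a]
    · rw [ha.pay5_eq, hb.pay5_eq, if_neg tbc, if_pos tab, if_pos tab.symm, if_neg hb.1.not_D3,
        if_neg ha.1.not_D3]
      norm_num
  unfold total5
  linarith [nn d e a b c]

/-- Every `5`-cycle receives at least `1` from its vertices. -/
theorem FewTriangles.one_le_total5 (hF : FewTriangles H) (hI : Irreducible H v₀)
    {a b c d e : V} (h : Cycle5 H a b c d e) : 1 ≤ total5 H v₀ a b c d e := by
  have hpr : ∀ {a b c d e : V}, Cycle5 H a b c d e → Poor H v₀ a ∨ Restricted H v₀ a →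
      1 ≤ total5 H v₀ a b c d e := by
    intro a b c d e h ha
    have ht : Tight H v₀ a := ha.elim (fun h => h.1) (fun h => h.1.1)
    rcases ht.tri_or h with h1 | h1
    · rw [← hF.total5_reflect hI h]
      exact ha.elim (hF.total5_of_poor hI h.reflect h1) (hF.total5_of_restricted hI h.reflect h1)
    · exact ha.elim (hF.total5_of_poor hI h h1) (hF.total5_of_restricted hI h h1)
  have h1 := h.rotate
  have h2 := h1.rotate
  have h3 := h2.rotate
  have h4 := h3.rotate
  have e1 := total5_rotate (H := H) (v₀ := v₀) a b c d e
  have e2 := total5_rotate (H := H) (v₀ := v₀) b c d e a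
  have e3 := total5_rotate (H := H) (v₀ := v₀) c d e a b
  have e4 := total5_rotate (H := H) (v₀ := v₀) d e a b c
  -- In a deficient cycle there are no poor or restricted vertices and no adjacent stars. So at most
  -- two vertices are stars, and three others pay 1/3 each.
  by_contra hlt
  have hord : ∀ {x y z u v : V}, Cycle5 H x y z u v → ¬ 1 ≤ total5 H v₀ x y z u v →
      (¬ Star H v₀ x → 1 / 3 ≤ pay5 H v₀ x y z u v) ∧ (Star H v₀ x → ¬ Star H v₀ y) := by
    intro x y z u v hc hn
    refine ⟨fun hs => hF.third_le_pay5 hI hc hs (fun hp => hn (hpr hc (Or.inl hp)))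
      (fun hp => hn (hpr hc (Or.inr hp))), fun hs hs' => hn (hF.total5_of_stars hI hc hs hs')⟩
  have o0 := hord h hlt
  have o1 := hord h1 (by linarith)
  have o2 := hord h2 (by linarith)
  have o3 := hord h3 (by linarith)
  have o4 := hord h4 (by linarith)
  have nn := pay5_nonneg (H := H) (v₀ := v₀)
  have n0 := nn a b c d e
  have n1 := nn b c d e a
  have n2 := nn c d e a b
  have n3 := nn d e a b c
  have n4 := nn e a b c d
  apply hlt
  unfold total5
  by_cases s0 : Star H v₀ a
  · have t1 := o1.1 (o0.2 s0)
    have s4 : ¬ Star H v₀ e := fun h => o4.2 h s0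
    have t4 := o4.1 s4
    by_cases s2 : Star H v₀ c
    · linarith [o3.1 (o2.2 s2)]
    · linarith [o2.1 s2]
  · have t0 := o0.1 s0
    by_cases s1 : Star H v₀ b
    · have t2 := o2.1 (o1.2 s1)
      by_cases s3 : Star H v₀ d
      · linarith [o4.1 (o3.2 s3)]
      · linarith [o3.1 s3]
    · have t1 := o1.1 s1
      by_cases s2 : Star H v₀ c
      · linarith [o3.1 (o2.2 s2)]
      · linarith [o2.1 s2]

end FiveFaces

/-! ### Vertices along a face boundary -/

section Boundary

namespace Rotation

variable {V : Type*} {H : SimpleGraph V} (R : Rotation H)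

theorem rot_pow_fst (n : ℕ) (d : H.Dart) : ((R.rot ^ n) d).fst = d.fst := by
  induction n with
  | zero => rfl
  | succ n ih => rw [pow_succ', Equiv.Perm.mul_apply, R.rot_fst, ih]

theorem next_fst (d : H.Dart) : (R.next d).fst = d.snd := R.rot_fst d.symm

/-- The `k`-th vertex on the face boundary from the dart `d`. -/
def pt (d : H.Dart) (k : ℕ) : V := ((R.next ^ k) d).fst

theorem pt_zero (d : H.Dart) : R.pt d 0 = d.fst := rfl

theorem pt_one (d : H.Dart) : R.pt d 1 = d.snd := R.next_fst d

theorem snd_pow (d : H.Dart) (k : ℕ) : ((R.next ^ k) d).snd = R.pt d (k + 1) := by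
  rw [pt, pow_succ', Equiv.Perm.mul_apply, next_fst]

theorem pt_next (d : H.Dart) (k : ℕ) : R.pt (R.next d) k = R.pt d (k + 1) := by
  rw [pt, pt, pow_succ, Equiv.Perm.mul_apply]

theorem pt_adj (d : H.Dart) (k : ℕ) : H.Adj (R.pt d k) (R.pt d (k + 1)) := by
  rw [← R.snd_pow]; exact ((R.next ^ k) d).adj

theorem pt_add (d : H.Dart) {n : ℕ} (h : (R.next ^ n) d = d) (k : ℕ) :
    R.pt d (k + n) = R.pt d k := by
  rw [pt, pow_add, Equiv.Perm.mul_apply, h, pt]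

/-- The boundary of the face at the corner between `d` and `R.rot d` returns to that corner along
the reverse of `d`. -/
theorem pt_rot (d : H.Dart) {n : ℕ} (h : (R.next ^ (n + 1)) (R.rot d) = R.rot d) :
    R.pt (R.rot d) n = d.snd := by
  rw [pow_succ', Equiv.Perm.mul_apply, next_apply] at h
  have := congrArg (fun e : H.Dart => e.snd) (R.rot.injective h)
  exact this

theorem next_ne (d : H.Dart) : R.next d ≠ d := fun h => by
  have := R.next_fst d
  rw [h] at this
  exact d.adj.ne this

theorem not_three_five (d : H.Dart) (h3 : (R.next ^ 3) d = d) : (R.next ^ 5) d ≠ d := fun h5 => by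
  have h6 : (R.next ^ 6) d = d := by
    rw [show 6 = 3 + 3 from rfl, pow_add, Equiv.Perm.mul_apply, h3, h3]
  rw [pow_succ', Equiv.Perm.mul_apply, h5] at h6
  exact R.next_ne d h6

theorem triangle {d : H.Dart} (h : (R.next ^ 3) d = d) :
    H.Adj (R.pt d 0) (R.pt d 1) ∧ H.Adj (R.pt d 1) (R.pt d 2) ∧ H.Adj (R.pt d 2) (R.pt d 0) :=
  ⟨R.pt_adj d 0, R.pt_adj d 1, (R.pt_add d h 0) ▸ R.pt_adj d 2⟩

theorem next_pow_next (d : H.Dart) (n : ℕ) :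
    (R.next ^ n) (R.next d) = R.next d ↔ (R.next ^ n) d = d := by
  rw [← Equiv.Perm.mul_apply, ← pow_succ, pow_succ', Equiv.Perm.mul_apply,
    R.next.injective.eq_iff]

end Rotation

end Boundary

/-! ### Payments summed over corners -/

section Corners

variable {V : Type*} [Fintype V] {H : SimpleGraph V} {v₀ : V}

/-- The darts from `v`. -/
noncomputable def dartsFrom (H : SimpleGraph V) (v : V) : Finset H.Dart := {d | d.fst = v}

theorem mem_dartsFrom {v : V} {d : H.Dart} : d ∈ dartsFrom H v ↔ d.fst = v := by
  simp [dartsFrom]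

theorem card_dartsFrom_filter (v : V) (P : V → Prop) :
    #{d ∈ dartsFrom H v | P d.snd} = #{w | H.Adj v w ∧ P w} := by
  refine card_bij (fun d _ => d.snd) ?_ ?_ ?_
  · intro d hd
    obtain ⟨hd, hP⟩ := mem_filter.mp hd
    have := d.adj
    rw [mem_dartsFrom.mp hd] at this
    simp [this, hP]
  · intro d hd e he h
    rw [mem_filter, mem_dartsFrom] at hd he
    exact SimpleGraph.Dart.ext _ _ (Prod.ext (hd.1.trans he.1.symm) h)
  · intro w hw
    simp only [mem_filter, mem_univ, true_and] at hw
    exact ⟨⟨(v, w), hw.1⟩, by simp [mem_dartsFrom, hw.2], rfl⟩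

theorem card_dartsFrom (v : V) : #(dartsFrom H v) = deg H v := by
  simpa [deg] using card_dartsFrom_filter (H := H) v fun _ => True

theorem sum_dartsFrom (f : H.Dart → ℚ) : ∑ v, ∑ d ∈ dartsFrom H v, f d = ∑ d, f d :=
  sum_fiberwise univ (fun d : H.Dart => d.fst) f

namespace Rotation

variable (R : Rotation H)

theorem isCycleOn (v : V) : R.rot.IsCycleOn (dartsFrom H v : Set H.Dart) := by
  refine ⟨⟨?_, R.rot.injective.injOn, ?_⟩, ?_⟩
  · intro d hd
    simp only [mem_coe, mem_dartsFrom] at hd ⊢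
    rw [R.rot_fst, hd]
  · intro d hd
    refine ⟨R.rot.symm d, ?_, by simp⟩
    simp only [mem_coe, mem_dartsFrom] at hd ⊢
    rw [← R.rot_fst, R.rot.apply_symm_apply, hd]
  · intro d hd e he
    simp only [mem_coe, mem_dartsFrom] at hd he
    exact R.rot_sameCycle d e (hd.trans he.symm)

theorem rot_pow_eq (d : H.Dart) {n : ℕ} : (R.rot ^ n) d = d ↔ deg H d.fst ∣ n := by
  rw [(R.isCycleOn d.fst).pow_apply_eq (mem_dartsFrom.mpr rfl), card_dartsFrom]

theorem rot_rot_ne {d : H.Dart} (h : 3 ≤ deg H d.fst) : R.rot (R.rot d) ≠ d := fun he => by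
  have := Nat.le_of_dvd two_pos ((R.rot_pow_eq d (n := 2)).mp he)
  omega

theorem sum_rot {M : Type*} [AddCommMonoid M] (d : H.Dart) (f : H.Dart → M) :
    ∑ e ∈ dartsFrom H d.fst, f e = ∑ i ∈ range (deg H d.fst), f ((R.rot ^ i) d) := by
  have hc := R.isCycleOn d.fst
  have hd : d ∈ dartsFrom H d.fst := mem_dartsFrom.mpr rfl
  have hinj : Set.InjOn (fun i => (R.rot ^ i) d) (range (deg H d.fst) : Set ℕ) := by
    intro i hi j hj h
    have h' := (hc.pow_apply_eq_pow_apply hd).mp h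
    rw [card_dartsFrom] at h'
    exact h'.eq_of_lt_of_lt (by simpa using hi) (by simpa using hj)
  rw [← sum_image (f := f) hinj]
  congr 1
  ext e
  simp only [mem_image, mem_range]
  constructor
  · intro he
    obtain ⟨n, hn, h⟩ := hc.exists_pow_eq hd he
    exact ⟨n, by rwa [card_dartsFrom] at hn, h⟩
  · rintro ⟨i, -, rfl⟩
    exact mem_dartsFrom.mpr (R.rot_pow_fst i d)

theorem sum_comp_rot {M : Type*} [AddCommMonoid M] (v : V) (f : H.Dart → M) :
    ∑ e ∈ dartsFrom H v, f (R.rot e) = ∑ e ∈ dartsFrom H v, f e :=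
  sum_equiv R.rot (fun d => by simp [mem_dartsFrom, R.rot_fst]) (fun _ _ => rfl)

/-- A boundary walk turns back only at a vertex of degree 1. -/
theorem pt_ne (hdeg : ∀ v, deg H v ≠ 1) (d : H.Dart) (k : ℕ) : R.pt d k ≠ R.pt d (k + 2) := by
  intro h
  set e := (R.next ^ k) d with he
  have h1 : (R.next e).snd = R.pt d (k + 2) := by
    rw [he, ← Equiv.Perm.mul_apply, ← pow_succ', R.snd_pow]
  have h2 : R.rot e.symm = e.symm := by
    refine SimpleGraph.Dart.ext _ _ (Prod.ext (R.rot_fst _) ?_)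
    exact h1.trans h.symm
  have h3 := (R.rot_pow_eq e.symm (n := 1)).mp (by simpa using h2)
  exact hdeg _ (Nat.dvd_one.mp h3)

theorem next_two_ne (hdeg : ∀ v, deg H v ≠ 1) (d : H.Dart) : (R.next ^ 2) d ≠ d := fun h =>
  R.pt_ne hdeg d 0 (R.pt_add d h 0).symm

theorem next_four_ne (hdeg : ∀ v, deg H v ≠ 1) (hI : Irreducible H v₀) (d : H.Dart) :
    (R.next ^ 4) d ≠ d := fun h => by
  have h4 := R.pt_adj d 3
  rw [show 3 + 1 = 0 + 4 from rfl, R.pt_add d h] at h4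
  exact R.pt_ne hdeg d 1 (hI.no_four _ _ _ _ (R.pt_adj d 0) (R.pt_adj d 1) (R.pt_adj d 2) h4
    (R.pt_ne hdeg d 0))

theorem cycle5 (hdeg : ∀ v, deg H v ≠ 1) {d : H.Dart} (h : (R.next ^ 5) d = d) :
    Cycle5 H (R.pt d 0) (R.pt d 1) (R.pt d 2) (R.pt d 3) (R.pt d 4) := by
  have e0 := R.pt_add d h 0
  have e1 := R.pt_add d h 1
  refine ⟨R.pt_adj d 0, R.pt_adj d 1, R.pt_adj d 2, R.pt_adj d 3, e0 ▸ R.pt_adj d 4,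
    R.pt_ne hdeg d 0, R.pt_ne hdeg d 1, R.pt_ne hdeg d 2, e0 ▸ R.pt_ne hdeg d 3,
    e1 ▸ R.pt_ne hdeg d 4⟩

/-- What the triangular face at the corner `d` receives from `d.fst`. -/
noncomputable def triPay (v₀ : V) (d : H.Dart) : ℚ :=
  if (R.next ^ 3) d = d then pay3 H v₀ (R.pt d 0) (R.pt d 1) (R.pt d 2) else 0

/-- What the pentagonal face at the corner `d` receives from `d.fst`. -/
noncomputable def pentPay (v₀ : V) (d : H.Dart) : ℚ :=
  if (R.next ^ 5) d = d then
    pay5 H v₀ (R.pt d 0) (R.pt d 1) (R.pt d 2) (R.pt d 3) (R.pt d 4) else 0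

/-- In a sum over darts, the payments to a face occur once for each of its three darts; hence 3 for
a face amounts to 1 for a dart. -/
theorem card_le_sum_triPay (hI : Irreducible H v₀) :
    (#{d | (R.next ^ 3) d = d} : ℚ) ≤ ∑ d, R.triPay v₀ d := by
  have h1 : ∑ d, R.triPay v₀ (R.next d) = ∑ d, R.triPay v₀ d := Equiv.sum_comp R.next _
  have h2 : ∑ d, R.triPay v₀ (R.next (R.next d)) = ∑ d, R.triPay v₀ d :=
    (Equiv.sum_comp R.next fun d => R.triPay v₀ (R.next d)).trans h1
  have h3 : ∑ d, (if (R.next ^ 3) d = d then (3 : ℚ) else 0) ≤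
      ∑ d, (R.triPay v₀ d + R.triPay v₀ (R.next d) + R.triPay v₀ (R.next (R.next d))) := by
    refine sum_le_sum fun d _ => ?_
    simp only [triPay, next_pow_next]
    split_ifs with h
    · simp only [pt_next]
      rw [show 2 + 1 = 0 + 3 from rfl, show 2 + 1 + 1 = 1 + 3 from rfl, R.pt_add d h,
        R.pt_add d h]
      obtain ⟨t1, t2, t3⟩ := R.triangle h
      exact hI.three_le_sum_pay3 t1 t2 t3
    · norm_num
  rw [sum_add_distrib, sum_add_distrib, h1, h2, ← sum_filter, sum_const, nsmul_eq_mul] at h3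
  linarith

theorem card_le_sum_pentPay (hI : Irreducible H v₀) (hF : FewTriangles H)
    (hdeg : ∀ v, deg H v ≠ 1) :
    (#{d | (R.next ^ 5) d = d} : ℚ) ≤ 5 * ∑ d, R.pentPay v₀ d := by
  set f := R.pentPay v₀ with hf
  have h1 : ∑ d, f (R.next d) = ∑ d, f d := Equiv.sum_comp R.next _
  have h2 : ∑ d, f (R.next (R.next d)) = ∑ d, f d :=
    (Equiv.sum_comp R.next fun d => f (R.next d)).trans h1
  have h3 : ∑ d, f (R.next (R.next (R.next d))) = ∑ d, f d :=
    (Equiv.sum_comp R.next fun d => f (R.next (R.next d))).trans h2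
  have h4 : ∑ d, f (R.next (R.next (R.next (R.next d)))) = ∑ d, f d :=
    (Equiv.sum_comp R.next fun d => f (R.next (R.next (R.next d)))).trans h3
  have h5 : ∑ d, (if (R.next ^ 5) d = d then (1 : ℚ) else 0) ≤
      ∑ d, (f d + f (R.next d) + f (R.next (R.next d)) + f (R.next (R.next (R.next d))) +
        f (R.next (R.next (R.next (R.next d))))) := by
    refine sum_le_sum fun d _ => ?_
    simp only [hf, pentPay, next_pow_next]
    split_ifs with h
    · have := hF.one_le_total5 hI (R.cycle5 hdeg h)
      simp only [pt_next]
      have e0 := R.pt_add d h 0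
      have e1 := R.pt_add d h 1
      have e2 := R.pt_add d h 2
      have e3 := R.pt_add d h 3
      simp only [Nat.reduceAdd] at e0 e1 e2 e3 ⊢
      rw [e0, e1, e2, e3]
      exact this
    · norm_num
  simp only [sum_add_distrib, h1, h2, h3, h4, ← sum_filter, sum_const, nsmul_eq_mul] at h5
  linarith

end Rotation

end Corners

/-! ### Corners of triangular and pentagonal faces -/

section CornerFaces

variable {V : Type*} {H : SimpleGraph V}

theorem dart_ext {d e : H.Dart} (h : d.fst = e.fst)
    (h' : d.snd = e.snd) : d = e := SimpleGraph.Dart.ext _ _ (Prod.ext h h')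

namespace Rotation

variable {R : Rotation H} {e : H.Dart}

/-- The corner between `e` and the next dart belongs to a triangular face. -/
def TriAt (R : Rotation H) (e : H.Dart) : Prop := (R.next ^ 3) (R.rot e) = R.rot e

/-- The corner between `e` and the next dart belongs to a pentagonal face. -/
def PentAt (R : Rotation H) (e : H.Dart) : Prop := (R.next ^ 5) (R.rot e) = R.rot e

theorem adj_rot (R : Rotation H) (e : H.Dart) : H.Adj e.fst (R.rot e).snd := by
  have := (R.rot e).adj
  rwa [R.rot_fst] at this

theorem TriAt.adj (h : R.TriAt e) : H.Adj (R.rot e).snd e.snd := by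
  have h1 := R.pt_rot e h
  have h2 := R.pt_adj (R.rot e) 1
  rwa [R.pt_one, h1] at h2

theorem TriAt.tri_left (h : R.TriAt e) : Tri H e.fst e.snd :=
  ⟨e.adj, _, R.adj_rot e, h.adj.symm⟩

theorem TriAt.tri_right (h : R.TriAt e) : Tri H e.fst (R.rot e).snd :=
  ⟨R.adj_rot e, _, e.adj, h.adj⟩

theorem TriAt.not_pentAt (h : R.TriAt e) : ¬ R.PentAt e := R.not_three_five _ h

end Rotation

end CornerFaces

/-! ### Expenses of the root, of degrees 3 and 4, and of vertices that are not tight -/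

section Budgets

variable {V : Type*} [Fintype V] {H : SimpleGraph V} {v₀ : V}

namespace Rotation

variable {R : Rotation H} {e : H.Dart}

/-- What `e.fst` pays to the face at the corner between `e` and the next dart. -/
noncomputable def load (R : Rotation H) (v₀ : V) (e : H.Dart) : ℚ :=
  R.triPay v₀ (R.rot e) + R.pentPay v₀ (R.rot e)

theorem exists_rot_pow (R : Rotation H) (d : H.Dart) {x : V} (hx : H.Adj d.fst x) :
    ∃ i < deg H d.fst, ((R.rot ^ i) d).snd = x := by
  obtain ⟨i, hi, h⟩ := (R.isCycleOn d.fst).exists_pow_eq (mem_dartsFrom.mpr rfl)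
    (mem_dartsFrom.mpr rfl : (⟨(d.fst, x), hx⟩ : H.Dart) ∈ dartsFrom H d.fst)
  exact ⟨i, by rwa [card_dartsFrom] at hi, by rw [h]⟩

theorem TriAt.load_eq (h : R.TriAt e) : R.load v₀ e = pay3 H v₀ e.fst (R.rot e).snd e.snd := by
  have h3 : (R.next ^ 3) (R.rot e) = R.rot e := h
  have h5 : ¬ (R.next ^ 5) (R.rot e) = R.rot e := h.not_pentAt
  rw [load, triPay, pentPay, if_pos h3, if_neg h5, R.pt_rot e h, R.pt_zero, R.pt_one,
    R.rot_fst, add_zero]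

theorem PentAt.load_eq (h : R.PentAt e) : R.load v₀ e =
    pay5 H v₀ e.fst (R.rot e).snd (R.pt (R.rot e) 2) (R.pt (R.rot e) 3) e.snd := by
  have h3 : ¬ (R.next ^ 3) (R.rot e) = R.rot e := fun h3 => R.not_three_five _ h3 h
  have h5 : (R.next ^ 5) (R.rot e) = R.rot e := h
  rw [load, triPay, pentPay, if_pos h5, if_neg h3, R.pt_rot e h, R.pt_zero, R.pt_one,
    R.rot_fst, zero_add]

theorem load_eq_zero (h3 : ¬ R.TriAt e) (h5 : ¬ R.PentAt e) : R.load v₀ e = 0 := by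
  simp only [TriAt, PentAt] at h3 h5
  rw [load, triPay, pentPay, if_neg h3, if_neg h5, add_zero]

theorem PentAt.cycle5 (h : R.PentAt e) (hdeg : ∀ v, deg H v ≠ 1) :
    Cycle5 H e.fst (R.rot e).snd (R.pt (R.rot e) 2) (R.pt (R.rot e) 3) e.snd := by
  have := R.cycle5 hdeg h
  rwa [R.pt_rot e h, R.pt_zero, R.pt_one, R.rot_fst] at this

theorem PentAt.not_tri (h : R.PentAt e) (hF : FewTriangles H) (hdeg : ∀ v, deg H v ≠ 1)
    (ht : Tri H e.fst e.snd) : ¬ Tri H e.fst (R.rot e).snd := fun ht' =>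
  hF.not_both (h.cycle5 hdeg) ht' ht

/-- Two triangles on a common edge coincide, so the rotation would return after two steps. -/
theorem TriAt.not_next (h : R.TriAt e) (hI : Irreducible H v₀) (hd : 3 ≤ deg H e.fst) :
    ¬ R.TriAt (R.rot e) := fun h' => by
  have h1 := R.adj_rot (R.rot e)
  rw [R.rot_fst] at h1
  have h2 := hI.common_unique (R.adj_rot e).ne e.adj h.adj h1 h'.adj.symm
  refine R.rot_rot_ne hd (dart_ext ?_ h2.symm)
  rw [R.rot_fst, R.rot_fst]

/-- The boundaries on the two sides of `e` continue beyond `e.snd` along the two darts next to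
`e.symm` in the rotation. If these agreed, the degree would be at most 2. -/
theorem PentAt.pt_ne (h : R.PentAt e) (hq : 3 ≤ deg H e.snd) :
    R.pt e 2 ≠ R.pt (R.rot e) 3 := by
  intro hr
  have h4 : (R.next ^ 4) (R.rot e) = e.symm := by
    have h5 : (R.next ^ (4 + 1)) (R.rot e) = R.rot e := h
    rw [pow_succ', Equiv.Perm.mul_apply, next_apply] at h5
    simpa using congrArg SimpleGraph.Dart.symm (R.rot.injective h5)
  have hd : R.rot e.symm = ((R.next ^ 3) (R.rot e)).symm := by
    refine dart_ext ?_ ?_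
    · have h1 := R.snd_pow (R.rot e) 3
      rw [R.pt_rot e h] at h1
      rw [R.rot_fst]
      exact h1.symm
    · exact (R.snd_pow e 1).trans hr
  refine R.rot_rot_ne (d := e.symm) hq ?_
  rw [hd, ← h4, pow_succ' R.next 3, Equiv.Perm.mul_apply, next_apply]

theorem card_dartsFrom_not_tri (v : V) :
    #{d ∈ dartsFrom H v | ¬ Tri H v d.snd} = nt H v := by
  rw [nt]
  convert card_dartsFrom_filter (H := H) v fun w => ¬ Tri H v w

theorem card_triAt_rot (R : Rotation H) (v : V) :
    #{d ∈ dartsFrom H v | R.TriAt (R.rot.symm d)} = #{d ∈ dartsFrom H v | R.TriAt d} := by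
  rw [card_filter, card_filter, ← R.sum_comp_rot]
  simp

/-- The triangular faces at `v` use disjoint pairs of edges in triangles. -/
theorem two_mul_card_triAt_le (R : Rotation H) (hI : Irreducible H v₀) {v : V}
    (hd : 3 ≤ deg H v) : 2 * #{d ∈ dartsFrom H v | R.TriAt d} + nt H v ≤ deg H v := by
  have h1 : Disjoint {d ∈ dartsFrom H v | R.TriAt d} {d ∈ dartsFrom H v | R.TriAt (R.rot.symm d)} := by
    rw [disjoint_filter]
    intro d hdv h2 h3
    have := h3.not_next hI (by
      rw [← R.rot_fst, Equiv.apply_symm_apply, mem_dartsFrom.mp hdv]; exact hd)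
    rw [Equiv.apply_symm_apply] at this
    exact this h2
  have h2 : Disjoint ({d ∈ dartsFrom H v | R.TriAt d} ∪
      {d ∈ dartsFrom H v | R.TriAt (R.rot.symm d)}) {d ∈ dartsFrom H v | ¬ Tri H v d.snd} := by
    rw [← filter_or, disjoint_filter]
    rintro d hdv (h | h) hn <;> obtain rfl := mem_dartsFrom.mp hdv
    · exact hn h.tri_left
    · have := h.tri_right
      rw [Equiv.apply_symm_apply, ← R.rot_fst, Equiv.apply_symm_apply] at this
      exact hn this
  have h3 := card_le_card (show ({d ∈ dartsFrom H v | R.TriAt d} ∪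
      {d ∈ dartsFrom H v | R.TriAt (R.rot.symm d)}) ∪ {d ∈ dartsFrom H v | ¬ Tri H v d.snd} ⊆
      dartsFrom H v by
    intro d hd
    simp only [mem_union, mem_filter] at hd
    tauto)
  rw [card_union_of_disjoint h2, card_union_of_disjoint h1, R.card_triAt_rot, card_dartsFrom,
    card_dartsFrom_not_tri] at h3
  omega

theorem card_triAt_add_card_pentAt_le (R : Rotation H) (v : V) :
    #{d ∈ dartsFrom H v | R.TriAt d} + #{d ∈ dartsFrom H v | R.PentAt d} ≤ deg H v := by
  rw [← card_dartsFrom, ← card_union_of_disjoint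
    (disjoint_filter.mpr fun d _ h h' => h.not_pentAt h')]
  exact card_le_card (union_subset (filter_subset _ _) (filter_subset _ _))

theorem sum_load_le (R : Rotation H) (v : V) (x y : ℚ)
    (h3 : ∀ d, d.fst = v → R.TriAt d → R.load v₀ d ≤ x)
    (h5 : ∀ d, d.fst = v → R.PentAt d → R.load v₀ d ≤ y) :
    ∑ d ∈ dartsFrom H v, R.load v₀ d ≤ #{d ∈ dartsFrom H v | R.TriAt d} * x +
      #{d ∈ dartsFrom H v | R.PentAt d} * y := by
  rw [← nsmul_eq_mul, ← nsmul_eq_mul, ← sum_const, ← sum_const, sum_filter, sum_filter,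
    ← sum_add_distrib]
  refine sum_le_sum fun d hd => ?_
  have hd := mem_dartsFrom.mp hd
  by_cases t3 : R.TriAt d
  · rw [if_pos t3, if_neg t3.not_pentAt, add_zero]
    exact h3 d hd t3
  · by_cases t5 : R.PentAt d
    · rw [if_neg t3, if_pos t5, zero_add]
      exact h5 d hd t5
    · rw [if_neg t3, if_neg t5, load_eq_zero t3 t5, add_zero]

theorem card_pentAt_eq_zero (R : Rotation H) (hF : FewTriangles H) (hdeg : ∀ v, deg H v ≠ 1)
    {v : V} (h : nt H v = 0) : #{d ∈ dartsFrom H v | R.PentAt d} = 0 := by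
  rw [card_eq_zero, filter_eq_empty_iff]
  intro d hd h5
  obtain rfl := mem_dartsFrom.mp hd
  have ht : ∀ w, H.Adj d.fst w → Tri H d.fst w := by
    intro w hw
    by_contra hn
    exact (card_pos.mpr ⟨w, by simp [hw, hn]⟩ : 0 < nt H d.fst).ne' h
  exact h5.not_tri hF hdeg (ht _ d.adj) (ht _ (R.adj_rot d))

/-- With `t` triangular and `p` pentagonal corners, the expense is `3 t + p = 2 t + (t + p)`. The
extra 2 covers degree 2, where both corners may be triangular. -/
theorem sum_load_root (R : Rotation H) (hI : Irreducible H v₀) (hpos : 0 < deg H v₀)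
    (hdeg : ∀ v, deg H v ≠ 1) : ∑ d ∈ dartsFrom H v₀, R.load v₀ d ≤ 2 * deg H v₀ + 2 := by
  have h := R.sum_load_le (v₀ := v₀) v₀ 3 1 (fun d hd h => by rw [h.load_eq, hd, pay3_root])
    (fun d hd h => by rw [h.load_eq, hd, pay5_root])
  have h1 := R.card_triAt_add_card_pentAt_le v₀
  have h2 : 2 * #{d ∈ dartsFrom H v₀ | R.TriAt d} ≤ deg H v₀ + 2 := by
    rcases Nat.lt_or_ge (deg H v₀) 3 with h3 | h3
    · have := hdeg v₀
      omega
    · have := R.two_mul_card_triAt_le hI h3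
      omega
  have h1' : (#{d ∈ dartsFrom H v₀ | R.TriAt d} : ℚ) + #{d ∈ dartsFrom H v₀ | R.PentAt d} ≤
    deg H v₀ := by exact_mod_cast h1
  have h2' : (2 : ℚ) * #{d ∈ dartsFrom H v₀ | R.TriAt d} ≤ deg H v₀ + 2 := by exact_mod_cast h2
  linarith

theorem sum_load_D3 (R : Rotation H) (hI : Irreducible H v₀) {v : V} (hv : D3 H v₀ v) :
    ∑ d ∈ dartsFrom H v, R.load v₀ d ≤ if ∃ a, (light H v₀).Adj v a then 1 else 0 := by
  have h := R.sum_load_le (v₀ := v₀) v (if ∃ a, (light H v₀).Adj v a then 1 else 0) 0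
    (fun d hd h => by
      rw [h.load_eq, hd, hv.pay3_eq]
      split_ifs with h1 h2 h2
      · exact le_rfl
      · exact absurd ⟨_, h1⟩ h2
      · norm_num
      · exact le_rfl)
    (fun d hd h => by rw [h.load_eq, hd]; simp [pay5, hv.1, hv.2])
  have h2 := R.two_mul_card_triAt_le hI hv.2.ge
  have h3 : (#{d ∈ dartsFrom H v | R.TriAt d} : ℚ) ≤ 1 := by
    have := hv.2
    exact_mod_cast (by omega : #{d ∈ dartsFrom H v | R.TriAt d} ≤ 1)
  split_ifs at h ⊢ <;> linarith

theorem sum_load_D4 (R : Rotation H) (hI : Irreducible H v₀) (hF : FewTriangles H)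
    (hdeg : ∀ v, deg H v ≠ 1) {v : V} (hv : D4 H v₀ v) (hs : ¬ Star H v₀ v) :
    ∑ d ∈ dartsFrom H v, R.load v₀ d ≤ 2 := by
  have h := R.sum_load_le (v₀ := v₀) v 1 (1 / 3)
    (fun d hd h => by rw [h.load_eq, hd, hv.pay3_eq]; split_ifs <;> norm_num)
    (fun d hd h => by rw [h.load_eq, hd, hv.pay5_eq hs])
  have h1 := R.card_triAt_add_card_pentAt_le v
  have h2 := R.two_mul_card_triAt_le hI (v := v) (by have := hv.2; omega)
  have h0 := R.card_pentAt_eq_zero hF hdeg (v := v)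
  rw [hv.2] at h1 h2
  -- An edge outside triangles leaves room for only one triangular corner; without such an edge no
  -- corner is pentagonal.
  have h3 : 3 * #{d ∈ dartsFrom H v | R.TriAt d} + #{d ∈ dartsFrom H v | R.PentAt d} ≤ 6 := by
    by_cases hn : nt H v = 0
    · have := h0 hn; omega
    · omega
  have h3' : (3 : ℚ) * #{d ∈ dartsFrom H v | R.TriAt d} + #{d ∈ dartsFrom H v | R.PentAt d} ≤ 6 := by
    exact_mod_cast h3
  linarith

theorem sum_load_slot_of_triAt (R : Rotation H) (hI : Irreducible H v₀) (hF : FewTriangles H)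
    (hdeg : ∀ v, deg H v ≠ 1) {d : H.Dart} (hv : Slot H v₀ d.fst) (hd : R.TriAt d) :
    ∑ e ∈ dartsFrom H d.fst, R.load v₀ e ≤ 3 / 2 := by
  have h4 : deg H d.fst = 4 := hv.1.2
  have h3 : 3 ≤ deg H d.fst := by omega
  obtain ⟨v, hvd⟩ : ∃ v, d.fst = v := ⟨_, rfl⟩
  obtain ⟨e₁, he₁⟩ : ∃ e, R.rot d = e := ⟨_, rfl⟩
  obtain ⟨e₂, he₂⟩ : ∃ e, R.rot e₁ = e := ⟨_, rfl⟩
  obtain ⟨e₃, he₃⟩ : ∃ e, R.rot e₂ = e := ⟨_, rfl⟩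
  have he₄ : R.rot e₃ = d := by
    have := (R.rot_pow_eq d (n := 4)).mpr (by rw [h4])
    rw [← he₃, ← he₂, ← he₁]
    exact this
  have hsum : ∑ e ∈ dartsFrom H d.fst, R.load v₀ e =
      R.load v₀ d + R.load v₀ e₁ + R.load v₀ e₂ + R.load v₀ e₃ := by
    rw [R.sum_rot, h4]
    simp only [sum_range_succ, sum_range_zero, zero_add, ← he₃, ← he₂, ← he₁]
    rfl
  have f₁ : e₁.fst = v := by rw [← he₁, R.rot_fst, hvd]
  have f₂ : e₂.fst = v := by rw [← he₂, R.rot_fst, f₁]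
  have f₃ : e₃.fst = v := by rw [← he₃, R.rot_fst, f₂]
  have n₁ : ¬ R.TriAt e₁ := he₁ ▸ hd.not_next hI h3
  have n₃ : ¬ R.TriAt e₃ := fun h => by
    have := h.not_next hI (by rw [f₃, ← hvd]; exact h3)
    rw [he₄] at this
    exact this hd
  have hcov : ∀ {x}, H.Adj v x → x = d.snd ∨ x = e₁.snd ∨ x = e₂.snd ∨ x = e₃.snd := by
    intro x hx
    rw [← hvd] at hx
    obtain ⟨i, hi, h⟩ := R.exists_rot_pow d hx
    rw [h4] at hi
    interval_cases i
    · exact Or.inl h.symm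
    · rw [← he₁]; exact Or.inr (Or.inl h.symm)
    · rw [← he₂, ← he₁]; exact Or.inr (Or.inr (Or.inl h.symm))
    · rw [← he₃, ← he₂, ← he₁]; exact Or.inr (Or.inr (Or.inr h.symm))
  have hne : ∀ {i j : ℕ}, i < 4 → j < 4 → i ≠ j → ((R.rot ^ i) d).snd ≠ ((R.rot ^ j) d).snd := by
    intro i j hi hj hij h
    have h' := dart_ext (by rw [R.rot_pow_fst, R.rot_pow_fst]) h
    rw [(R.isCycleOn d.fst).pow_apply_eq_pow_apply (mem_dartsFrom.mpr rfl), card_dartsFrom, h4]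
      at h'
    exact hij (h'.eq_of_lt_of_lt hi hj)
  have d01 : d.snd ≠ e₁.snd := by rw [← he₁]; exact @hne 0 1 (by simp) (by simp) (by simp)
  have d02 : d.snd ≠ e₂.snd := by
    rw [← he₂, ← he₁]; exact @hne 0 2 (by simp) (by simp) (by simp)
  have d03 : d.snd ≠ e₃.snd := by
    rw [← he₃, ← he₂, ← he₁]; exact @hne 0 3 (by simp) (by simp) (by simp)
  have d12 : e₁.snd ≠ e₂.snd := by
    rw [← he₂, ← he₁]; exact @hne 1 2 (by simp) (by simp) (by simp)
  have d13 : e₁.snd ≠ e₃.snd := by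
    rw [← he₃, ← he₂, ← he₁]; exact @hne 1 3 (by simp) (by simp) (by simp)
  have a₀ : H.Adj v d.snd := hvd ▸ d.adj
  have a₁ : H.Adj v e₁.snd := f₁ ▸ e₁.adj
  have a₂ : H.Adj v e₂.snd := f₂ ▸ e₂.adj
  have a₃ : H.Adj v e₃.snd := f₃ ▸ e₃.adj
  have hadj : H.Adj e₁.snd d.snd := he₁ ▸ hd.adj
  have t₀ : Tri H v d.snd := ⟨a₀, _, a₁, hadj.symm⟩
  have t₁ : Tri H v e₁.snd := ⟨a₁, _, a₀, hadj⟩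
  rw [hvd] at hv
  have l₀ : R.load v₀ d = if ¬ (light H v₀).Adj v e₁.snd then 1 / 2 else 1 := by
    rw [hd.load_eq, hvd, he₁, hv.1.pay3_eq]
    simp only [hv, true_and]
  have hpart : ∀ {x y}, H.Adj v x → H.Adj v y → x ≠ d.snd → x ≠ e₁.snd → H.Adj x y →
      y ≠ d.snd ∧ y ≠ e₁.snd := by
    intro x y hx hy hx0 hx1 hxy
    constructor
    · rintro rfl
      exact hx1 (hI.common_unique a₀.ne hx hxy.symm a₁ hadj.symm)
    · rintro rfl
      exact hx0 (hI.common_unique a₁.ne hx hxy.symm a₀ hadj)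
  rw [hsum]
  -- If one more edge is in a triangle, all four are and no corner is pentagonal; the triangular
  -- faces cost at most 1 + 1/2 because a slot has an edge that is not light. Otherwise the pentagon
  -- between the two other edges gets nothing, and those beside the triangle get at most 1/3 + 1/6,
  -- as adjacent vertices do not both have degree 3.
  by_cases t₂ : Tri H v e₂.snd ∨ Tri H v e₃.snd
  · have hadj' : H.Adj e₂.snd e₃.snd := by
      rcases t₂ with ⟨-, c, hc, hc'⟩ | ⟨-, c, hc, hc'⟩
      · obtain ⟨c0, c1⟩ := hpart a₂ hc d02.symm d12.symm hc'
        rcases hcov hc with rfl | rfl | rfl | rfl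
        · exact absurd rfl c0
        · exact absurd rfl c1
        · exact absurd hc' (H.irrefl)
        · exact hc'
      · obtain ⟨c0, c1⟩ := hpart a₃ hc d03.symm d13.symm hc'
        rcases hcov hc with rfl | rfl | rfl | rfl
        · exact absurd rfl c0
        · exact absurd rfl c1
        · exact hc'.symm
        · exact absurd hc' (H.irrefl)
    have t₂ : Tri H v e₂.snd := ⟨a₂, _, a₃, hadj'⟩
    have t₃ : Tri H v e₃.snd := ⟨a₃, _, a₂, hadj'.symm⟩
    have z₁ : R.load v₀ e₁ = 0 := load_eq_zero n₁ fun h5 =>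
      h5.not_tri hF hdeg (by rw [f₁]; exact t₁) (by rw [f₁, he₂]; exact t₂)
    have z₃ : R.load v₀ e₃ = 0 := load_eq_zero n₃ fun h5 =>
      h5.not_tri hF hdeg (by rw [f₃]; exact t₃) (by rw [f₃, he₄]; exact t₀)
    rw [l₀, z₁, z₃]
    by_cases n₂ : R.TriAt e₂
    · have l₂ : R.load v₀ e₂ = if ¬ (light H v₀).Adj v e₃.snd then 1 / 2 else 1 := by
        rw [n₂.load_eq, f₂, he₃, hv.1.pay3_eq]
        simp only [hv, true_and]
      rw [l₂]
      by_cases g₁ : (light H v₀).Adj v e₁.snd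
      · by_cases g₃ : (light H v₀).Adj v e₃.snd
        · obtain ⟨x, hx, hnx⟩ := hv.2.2
          rcases hcov hx with rfl | rfl | rfl | rfl
          · exact absurd (light_third hI a₁ a₀ hadj g₁) hnx
          · exact absurd g₁ hnx
          · exact absurd (light_third hI a₃ a₂ hadj'.symm g₃) hnx
          · exact absurd g₃ hnx
        · simp only [g₁, g₃]; norm_num
      · simp only [g₁]; split_ifs <;> norm_num at *
    · have z₂ : R.load v₀ e₂ = 0 := load_eq_zero n₂ fun h5 =>
        h5.not_tri hF hdeg (by rw [f₂]; exact t₂) (by rw [f₂, he₃]; exact t₃)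
      rw [z₂]
      split_ifs <;> norm_num
  · push Not at t₂
    obtain ⟨t₂, t₃⟩ := t₂
    have z₂ : R.load v₀ e₂ = 0 := by
      by_cases h5 : R.PentAt e₂
      · rw [h5.load_eq, f₂, he₃, hv.pay5_eq, if_neg t₃, if_neg t₂]
      · exact load_eq_zero (fun h => t₂ (f₂ ▸ h.tri_left)) h5
    have z₁ : R.load v₀ e₁ ≤ if D3 H v₀ e₁.snd then 1 / 3 else 1 / 6 := by
      by_cases h5 : R.PentAt e₁
      · rw [h5.load_eq, f₁, he₂, hv.pay5_eq, if_neg t₂, if_pos t₁]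
      · rw [load_eq_zero n₁ h5]; split_ifs <;> norm_num
    have z₃ : R.load v₀ e₃ ≤ if D3 H v₀ d.snd then 1 / 3 else 1 / 6 := by
      by_cases h5 : R.PentAt e₃
      · rw [h5.load_eq, f₃, he₄, hv.pay5_eq, if_pos t₀]
      · rw [load_eq_zero n₃ h5]; split_ifs <;> norm_num
    have z₀ : R.load v₀ d ≤ 1 := by rw [l₀]; split_ifs <;> norm_num
    split_ifs at z₁ z₃ with g₁ g₂ g₂
    · exact absurd hadj (hI.d3_not_adj g₁ g₂)
    all_goals linarith

theorem sum_load_slot (R : Rotation H) (hI : Irreducible H v₀) (hF : FewTriangles H)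
    (hdeg : ∀ v, deg H v ≠ 1) {v : V} (hv : Slot H v₀ v) :
    ∑ d ∈ dartsFrom H v, R.load v₀ d ≤ 3 / 2 := by
  by_cases h : ∃ d, d.fst = v ∧ R.TriAt d
  · obtain ⟨d, rfl, hd⟩ := h
    exact R.sum_load_slot_of_triAt hI hF hdeg hv hd
  · have h5 := R.sum_load_le (v₀ := v₀) v 0 (1 / 3)
      (fun d hd h' => absurd ⟨d, hd, h'⟩ h)
      (fun d hd h' => by rw [h'.load_eq, hd, hv.pay5_eq]; split_ifs <;> norm_num)
    have h1 := R.card_triAt_add_card_pentAt_le v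
    rw [hv.1.2] at h1
    have h2 : (#{d ∈ dartsFrom H v | R.PentAt d} : ℚ) ≤ 4 := by
      exact_mod_cast (by omega : #{d ∈ dartsFrom H v | R.PentAt d} ≤ 4)
    linarith

/-- A triangular face costs 2, and an edge outside triangles costs 1/3 on each side. From degree 6
on this fits the budget. At degree 5 it fails only for two triangular faces and one further edge,
which would make the vertex tight. -/
theorem sum_load_big (R : Rotation H) (hI : Irreducible H v₀)
    {v : V} (hv : Big H v₀ v) (ht : ¬ Tight H v₀ v) :
    ∑ d ∈ dartsFrom H v, R.load v₀ d ≤ 2 * deg H v - 6 := by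
  set g : H.Dart → ℚ := fun d => if Tri H v d.snd then 0 else 1 / 3 with hg
  have h1 : ∑ d ∈ dartsFrom H v, g d = nt H v * (1 / 3) := by
    have : ∀ d, g d = if ¬ Tri H v d.snd then 1 / 3 else 0 := fun d => by
      simp only [hg]; split_ifs <;> simp_all
    simp only [this]
    rw [← sum_filter, sum_const, nsmul_eq_mul, card_dartsFrom_not_tri]
  have h2 : ∑ d ∈ dartsFrom H v, g (R.rot d) = nt H v * (1 / 3) :=
    (R.sum_comp_rot v g).trans h1
  have hg0 : ∀ d, 0 ≤ g d := fun d => by simp only [hg]; split_ifs <;> norm_num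
  have h3 : ∑ d ∈ dartsFrom H v, R.load v₀ d ≤
      ∑ d ∈ dartsFrom H v, ((if R.TriAt d then 2 else 0) + (g (R.rot d) + g d)) := by
    refine sum_le_sum fun d hd => ?_
    have hd := mem_dartsFrom.mp hd
    by_cases t3 : R.TriAt d
    · rw [if_pos t3, t3.load_eq, hd, hv.pay3_eq, if_pos ht]
      linarith [hg0 (R.rot d), hg0 d]
    · rw [if_neg t3]
      by_cases t5 : R.PentAt d
      · rw [t5.load_eq, hd, hv.pay5_eq ht, zero_add]
      · rw [load_eq_zero t3 t5]
        linarith [hg0 (R.rot d), hg0 d]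
  rw [sum_add_distrib, sum_add_distrib, h1, h2, ← sum_filter, sum_const, nsmul_eq_mul] at h3
  have h4 := R.two_mul_card_triAt_le hI (v := v) (by have := hv.2; omega)
  have h5 : 6 * #{d ∈ dartsFrom H v | R.TriAt d} + 2 * nt H v + 18 ≤ 6 * deg H v := by
    have h6 := hv.2
    rcases Nat.lt_or_ge 5 (deg H v) with h7 | h7
    · omega
    · have h8 : nt H v ≠ 1 := fun h => ht ⟨hv.1, by omega, h⟩
      omega
  have h5' : (6 : ℚ) * #{d ∈ dartsFrom H v | R.TriAt d} + 2 * nt H v + 18 ≤ 6 * deg H v := by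
    exact_mod_cast h5
  linarith

end Rotation

end Budgets

/-! ### Expenses of tight vertices -/

section TightBudgets

variable {V : Type*} [Fintype V] {H : SimpleGraph V} {v₀ : V}

theorem tightPay_le_two (x y z : V) : tightPay H v₀ x y z ≤ 2 := by
  unfold tightPay; split_ifs <;> norm_num

theorem tightPay_le {x y z : V} (h1 : ¬ ATri H v₀ x y z) (h2 : ¬ ATri H v₀ x z y) :
    tightPay H v₀ x y z ≤ 5 / 3 := by
  simp only [tightPay, h1, h2, or_self, if_false]
  split_ifs <;> norm_num

theorem SemiPoor.tightPay_le {x y z : V} (h : SemiPoor H v₀ x) (h1 : ¬ ATri H v₀ x y z)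
    (h2 : ¬ ATri H v₀ x z y) : tightPay H v₀ x y z ≤ 3 / 2 := by
  simp only [tightPay, h1, h2, h, or_self, if_false, not_true, true_and, false_and]
  split_ifs <;> norm_num

theorem SemiPoor.tightPay_le_of_not_restricted {x y z : V} (h : SemiPoor H v₀ x)
    (hr : ¬ Restricted H v₀ x) (hxy : H.Adj x y) (hxz : H.Adj x z) (hyz : H.Adj y z)
    (h1 : ¬ ATri H v₀ x y z) (h2 : ¬ ATri H v₀ x z y) : tightPay H v₀ x y z ≤ 4 / 3 := by
  simp only [tightPay, h1, h2, h, or_self, if_false, not_true, true_and, false_and]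
  by_cases h4 : D4 H v₀ y ∧ D4 H v₀ z
  · have hs : ¬ (Slot H v₀ y ∨ Slot H v₀ z) := by
      rintro (hs | hs)
      · exact hr ⟨h, y, z, hxy, hxz, hyz, Or.inl ⟨hs, h4.2⟩⟩
      · exact hr ⟨h, z, y, hxz, hxy, hyz.symm, Or.inl ⟨hs, h4.1⟩⟩
    simp only [h4, hs, if_false, and_self, if_true]
    split_ifs <;> norm_num
  · by_cases hy : D3 H v₀ y
    · have hz : ¬ SemiPoor H v₀ z := fun hz => hr ⟨h, y, z, hxy, hxz, hyz, Or.inr ⟨hy, hz⟩⟩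
      simp only [h4, hy, hz, if_true, if_false, true_or, not_false_iff]
      split_ifs <;> norm_num
    · by_cases hz : D3 H v₀ z
      · have hy' : ¬ SemiPoor H v₀ y := fun hy' =>
          hr ⟨h, z, y, hxz, hxy, hyz.symm, Or.inr ⟨hz, hy'⟩⟩
        simp only [h4, hy, hz, hy', if_true, if_false, or_true, not_false_iff]
        split_ifs <;> norm_num
      · simp only [h4, hy, hz, or_self, if_false]
        split_ifs <;> norm_num

theorem Tight.pay5_le {x : V} (h : Tight H v₀ x) (a b c e : V) :
    pay5 H v₀ x a b c e ≤ 1 / 3 := by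
  rw [h.pay5_eq]
  split_ifs <;> norm_num

namespace Rotation

variable {R : Rotation H}

/-- A restricted vertex does not pay to the faces on both sides of its edge outside triangles. -/
theorem not_needy_of_needy (hI : Irreducible H v₀) (hF : FewTriangles H)
    (hdeg : ∀ v, deg H v ≠ 1) {e₀ e₄ : H.Dart} {v x₂ x₃ : V} (hv : Restricted H v₀ v)
    (f₀ : e₀.fst = v) (he : R.rot e₄ = e₀)
    (hpair : ∀ {x y}, H.Adj v x → H.Adj v y → H.Adj x y → x = (R.rot e₀).snd ∧ y = x₂ ∨
      x = x₂ ∧ y = (R.rot e₀).snd ∨ x = x₃ ∧ y = e₄.snd ∨ x = e₄.snd ∧ y = x₃)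
    (t₁ : Tri H v (R.rot e₀).snd) (t₄ : Tri H v e₄.snd)
    (h₀ : R.PentAt e₀) (h₄ : R.PentAt e₄)
    (hn₄ : Needy H v₀ e₀.snd (R.pt e₀ 2) (R.pt e₀ 3) e₄.snd) :
    ¬ Needy H v₀ e₀.snd (R.pt (R.rot e₀) 3) (R.pt (R.rot e₀) 2) (R.rot e₀).snd := by
  intro hn₀
  have f₄ : e₄.fst = v := by rw [← R.rot_fst, he, f₀]
  have c₀ := (h₀.cycle5 hdeg).reflect
  have c₄ := h₄.cycle5 hdeg
  rw [f₀] at c₀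
  rw [he, f₄] at c₄
  obtain ⟨r₄, q4, s₄, hx₄⟩ := hn₄
  obtain ⟨r₀, -, s₀, hx₁⟩ := hn₀
  have hrr := h₀.pt_ne (R := R) (by rw [q4.2]; norm_num)
  obtain ⟨⟨ht, ⟨a, w, hA⟩, -⟩, y, z, hpy, hpz, hyz, hcase⟩ := hv
  -- A slot together with a vertex of degree 4 is ruled out: one of them would be the vertex next to
  -- `v` on one of the needy cycles, where degree 4 is excluded.
  have hcase : D3 H v₀ y ∧ SemiPoor H v₀ z := by
    refine hcase.resolve_left fun ⟨hy, hz⟩ => ?_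
    rcases hpair hpy hpz hyz with ⟨rfl, rfl⟩ | ⟨rfl, rfl⟩ | ⟨rfl, rfl⟩ | ⟨rfl, rfl⟩
    · exact hx₁ hy.1
    · exact hx₁ hz
    · exact hx₄ hz
    · exact hx₄ hy.1
  have hya : y ≠ a := by
    rintro rfl
    obtain rfl := hI.common_unique hpy.ne hpz hyz hA.pw hA.aw
    exact hcase.2.1.not_small (Or.inr hA.d4)
  have o₄ := hF.others c₄.rotate.rotate.rotate.rotate t₄.symm
  have o₀ := hF.others c₀.rotate.rotate.rotate.rotate t₁.symm
  -- Whichever cycle contains `a`, the other one supplies the middle vertex of `double_cycle` with a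
  -- second star neighbour.
  rcases hpair hA.pa hA.pw hA.aw with ⟨rfl, rfl⟩ | ⟨rfl, rfl⟩ | ⟨rfl, rfl⟩ | ⟨rfl, rfl⟩
  · exact hI.double_cycle ht.1 ht.2.1 hA hcase.1 hpy hpz hyz hya c₀.ab c₀.bc c₀.cd c₀.de c₀.ce
      c₀.ac o₀.1 o₀.2.1 o₀.2.2.1 o₀.2.2.2 r₀ q4 s₀ c₄.bc hrr.symm c₄.ac r₄
  · exact hx₁ hA.d4
  · exact hx₄ hA.d4
  · exact hI.double_cycle ht.1 ht.2.1 hA hcase.1 hpy hpz hyz hya c₄.ab c₄.bc c₄.cd c₄.de c₄.ce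
      c₄.ac o₄.1 o₄.2.1 o₄.2.2.1 o₄.2.2.2 r₄ q4 s₄ c₀.bc hrr c₀.ac r₀

theorem sum_load_tight (R : Rotation H) (hI : Irreducible H v₀) (hF : FewTriangles H)
    (hdeg : ∀ v, deg H v ≠ 1) {v : V} (hv : Tight H v₀ v) :
    ∑ d ∈ dartsFrom H v, R.load v₀ d ≤ 4 := by
  have hnt : #(univ.filter fun w => H.Adj v w ∧ ¬ Tri H v w) = 1 := hv.2.2
  obtain ⟨q, hq⟩ := card_pos.mp (hnt ▸ Nat.one_pos)
  simp only [mem_filter, mem_univ, true_and] at hq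
  obtain ⟨d, f₀, hdq⟩ : ∃ d : H.Dart, d.fst = v ∧ d.snd = q := ⟨⟨(v, q), hq.1⟩, rfl, rfl⟩
  have h5 : deg H d.fst = 5 := by rw [f₀]; exact hv.2.1
  have tq : ¬ Tri H v d.snd := hdq ▸ hq.2
  have hne : ∀ {i : ℕ}, 0 < i → i < 5 → Tri H v ((R.rot ^ i) d).snd := by
    intro i hi hi'
    by_contra hn
    have hf : ((R.rot ^ i) d).fst = v := by rw [R.rot_pow_fst, f₀]
    have h := hv.unique (f₀ ▸ d.adj) tq (hf ▸ ((R.rot ^ i) d).adj) hn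
    have h' := (R.rot_pow_eq d).mp (dart_ext (hf.trans f₀.symm) h.symm)
    rw [h5] at h'
    exact absurd (Nat.le_of_dvd hi h') (by omega)
  obtain ⟨e₁, he₁⟩ : ∃ e, R.rot d = e := ⟨_, rfl⟩
  obtain ⟨e₂, he₂⟩ : ∃ e, R.rot e₁ = e := ⟨_, rfl⟩
  obtain ⟨e₃, he₃⟩ : ∃ e, R.rot e₂ = e := ⟨_, rfl⟩
  obtain ⟨e₄, he₄⟩ : ∃ e, R.rot e₃ = e := ⟨_, rfl⟩
  have he₅ : R.rot e₄ = d := by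
    have := (R.rot_pow_eq d (n := 5)).mpr (by rw [h5])
    rw [← he₄, ← he₃, ← he₂, ← he₁]
    exact this
  have f₁ : e₁.fst = v := by rw [← he₁, R.rot_fst, f₀]
  have f₂ : e₂.fst = v := by rw [← he₂, R.rot_fst, f₁]
  have f₃ : e₃.fst = v := by rw [← he₃, R.rot_fst, f₂]
  have f₄ : e₄.fst = v := by rw [← he₄, R.rot_fst, f₃]
  have t₁ : Tri H v e₁.snd := by rw [← he₁]; exact @hne 1 (by simp) (by simp)
  have t₂ : Tri H v e₂.snd := by rw [← he₂, ← he₁]; exact @hne 2 (by simp) (by simp)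
  have t₃ : Tri H v e₃.snd := by rw [← he₃, ← he₂, ← he₁]; exact @hne 3 (by simp) (by simp)
  have t₄ : Tri H v e₄.snd := by
    rw [← he₄, ← he₃, ← he₂, ← he₁]; exact @hne 4 (by simp) (by simp)
  have hcov : ∀ {x}, H.Adj v x → x = d.snd ∨ x = e₁.snd ∨ x = e₂.snd ∨ x = e₃.snd ∨
      x = e₄.snd := by
    intro x hx
    rw [← f₀] at hx
    obtain ⟨i, hi, h⟩ := R.exists_rot_pow d hx
    rw [h5] at hi
    rw [← he₄, ← he₃, ← he₂, ← he₁]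
    interval_cases i
    · exact Or.inl h.symm
    · exact Or.inr (Or.inl h.symm)
    · exact Or.inr (Or.inr (Or.inl h.symm))
    · exact Or.inr (Or.inr (Or.inr (Or.inl h.symm)))
    · exact Or.inr (Or.inr (Or.inr (Or.inr h.symm)))
  have hsum : ∑ e ∈ dartsFrom H v, R.load v₀ e =
      R.load v₀ d + R.load v₀ e₁ + R.load v₀ e₂ + R.load v₀ e₃ + R.load v₀ e₄ := by
    rw [← f₀, R.sum_rot, h5]
    simp only [sum_range_succ, sum_range_zero, zero_add, ← he₄, ← he₃, ← he₂, ← he₁]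
    rfl
  rw [hsum]
  have l₀ : R.load v₀ d ≤ 1 / 3 := by
    by_cases h : R.PentAt d
    · rw [h.load_eq, f₀]; exact hv.pay5_le _ _ _ _
    · rw [load_eq_zero (fun h => tq (f₀ ▸ h.tri_left)) h]; norm_num
  have l₄ : R.load v₀ e₄ ≤ 1 / 3 := by
    by_cases h : R.PentAt e₄
    · rw [h.load_eq, f₄]; exact hv.pay5_le _ _ _ _
    · refine (load_eq_zero (fun h => tq ?_) h).trans_le (by norm_num)
      have := h.tri_right
      rwa [f₄, he₅] at this
  have lt : ∀ {e : H.Dart}, e.fst = v → R.TriAt e →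
      R.load v₀ e = tightPay H v₀ v (R.rot e).snd e.snd := by
    intro e hf h
    rw [h.load_eq, hf, hv.big.pay3_eq, if_neg (not_not_intro hv)]
  have lz : ∀ {e : H.Dart}, e.fst = v → Tri H v e.snd → Tri H v (R.rot e).snd → ¬ R.TriAt e →
      R.load v₀ e = 0 := by
    rintro e rfl h1 h2 h
    exact load_eq_zero h fun h' => h'.not_tri hF hdeg h1 h2
  have l2 : ∀ {e : H.Dart}, e.fst = v → Tri H v e.snd → Tri H v (R.rot e).snd →
      R.load v₀ e ≤ 2 := by
    intro e hf h1 h2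
    by_cases h : R.TriAt e
    · rw [lt hf h]; exact tightPay_le_two _ _ _
    · rw [lz hf h1 h2 h]; norm_num
  have hd3 : ∀ {e : H.Dart}, e.fst = v → 3 ≤ deg H e.fst := by
    rintro e rfl; rw [hv.2.1]; norm_num
  have k₁ := l2 f₁ t₁ (he₂ ▸ t₂)
  have k₂ := l2 f₂ t₂ (he₃ ▸ t₃)
  have k₃ := l2 f₃ t₃ (he₄ ▸ t₄)
  -- Pentagonal payments arise only on the two sides of `d`. A triangular face at the middle corner
  -- excludes those at the corners next to it. So unless `e₁` and `e₃` both carry triangular faces,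
  -- the expense is at most 2 + 2/3.
  by_cases T₂ : R.TriAt e₂
  · have z₁ := lz f₁ t₁ (he₂ ▸ t₂) fun h => (he₂ ▸ h.not_next hI (hd3 f₁)) T₂
    have z₃ := lz f₃ t₃ (he₄ ▸ t₄) (he₃ ▸ T₂.not_next hI (hd3 f₂))
    linarith
  have z₂ := lz f₂ t₂ (he₃ ▸ t₃) T₂
  by_cases T₁ : R.TriAt e₁
  swap
  · linarith [lz f₁ t₁ (he₂ ▸ t₂) T₁]
  by_cases T₃ : R.TriAt e₃
  swap
  · linarith [lz f₃ t₃ (he₄ ▸ t₄) T₃]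
  have x₁ := lt f₁ T₁
  have x₃ := lt f₃ T₃
  rw [he₂] at x₁
  rw [he₄] at x₃
  have a₁₂ : H.Adj e₂.snd e₁.snd := he₂ ▸ T₁.adj
  have a₃₄ : H.Adj e₄.snd e₃.snd := he₄ ▸ T₃.adj
  have hpair : ∀ {x y}, H.Adj v x → H.Adj v y → H.Adj x y → x = e₁.snd ∧ y = e₂.snd ∨
      x = e₂.snd ∧ y = e₁.snd ∨ x = e₃.snd ∧ y = e₄.snd ∨ x = e₄.snd ∧ y = e₃.snd := by
    intro x y hx hy hxy
    rcases hcov hx with rfl | rfl | rfl | rfl | rfl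
    · exact absurd ⟨hx, y, hy, hxy⟩ tq
    · exact Or.inl ⟨rfl, hI.common_unique hx.ne hy hxy t₂.1 a₁₂.symm⟩
    · exact Or.inr (Or.inl ⟨rfl, hI.common_unique hx.ne hy hxy t₁.1 a₁₂⟩)
    · exact Or.inr (Or.inr (Or.inl ⟨rfl, hI.common_unique hx.ne hy hxy t₄.1 a₃₄.symm⟩))
    · exact Or.inr (Or.inr (Or.inr ⟨rfl, hI.common_unique hx.ne hy hxy t₃.1 a₃₄⟩))
  -- The budget 4 is kept as 2 + 2 for poor vertices, 5/3 + 5/3 + 2/3 without a triangle of degrees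
  -- 3 and 4, 2 + 3/2 + 1/3 for restricted vertices, and 2 + 4/3 + 2/3 for the other semi-poor ones.
  by_cases hP : HasOther H v₀ v
  swap
  · have hp : Poor H v₀ v := ⟨hv, hP⟩
    have y₀ : R.load v₀ d ≤ 0 := by
      by_cases h : R.PentAt d
      · rw [h.load_eq, f₀, hv.pay5_eq, if_pos hp]
      · rw [load_eq_zero (fun h => tq (f₀ ▸ h.tri_left)) h]
    have y₄ : R.load v₀ e₄ ≤ 0 := by
      by_cases h : R.PentAt e₄
      · rw [h.load_eq, f₄, hv.pay5_eq, if_pos hp]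
      · refine (load_eq_zero (fun h => tq ?_) h).le
        have := h.tri_right
        rwa [f₄, he₅] at this
    linarith
  have hother : (¬ ATri H v₀ v e₂.snd e₁.snd ∧ ¬ ATri H v₀ v e₁.snd e₂.snd) ∨
      (¬ ATri H v₀ v e₄.snd e₃.snd ∧ ¬ ATri H v₀ v e₃.snd e₄.snd) := by
    obtain ⟨x, y, hx, hy, hxy, h1, h2⟩ := hP
    rcases hpair hx hy hxy with ⟨rfl, rfl⟩ | ⟨rfl, rfl⟩ | ⟨rfl, rfl⟩ | ⟨rfl, rfl⟩
    · exact Or.inl ⟨h2, h1⟩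
    · exact Or.inl ⟨h1, h2⟩
    · exact Or.inr ⟨h2, h1⟩
    · exact Or.inr ⟨h1, h2⟩
  by_cases hS : ∃ a w, ATri H v₀ v a w
  swap
  · have hno : ∀ a w, ¬ ATri H v₀ v a w := fun a w h => hS ⟨a, w, h⟩
    rw [x₁, z₂, x₃]
    linarith [tightPay_le (hno e₂.snd e₁.snd) (hno e₁.snd e₂.snd),
      tightPay_le (hno e₄.snd e₃.snd) (hno e₃.snd e₄.snd)]
  have hSP : SemiPoor H v₀ v := ⟨hv, hS, hP⟩
  by_cases hR : Restricted H v₀ v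
  · have htri : R.load v₀ e₁ + R.load v₀ e₃ ≤ 7 / 2 := by
      rcases hother with ⟨h1, h2⟩ | ⟨h1, h2⟩
      · have := hSP.tightPay_le h1 h2
        rw [x₁]; linarith
      · have := hSP.tightPay_le h1 h2
        rw [x₃]; linarith
    have hpoor : ¬ Poor H v₀ v := fun h => h.2 hP
    have hfive : R.load v₀ d + R.load v₀ e₄ ≤ 1 / 3 := by
      by_cases h0 : R.PentAt d
      swap
      · rw [load_eq_zero (fun h => tq (f₀ ▸ h.tri_left)) h0]; linarith
      by_cases h4 : R.PentAt e₄
      swap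
      · have : R.load v₀ e₄ = 0 := load_eq_zero (fun h => tq (by
          have := h.tri_right
          rwa [f₄, he₅] at this)) h4
        linarith
      have key := not_needy_of_needy (R := R) hI hF hdeg hR f₀ he₅ (x₂ := e₂.snd)
        (x₃ := e₃.snd) (by rw [he₁]; exact hpair) (by rw [he₁]; exact t₁) t₄ h0 h4
      rw [he₁] at key
      have g₀ := h0.load_eq (v₀ := v₀)
      have g₄ := h4.load_eq (v₀ := v₀)
      rw [f₀, he₁, hv.pay5_eq, if_neg hpoor, if_pos hR] at g₀
      rw [f₄, he₅, hv.pay5_eq, if_neg hpoor, if_pos hR] at g₄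
      simp only [t₁, if_true] at g₀
      simp only [tq, if_false] at g₄
      by_cases hn : Needy H v₀ d.snd (R.pt d 2) (R.pt d 3) e₄.snd
      · rw [if_neg (key hn)] at g₀
        linarith
      · rw [if_neg hn] at g₄
        linarith
    linarith
  · have htri : R.load v₀ e₁ + R.load v₀ e₃ ≤ 10 / 3 := by
      rcases hother with ⟨h1, h2⟩ | ⟨h1, h2⟩
      · have := hSP.tightPay_le_of_not_restricted hR t₂.1 t₁.1 a₁₂ h1 h2
        rw [x₁]; linarith
      · have := hSP.tightPay_le_of_not_restricted hR t₄.1 t₃.1 a₃₄ h1 h2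
        rw [x₃]; linarith
    linarith

end Rotation

end TightBudgets

/-! ### The discharging contradiction -/

section Counting

variable {V : Type*} [Fintype V] {H : SimpleGraph V} {v₀ : V}

theorem Rotation.sum_load (R : Rotation H) :
    ∑ v, ∑ d ∈ dartsFrom H v, R.load v₀ d = ∑ d, R.triPay v₀ d + ∑ d, R.pentPay v₀ d := by
  rw [sum_dartsFrom]
  simp only [Rotation.load]
  rw [sum_add_distrib, Equiv.sum_comp R.rot (R.triPay v₀), Equiv.sum_comp R.rot (R.pentPay v₀)]

theorem card_dart_eq_sum (H : SimpleGraph V) : Fintype.card H.Dart = ∑ v, deg H v := by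
  rw [← card_univ, card_eq_sum_card_fiberwise (f := fun d : H.Dart => d.fst) (t := univ)
    (fun _ _ => mem_univ _)]
  exact sum_congr rfl fun v _ => card_dartsFrom v

/-- In total the corrections 1 and -1/2 do not add anything, by `two_mul_card_le`, and the 8 of the
root stays below the 12 in Euler's inequality. -/
theorem Rotation.sum_load_vertex_le (R : Rotation H) (hI : Irreducible H v₀)
    (hF : FewTriangles H) (hdeg : ∀ v, deg H v ≠ 1) (v : V) :
    ∑ d ∈ dartsFrom H v, R.load v₀ d ≤ 2 * deg H v - (if 0 < deg H v then 6 else 0) +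
      (if D3 H v₀ v ∧ ∃ a, (light H v₀).Adj v a then 1 else 0) -
      (if Slot H v₀ v then 1 / 2 else 0) + (if v = v₀ then 8 else 0) := by
  rcases Nat.eq_zero_or_pos (deg H v) with h0 | hpos
  · have h3 : ¬ D3 H v₀ v := fun h => by have := h.2; omega
    have h4 : ¬ Slot H v₀ v := fun h => by have := h.1.2; omega
    have he : dartsFrom H v = ∅ := card_eq_zero.mp ((card_dartsFrom v).trans h0)
    simp only [he, h0, h3, h4, sum_empty, false_and, if_false, lt_irrefl]
    split_ifs <;> norm_num
  rw [if_pos hpos]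
  obtain ⟨w, hw⟩ := card_pos.mp hpos
  rcases hI.kinds (by simpa using hw) with rfl | h | h | h
  · have h3 : ¬ D3 H v v := fun h => h.1 rfl
    have h4 : ¬ Slot H v v := fun h => h.1.1 rfl
    have := R.sum_load_root hI hpos hdeg
    simp only [h3, h4, false_and, if_false, if_true]
    linarith
  · have h4 : ¬ Slot H v₀ v := fun h' => h.not_D4 h'.1
    have := R.sum_load_D3 hI h
    simp only [h, h4, h.2, h.1, true_and, if_false]
    push_cast
    linarith
  · have hn := h.not_D3
    by_cases hs : Slot H v₀ v
    · have := R.sum_load_slot hI hF hdeg hs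
      simp only [hn, hs, h.2, h.1, false_and, if_false, if_true]
      push_cast
      linarith
    · have := R.sum_load_D4 hI hF hdeg h (by rintro (h' | h'); exacts [hn h', hs h'])
      simp only [hn, hs, h.2, h.1, false_and, if_false]
      push_cast
      linarith
  · have hs : ¬ Slot H v₀ v := fun h' => h.not_D4 h'.1
    simp only [h.not_D3, hs, h.1, false_and, if_false]
    by_cases ht : Tight H v₀ v
    · have := R.sum_load_tight hI hF hdeg ht
      rw [ht.2.1]
      push_cast
      linarith
    · have := R.sum_load_big hI h ht
      linarith

/-- An irreducible subgraph of a plane graph in which every `5`-cycle has at most one edge in a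
triangle has no edges. -/
theorem Irreducible.not_adj {G : SimpleGraph V} (E : PlaneEmbedding G) (hH : H ≤ G)
    (hI : Irreducible H v₀) (hF : FewTriangles H) (h1 : deg H v₀ ≠ 1) (a b : V) :
    ¬ H.Adj a b := by
  intro hab
  have hdeg : ∀ v, deg H v ≠ 1 := by
    intro v hv
    by_cases hv₀ : v = v₀
    · exact h1 (hv₀ ▸ hv)
    · have := hI.three_le_deg hv₀ (by omega)
      omega
  obtain ⟨R, hR⟩ := E.exists_rotation hH hab
  have horb : 30 * Nat.card (Quotient (Equiv.Perm.SameCycle.setoid R.next)) ≤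
      5 * Fintype.card H.Dart + 5 * #{d | (R.next ^ 3) d = d} + #{d | (R.next ^ 5) d = d} := by
    convert card_orbits_le (τ := R.next) R.next_ne (R.next_two_ne hdeg)
      (R.next_four_ne hdeg hI)
  have hdarts : 2 * Nat.card H.edgeSet = Fintype.card H.Dart := by
    rw [H.dart_card_eq_twice_card_edges, Nat.card_eq_fintype_card, SimpleGraph.edgeFinset_card]
  have hiso : Nat.card {v // ∀ w, ¬ H.Adj v w} + #{v | 0 < deg H v} = Nat.card V := by
    have h : Nat.card {v // ∀ w, ¬ H.Adj v w} = #{v | ¬ 0 < deg H v} := by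
      rw [Nat.card_eq_fintype_card, Fintype.card_subtype]
      congr 1
      ext v
      simp [deg, filter_eq_empty_iff]
    rw [h, Nat.card_eq_fintype_card, ← card_univ, add_comm]
    exact card_filter_add_card_filter_not _
  have hsum := sum_le_sum fun v (_ : v ∈ univ) => R.sum_load_vertex_le hI hF hdeg v
  rw [R.sum_load] at hsum
  simp only [sum_add_distrib, sum_sub_distrib, ← mul_sum, ← sum_filter, sum_const, nsmul_eq_mul]
    at hsum
  have hroot : #{v : V | v = v₀} = 1 := card_eq_one.mpr ⟨v₀, by ext; simp⟩
  have hn : (∑ v, (deg H v : ℚ)) = Fintype.card H.Dart := by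
    rw [card_dart_eq_sum]; push_cast; rfl
  rw [hroot, hn] at hsum
  have h3 := R.card_le_sum_triPay hI
  have h5 := R.card_le_sum_pentPay hI hF hdeg
  have hslot : (2 : ℚ) * #{u | D3 H v₀ u ∧ ∃ a, (light H v₀).Adj u a} ≤ #{e | Slot H v₀ e} := by
    exact_mod_cast hI.two_mul_card_le
  -- Euler's inequality times 30, with the orbit bound inserted. Divided by 5, it says that the sum
  -- of `2 deg - 6` plus 12 is at most 3 for each triangular and 1 for each pentagonal face.
  have heuler : (10 : ℚ) * Fintype.card H.Dart + 60 ≤ 30 * #{v | 0 < deg H v} +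
      5 * #{d | (R.next ^ 3) d = d} + #{d | (R.next ^ 5) d = d} := by
    exact_mod_cast (by omega : 10 * Fintype.card H.Dart + 60 ≤ 30 * #{v | 0 < deg H v} +
      5 * #{d | (R.next ^ 3) d = d} + #{d | (R.next ^ 5) d = d})
  push_cast at hsum
  linarith

end Counting

/-! ### Forbidden cycle lengths and the final induction -/

section Main

variable {V : Type*}

theorem Tri.mono {G H : SimpleGraph V} (hH : H ≤ G) {a b : V} (h : Tri H a b) : Tri G a b :=
  let ⟨hab, c, hac, hbc⟩ := h
  ⟨hH hab, c, hH hac, hH hbc⟩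

theorem Cycle5.mono {G H : SimpleGraph V} (hH : H ≤ G) {a b c d e : V}
    (h : Cycle5 H a b c d e) : Cycle5 G a b c d e :=
  ⟨hH h.ab, hH h.bc, hH h.cd, hH h.de, hH h.ea, h.ac, h.bd, h.ce, h.da, h.eb⟩

theorem FewTriangles.mono {G H : SimpleGraph V} (hF : FewTriangles G) (hH : H ≤ G) :
    FewTriangles H := fun a b c d e h ht =>
  let ⟨h1, h2⟩ := hF a b c d e (h.mono hH) (ht.mono hH)
  ⟨fun h => h1 (h.mono hH), fun h => h2 (h.mono hH)⟩

theorem NoCycleOfLength.four {G : SimpleGraph V} (h : NoCycleOfLength G 4) (a b c d : V)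
    (hab : G.Adj a b) (hbc : G.Adj b c) (hcd : G.Adj c d) (hda : G.Adj d a) (hac : a ≠ c) :
    b = d := by
  by_contra hbd
  refine h a (.cons hab (.cons hbc (.cons hcd (.cons hda .nil)))) ?_ rfl
  have := hab.ne
  have := hbc.ne
  have := hcd.ne
  have := hda.ne
  simp [SimpleGraph.Walk.cons_isCycle_iff, SimpleGraph.Walk.cons_isPath_iff]
  grind

theorem NoCycleOfLength.five {G : SimpleGraph V} (h : NoCycleOfLength G 5) {a b c d e : V}
    (hc : Cycle5 G a b c d e) : False := by
  obtain ⟨hab, hbc, hcd, hde, hea, _, _, _, _, _⟩ := hc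
  refine h a (.cons hab (.cons hbc (.cons hcd (.cons hde (.cons hea .nil))))) ?_ rfl
  have := hab.ne
  have := hbc.ne
  have := hcd.ne
  have := hde.ne
  have := hea.ne
  simp [SimpleGraph.Walk.cons_isCycle_iff, SimpleGraph.Walk.cons_isPath_iff]
  grind

/-- An apex on the cycle would produce a 4-cycle. An apex off the cycle can be inserted between `a`
and `b` to make the cycle longer by one. -/
theorem Cycle5.exists_apex {G : SimpleGraph V} (h4 : NoCycleOfLength G 4) {a b c d e : V}
    (h : Cycle5 G a b c d e) (ht : Tri G a b) :
    ∃ x, G.Adj a x ∧ G.Adj x b ∧ x ≠ c ∧ x ≠ d ∧ x ≠ e := by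
  obtain ⟨-, x, hax, hbx⟩ := ht
  refine ⟨x, hax, hbx.symm, ?_, ?_, ?_⟩
  · rintro rfl
    exact h.ce (h4.four _ _ _ _ hax h.cd h.de h.ea h.da.symm)
  · rintro rfl
    exact h.bd (h4.four _ _ _ _ h.ab h.bc h.cd hax.symm h.ac)
  · rintro rfl
    exact h.ce (h4.four _ _ _ _ h.bc h.cd h.de hbx.symm h.bd)

theorem NoCycleOfLength.six {G : SimpleGraph V} (h : NoCycleOfLength G 6)
    (h4 : NoCycleOfLength G 4) {a b c d e : V} (hc : Cycle5 G a b c d e) : ¬ Tri G a b := by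
  intro ht
  obtain ⟨x, hax, hxb, hx⟩ := hc.exists_apex h4 ht
  obtain ⟨hab, hbc, hcd, hde, hea, _, _, _, _, _⟩ := hc
  refine h a (.cons hax (.cons hxb (.cons hbc (.cons hcd (.cons hde (.cons hea .nil)))))) ?_ rfl
  have := hab.ne
  have := hbc.ne
  have := hcd.ne
  have := hde.ne
  have := hea.ne
  have := hax.ne
  have := hxb.ne
  simp [SimpleGraph.Walk.cons_isCycle_iff, SimpleGraph.Walk.cons_isPath_iff]
  grind

/-- Two cycle edges in triangles would have different apexes, by the absence of 4-cycles, and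
inserting both gives a 7-cycle. -/
theorem NoCycleOfLength.seven {G : SimpleGraph V} (h : NoCycleOfLength G 7)
    (h4 : NoCycleOfLength G 4) : FewTriangles G := by
  intro a b c d e hc ht
  obtain ⟨x, hax, hxb, hxc, hxd, hxe⟩ := hc.exists_apex h4 ht
  have n1 := hc.ab.ne
  have n2 := hc.bc.ne
  have n3 := hc.cd.ne
  have n4 := hc.de.ne
  have n5 := hc.ea.ne
  have n6 := hax.ne
  have n7 := hxb.ne
  constructor
  · intro ht'
    obtain ⟨y, hby, hyc, hyd, hye, hya⟩ := hc.rotate.exists_apex h4 ht'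
    have hxy : x ≠ y := by
      rintro rfl
      exact hxb.ne (h4.four _ _ _ _ hc.ab hc.bc hyc.symm hax.symm hc.ac).symm
    obtain ⟨hab, hbc, hcd, hde, hea, _, _, _, _, _⟩ := hc
    refine h a (.cons hax (.cons hxb (.cons hby (.cons hyc (.cons hcd (.cons hde
      (.cons hea .nil))))))) ?_ rfl
    have := hby.ne
    have := hyc.ne
    simp [SimpleGraph.Walk.cons_isCycle_iff, SimpleGraph.Walk.cons_isPath_iff]
    grind
  · intro ht'
    obtain ⟨y, hcy, hyd, hye, hya, hyb⟩ := hc.rotate.rotate.exists_apex h4 ht'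
    have hxy : x ≠ y := by
      rintro rfl
      exact hxb.ne (h4.four _ _ _ _ hc.ab hc.bc hcy hax.symm hc.ac).symm
    obtain ⟨hab, hbc, hcd, hde, hea, _, _, _, _, _⟩ := hc
    refine h a (.cons hax (.cons hxb (.cons hbc (.cons hcy (.cons hyd (.cons hde
      (.cons hea .nil))))))) ?_ rfl
    have := hcy.ne
    have := hyd.ne
    simp [SimpleGraph.Walk.cons_isCycle_iff, SimpleGraph.Walk.cons_isPath_iff]
    grind

theorem fewTriangles_of_noCycle {G : SimpleGraph V} {l : ℕ} (hl : l = 5 ∨ l = 6 ∨ l = 7)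
    (h4 : NoCycleOfLength G 4) (h : NoCycleOfLength G l) : FewTriangles G := by
  rcases hl with rfl | rfl | rfl
  · exact fun a b c d e hc => (h.five hc).elim
  · exact fun a b c d e hc ht => absurd ht (h.six h4 hc)
  · exact h.seven h4

theorem isolate_lt [Fintype V] {H : SimpleGraph V} {B : Finset V} {v : V} (hv : v ∈ B)
    (hpos : 0 < deg H v) : isolate H B < H := by
  refine lt_of_le_of_ne (fun _ _ h => h.1) fun he => ?_
  obtain ⟨w, hw⟩ := card_pos.mp hpos
  have hvw : H.Adj v w := by simpa using hw
  rw [← he] at hvw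
  exact hvw.2.1 hv

theorem decomposable_of_not_adj [Fintype V] {H : SimpleGraph V} (h : ∀ a b, ¬ H.Adj a b)
    (v₀ : V) : Decomposable H v₀ := by
  refine ⟨fun _ _ => False, fun v => Fintype.equivFin V v, by simp, by simp, by simp, by simp,
    Fin.val_injective.comp (Fintype.equivFin V).injective, by simp [h], fun v hv => ?_⟩
  exact absurd hv (h _ _)

/-- The root varies in the induction because a root of degree 1 hands its role to its neighbour.
Otherwise, a counterexample whose proper subgraphs are all decomposable is irreducible, hence has no
edges by discharging, and then it is trivially decomposable. -/
theorem PlaneEmbedding.decomposable [Fintype V] {G : SimpleGraph V} (E : PlaneEmbedding G)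
    (h4 : NoCycleOfLength G 4) (hF : FewTriangles G) (H : SimpleGraph V) (hH : H ≤ G) (v₀ : V) :
    Decomposable H v₀ := by
  induction H using WellFoundedLT.induction generalizing v₀ with
  | ind H ih =>
  by_cases h1 : deg H v₀ = 1
  · obtain ⟨w, hw⟩ := card_eq_one.mp h1
    have hlt : isolate H {v₀} < H := isolate_lt (mem_singleton_self v₀) (by omega)
    refine Decomposable.of_leaf (w := w) (fun x => ?_) (ih _ hlt (hlt.le.trans hH) w)
    simpa using Finset.ext_iff.mp hw x
  · by_contra hD
    have hI : Irreducible H v₀ := by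
      refine ⟨fun a b c d hab hbc hcd hda =>
        h4.four a b c d (hH hab) (hH hbc) (hH hcd) (hH hda), fun B hB v hv => ?_⟩
      by_contra hpos
      have hlt : isolate H B < H := isolate_lt hv (Nat.pos_of_ne_zero hpos)
      exact hD (hB.decomposable (ih _ hlt (hlt.le.trans hH) v₀))
    exact hD (decomposable_of_not_adj (hI.not_adj E hH (hF.mono hH) h1) v₀)

end Main

end AlonTarsi

theorem theorem3 {V : Type*} [Finite V] (l : ℕ) (hl : l = 5 ∨ l = 6 ∨ l = 7)
    (G : SimpleGraph V) (hG : AlonTarsi.PlanarFamily 4 l G)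
    (E : AlonTarsi.PlaneEmbedding G) (v₀ : V) (hv₀ : E.OnOuterBoundary v₀) :
    ∃ M : G.Subgraph, AlonTarsi.IsValidMatching v₀ M ∧
      ∃ D : Digraph V, AlonTarsi.IsGoodOrientation (G.deleteEdges M.edgeSet) v₀ D := by
  have := Fintype.ofFinite V
  obtain ⟨-, h4, h⟩ := hG
  exact (E.decomposable h4 (AlonTarsi.fewTriangles_of_noCycle hl h4 h) G le_rfl
    v₀).exists_goodOrientation
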